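/- Let $n\ge 2$, let $(M,g)$ be a smooth $n$-dimensional Lorentzian manifold of signature $(-,+,\dots,+)$ with Levi-Civita derivative $D$, and let $\mathcal H\subset M$ be a Killing horizon with generator $\xi$: $\xi$ is a smooth Killing vector field, and $\mathcal H$ is a hypersurface, locally $\{S=0\}$ with $dS\neq 0$, on which $\xi^\mu\xi_\mu=0$ and $\xi_\mu=f\,\partial_\mu S$ with $f\ne 0$. Its surface gravity $\kappa$ is defined by $\xi^\nu D_\nu\xi^\mu=\kappa\,\xi^\mu$ on $\mathcal H$. Let $(\delta g_{\mu\nu},\delta\xi^\mu)$ be a stationary variation: a smooth symmetric two-tensor and a smooth vector field with $$\mathcal L_\xi\delta g_{\mu\nu}+\mathcal L_{\delta\xi}g_{\mu\nu}=0 ,$$ for which the horizon stays at the same location, i.e. on $\mathcal H$, to first order, $\xi_\mu$ stays normal and null: $\delta(\xi_\mu)=\delta g_{\mu\nu}\xi^\nu+g_{\mu\nu}\delta\xi^\nu=\lambda\,\xi_\mu$ for some function $\lambda$, and $\delta(\xi_\mu\xi^\mu)=0$. The variation $\delta\kappa$ of the surface gravity is the function on $\mathcal H$ for which the equation $\xi^\nu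 D_\nu\xi^\mu=\kappa\,\xi^\mu$ holds on $\mathcal H$ to first order in $s$ for $g+s\,\delta g$, $\xi+s\,\delta\xi$, $\kappa+s\,\delta\kappa$. For a vector field $X$ put, with $(d^{n-p}x)_{\mu_1\dots\mu_p}=\frac{1}{p!(n-p)!}\epsilon_{\mu_1\dots\mu_n}dx^{\mu_{p+1}}\wedge\dots\wedge dx^{\mu_n}$ and Newton's constant $G>0$, $$k^K_{X}=\frac{\sqrt{-\det g}}{16\pi G}\,(D^\mu X^\nu-D^\nu X^\mu)\,(d^{n-2}x)_{\mu\nu},$$ $$I^n_{\delta g}\mathcal L_{EH}=\frac{\sqrt{-\det g}}{16\pi G}\,\bigl(g^{\mu\alpha}D^\beta\delta g_{\alpha\beta}-g^{\alpha\beta}D^\mu\delta g_{\alpha\beta}\bigr)\,(d^{n-1}x)_\mu .$$ Let $H\subset\mathcal H$ be a spacelike section: a compact embedded submanifold without boundary, of dimension $n-2$, on which $g$ induces a positive definite metric. Let $d\mathcal A$ be the area element of this metric and $\mathcal A=\oint_H d\mathcal A$. Let $N$ be the null vector field along $H$ orthogonal to $H$ with $N_\mu\xi^\mu=-1$. Integrals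 of $(n-2)$-forms over $H$ are taken with the orientation for which $\sqrt{-\det g}\,(d^{n-2}x)_{\mu\nu}=\frac12(\xi_\mu N_\nu-N_\mu\xi_\nu)\,d\mathcal A$ on $H$. Then $$\oint_H k^K_{\delta\xi}-\oint_H i_\xi I^n_{\delta g}\mathcal L_{EH}=-\frac{1}{8\pi G}\oint_H\delta\kappa\,d\mathcal A .$$ In particular, if $\delta\kappa$ is constant on $H$ (as it is when the surface gravity is constant on the horizon), then $$\oint_H k^K_{\delta\xi}-\oint_H i_\xi I^n_{\delta g}\mathcal L_{EH}=-\frac{\mathcal A}{8\pi G}\,\delta\kappa .$$ -/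

import Mathlib

open scoped Manifold ContDiff

noncomputable section

namespace KillingHorizon

/-- Coordinate space of dimension `n`. -/
abbrev Coord (n : ℕ) := EuclideanSpace ℝ (Fin n)

section Coordinates

/-! ### Tensor calculus in coordinates

`G` is a metric `g_{ij}`, `X` a vector field `X^i` and `T` a covariant two-tensor `T_{ij}`, all
given by their components as functions of the coordinates `u`. -/

variable {n : ℕ}

/-- The partial derivative `∂_k f`. -/
def pd (k : Fin n) (f : Coord n → ℝ) (u : Coord n) : ℝ :=
  fderiv ℝ f u (EuclideanSpace.single k 1)

/-- The Christoffel symbol `Γ^k_{ij}` of the Levi-Civita connection of `G`. -/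
def christoffel (G : Coord n → Matrix (Fin n) (Fin n) ℝ) (u : Coord n) (k i j : Fin n) : ℝ :=
  (1 / 2) * ∑ l, (G u)⁻¹ k l *
    (pd i (fun y => G y l j) u + pd j (fun y => G y l i) u - pd l (fun y => G y i j) u)

/-- The covariant derivative `D_k X^i`. -/
def covVector (G : Coord n → Matrix (Fin n) (Fin n) ℝ) (X : Coord n → Fin n → ℝ)
    (u : Coord n) (k i : Fin n) : ℝ :=
  pd k (fun y => X y i) u + ∑ l, christoffel G u i k l * X u l

/-- The covariant derivative `D_k T_{ij}`. -/
def covTensor (G T : Coord n → Matrix (Fin n) (Fin n) ℝ) (u : Coord n) (k i j : Fin n) : ℝ :=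
  pd k (fun y => T y i j) u - ∑ l, christoffel G u l k i * T u l j
    - ∑ l, christoffel G u l k j * T u i l

/-- The Lie derivative `(L_X T)_{ij} = X^r ∂_r T_{ij} + ∂_i X^r T_{rj} + ∂_j X^r T_{ir}`. -/
def lieDeriv (X : Coord n → Fin n → ℝ) (T : Coord n → Matrix (Fin n) (Fin n) ℝ)
    (u : Coord n) (i j : Fin n) : ℝ :=
  ∑ r, (X u r * pd r (fun y => T y i j) u
    + pd i (fun y => X y r) u * T u r j + pd j (fun y => X y r) u * T u i r)

/-- The acceleration `X^k D_k X^i`. -/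
def acceleration (G : Coord n → Matrix (Fin n) (Fin n) ℝ) (X : Coord n → Fin n → ℝ)
    (u : Coord n) (i : Fin n) : ℝ :=
  ∑ k, X u k * covVector G X u k i

/-- The raised covariant derivative `D^μ X^ν`. -/
def covVectorUp (G : Coord n → Matrix (Fin n) (Fin n) ℝ) (X : Coord n → Fin n → ℝ)
    (u : Coord n) (μ ν : Fin n) : ℝ :=
  ∑ k, (G u)⁻¹ μ k * covVector G X u k ν

/-- The vector `g^{μα} D^β T_{αβ} - g^{αβ} D^μ T_{αβ}`. -/
def thetaVector (G T : Coord n → Matrix (Fin n) (Fin n) ℝ) (u : Coord n) (μ : Fin n) : ℝ :=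
  (∑ α, ∑ β, ∑ k, (G u)⁻¹ μ α * (G u)⁻¹ β k * covTensor G T u k α β)
    - ∑ α, ∑ β, ∑ k, (G u)⁻¹ α β * (G u)⁻¹ μ k * covTensor G T u k α β

/-- The determinant of the `n` coordinate vectors `w 0, …, w (n-1)`. -/
def volDet (w : Fin n → Coord n) : ℝ := Matrix.det (Matrix.of fun a i => w a i)

/-- `(d^{n-1}x)_μ = 1/(n-1)! ε_{μ μ₂ … μ_n} dx^{μ₂} ∧ … ∧ dx^{μ_n}`, evaluated on `n - 1` vectors
(here `n = m + 1`). -/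
def codimOneForm {m : ℕ} (μ : Fin (m + 1)) (w : Fin m → Coord (m + 1)) : ℝ :=
  volDet (Fin.cons (EuclideanSpace.single μ 1) w)

/-- `(d^{n-2}x)_{μν} = 1/(2 (n-2)!) ε_{μ ν μ₃ … μ_n} dx^{μ₃} ∧ … ∧ dx^{μ_n}`, evaluated on `n - 2`
vectors (here `n = d + 2`). -/
def codimTwoForm {d : ℕ} (μ ν : Fin (d + 2)) (w : Fin d → Coord (d + 2)) : ℝ :=
  (1 / 2) * volDet (Fin.cons (EuclideanSpace.single μ 1)
    (Fin.cons (EuclideanSpace.single ν 1) w))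

/-- The Komar `(n-2)`-form
`k^K_X = √(-g) / (16 π G_N) (D^μ X^ν - D^ν X^μ) (d^{n-2}x)_{μν}`. -/
def komarForm {d : ℕ} (GN : ℝ) (G : Coord (d + 2) → Matrix (Fin (d + 2)) (Fin (d + 2)) ℝ)
    (X : Coord (d + 2) → Fin (d + 2) → ℝ) (u : Coord (d + 2)) (w : Fin d → Coord (d + 2)) : ℝ :=
  Real.sqrt (-(G u).det) / (16 * Real.pi * GN) *
    ∑ μ, ∑ ν, (covVectorUp G X u μ ν - covVectorUp G X u ν μ) * codimTwoForm μ ν w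

/-- The `(n-1)`-form
`I^n_T L_EH = √(-g) / (16 π G_N) (g^{μα} D^β T_{αβ} - g^{αβ} D^μ T_{αβ}) (d^{n-1}x)_μ`,
the boundary term in the variation of the Einstein-Hilbert Lagrangian under `δg = T`. -/
def thetaForm {m : ℕ} (GN : ℝ) (G T : Coord (m + 1) → Matrix (Fin (m + 1)) (Fin (m + 1)) ℝ)
    (u : Coord (m + 1)) (w : Fin m → Coord (m + 1)) : ℝ :=
  Real.sqrt (-(G u).det) / (16 * Real.pi * GN) * ∑ μ, thetaVector G T u μ * codimOneForm μ w

end Coordinates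

section Manifolds

variable {n : ℕ} {M : Type*} [TopologicalSpace M] [ChartedSpace (Coord n) M]

/-- Vector fields (no smoothness imposed). -/
abbrev VField (n : ℕ) (M : Type*) [TopologicalSpace M] [ChartedSpace (Coord n) M] :=
  (p : M) → TangentSpace (𝓡 n) p

/-- Fields of bilinear forms on the tangent spaces (no smoothness imposed). -/
abbrev TField (n : ℕ) (M : Type*) [TopologicalSpace M] [ChartedSpace (Coord n) M] :=
  (p : M) → TangentSpace (𝓡 n) p →L[ℝ] TangentSpace (𝓡 n) p →L[ℝ] ℝ

/-- The vector field `X` is smooth. -/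
def SmoothVector (X : VField n M) [IsManifold (𝓡 n) ∞ M] : Prop :=
  ContMDiff (𝓡 n) (𝓡 n).tangent ∞ (fun p => (⟨p, X p⟩ : TangentBundle (𝓡 n) M))

/-- The two-tensor `T` is smooth, as a section of the bundle of bilinear forms. -/
def SmoothTensor (T : TField n M) [IsManifold (𝓡 n) ∞ M] : Prop :=
  ContMDiff (𝓡 n) ((𝓡 n).prod 𝓘(ℝ, Coord n →L[ℝ] Coord n →L[ℝ] ℝ)) ∞
    (fun p => Bundle.TotalSpace.mk' (Coord n →L[ℝ] Coord n →L[ℝ] ℝ)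
      (E := fun q : M => TangentSpace (𝓡 n) q →L[ℝ] TangentSpace (𝓡 n) q →L[ℝ] ℝ) p (T p))

/-- `T` is symmetric. -/
def SymmTensor (T : TField n M) : Prop := ∀ p v w, T p v w = T p w v

/-- `g` is a smooth Lorentzian metric, of signature `(-, +, …, +)`. -/
structure IsLorentzMetric (g : TField n M) [IsManifold (𝓡 n) ∞ M] : Prop where
  smooth : SmoothTensor g
  symm : SymmTensor g
  signature : ∀ p, ∃ t, g p t t < 0 ∧ ∀ w, g p t w = 0 → w ≠ 0 → 0 < g p w w

/-- The coordinate vector `∂_i`, for the preferred chart around `x`, at the point of coordinates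
`u`. -/
def basisVec (x : M) (u : Coord n) (i : Fin n) :
    TangentSpace (𝓡 n) ((extChartAt (𝓡 n) x).symm u) :=
  mfderiv 𝓘(ℝ, Coord n) (𝓡 n) (extChartAt (𝓡 n) x).symm u (EuclideanSpace.single i 1)

/-- The coordinates of a tangent vector at `p`, in the preferred chart around `x`. -/
def vecCoord (x : M) {p : M} (w : TangentSpace (𝓡 n) p) : Coord n :=
  mfderiv (𝓡 n) 𝓘(ℝ, Coord n) (extChartAt (𝓡 n) x) p w

/-- The components `X^i` of a vector field in the preferred chart around `x`. -/
def coordVector (X : VField n M) (x : M) (u : Coord n) (i : Fin n) : ℝ :=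
  vecCoord x (X ((extChartAt (𝓡 n) x).symm u)) i

/-- The components `T_{ij}` of a two-tensor in the preferred chart around `x`. -/
def coordTensor (T : TField n M) (x : M) (u : Coord n) : Matrix (Fin n) (Fin n) ℝ :=
  Matrix.of fun i j => T ((extChartAt (𝓡 n) x).symm u) (basisVec x u i) (basisVec x u j)

/-- The Lie derivative `(L_X T)_{ij}` at the point `p`, in the preferred chart around `p`. -/
def lieAt (X : VField n M) (T : TField n M) (p : M) (i j : Fin n) : ℝ :=
  lieDeriv (coordVector X p) (coordTensor T p) (extChartAt (𝓡 n) p p) i j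

/-- The acceleration `(X^k D_k X^i)` at the point `p`, in the preferred chart around `p`. -/
def accelAt (g : TField n M) (X : VField n M) (p : M) (i : Fin n) : ℝ :=
  acceleration (coordTensor g p) (coordVector X p) (extChartAt (𝓡 n) p p) i

/-- `𝓗` is a Killing horizon of the metric `g` with generator `ξ`: `ξ` is a smooth Killing vector
field, and `𝓗` is a null hypersurface with normal `ξ`, that is, near each of its points it is a
level set `S = 0` of a smooth function with `dS ≠ 0`, and on it `ξ` is null and
`ξ_μ = f ∂_μ S` with `f ≠ 0`. -/
structure IsKillingHorizon (g : TField n M) (ξ : VField n M) (𝓗 : Set M)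
    [IsManifold (𝓡 n) ∞ M] : Prop where
  smooth : SmoothVector ξ
  killing : ∀ p i j, lieAt ξ g p i j = 0
  hypersurface : ∀ p ∈ 𝓗, ∃ U : Set M, IsOpen U ∧ p ∈ U ∧ ∃ S : M → ℝ,
    ContMDiffOn (𝓡 n) 𝓘(ℝ, ℝ) ∞ S U ∧ 𝓗 ∩ U = {q ∈ U | S q = 0} ∧
    ∀ q ∈ 𝓗 ∩ U, mvfderiv (𝓡 n) S q ≠ 0 ∧
      ∃ f : ℝ, f ≠ 0 ∧ ∀ w : TangentSpace (𝓡 n) q,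
        g q (ξ q) w = f * mvfderiv (𝓡 n) S q w
  null : ∀ p ∈ 𝓗, g p (ξ p) (ξ p) = 0

/-- `κ` is the surface gravity of the horizon: `ξ^ν D_ν ξ^μ = κ ξ^μ` on `𝓗`. -/
def IsSurfaceGravity (g : TField n M) (ξ : VField n M) (𝓗 : Set M) (κ : M → ℝ) : Prop :=
  ∀ p ∈ 𝓗, ∀ i, accelAt g ξ p i = κ p * vecCoord p (ξ p) i

/-- `(δg, δξ)` is a stationary variation of the Killing horizon: it is smooth, preserves the Killing
equation to first order, `L_ξ δg + L_δξ g = 0`, and leaves the horizon in place, in the sense that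
on `𝓗` the covector `ξ_μ` stays normal, `δ(ξ_μ) = λ ξ_μ`, and null, `δ(ξ_μ ξ^μ) = 0`, to first
order. -/
structure IsStationaryVariation (g : TField n M) (ξ : VField n M) (𝓗 : Set M)
    (δg : TField n M) (δξ : VField n M) [IsManifold (𝓡 n) ∞ M] : Prop where
  smooth_metric : SmoothTensor δg
  symm : SymmTensor δg
  smooth_vector : SmoothVector δξ
  stationary : ∀ p i j, lieAt ξ δg p i j + lieAt δξ g p i j = 0
  normal : ∀ p ∈ 𝓗, ∃ lam : ℝ, ∀ w, δg p (ξ p) w + g p (δξ p) w = lam * g p (ξ p) w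
  null : ∀ p ∈ 𝓗, δg p (ξ p) (ξ p) + 2 * g p (δξ p) (ξ p) = 0

/-- `δκ` is the variation of the surface gravity: the equation `ξ^ν D_ν ξ^μ = κ ξ^μ` defining `κ`
holds on `𝓗` to first order in `s` for `g + s δg`, `ξ + s δξ`, `κ + s δκ`. -/
def IsSurfaceGravityVariation (g : TField n M) (ξ : VField n M) (𝓗 : Set M)
    (δg : TField n M) (δξ : VField n M) (κ δκ : M → ℝ) : Prop :=
  ∀ p ∈ 𝓗, ∀ i, HasDerivAt (fun s : ℝ =>
    accelAt (fun q => g q + s • δg q) (fun q => ξ q + s • δξ q) p i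
      - (κ p + s * δκ p) * vecCoord p (ξ p + s • δξ p) i) 0 0

end Manifolds

section Integration

variable {d : ℕ} {H : Type*} [TopologicalSpace H] [ChartedSpace (Coord d) H]

/-- The integral over a compact `d`-dimensional manifold `H` of a density `dens` (a function of
`d` tangent vectors which is multiplied by `|det A|` when they are transformed by a matrix `A`),
computed with a partition of unity `ρ` subordinate to the charts. -/
def integral (ρ : SmoothPartitionOfUnity H (𝓡 d) H Set.univ)
    (dens : (q : H) → (Fin d → TangentSpace (𝓡 d) q) → ℝ) : ℝ :=
  ∑ᶠ c : H, ∫ u in (extChartAt (𝓡 d) c).target,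
    ρ c ((extChartAt (𝓡 d) c).symm u) *
      dens ((extChartAt (𝓡 d) c).symm u) (fun a => basisVec c u a)

end Integration

section Section

variable {d : ℕ} {M : Type*} [TopologicalSpace M] [ChartedSpace (Coord (d + 2)) M]
  {H : Type*} [TopologicalSpace H] [ChartedSpace (Coord d) H]

/-- The differential of `ι : H → M`. -/
def push (ι : H → M) (q : H) (w : TangentSpace (𝓡 d) q) : TangentSpace (𝓡 (d + 2)) (ι q) :=
  mfderiv (𝓡 d) (𝓡 (d + 2)) ι q w

/-- `ι` embeds the `(n-2)`-manifold `H` (compact in the theorem) as a spacelike submanifold of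
`𝓗`. -/
structure IsSpacelikeSection (g : TField (d + 2) M) (𝓗 : Set M) (ι : H → M) : Prop where
  smooth : ContMDiff (𝓡 d) (𝓡 (d + 2)) ∞ ι
  injective : Function.Injective ι
  mem : ∀ q, ι q ∈ 𝓗
  spacelike : ∀ (q : H) (w : TangentSpace (𝓡 d) q), w ≠ 0 →
    0 < g (ι q) (push ι q w) (push ι q w)

/-- `N` is the transverse null normal of `H`: `N² = 0`, `N · ξ = -1` and `N ⟂ TH`. -/
structure IsTransverseNull (g : TField (d + 2) M) (ξ : VField (d + 2) M) (ι : H → M)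
    (N : (q : H) → TangentSpace (𝓡 (d + 2)) (ι q)) : Prop where
  null : ∀ q, g (ι q) (N q) (N q) = 0
  normalized : ∀ q, g (ι q) (N q) (ξ (ι q)) = -1
  orthogonal : ∀ (q : H) (w : TangentSpace (𝓡 d) q), g (ι q) (N q) (push ι q w) = 0

/-- The area density `dA` of the metric induced on `H`. -/
def areaDensity (g : TField (d + 2) M) (ι : H → M) (q : H)
    (w : Fin d → TangentSpace (𝓡 d) q) : ℝ :=
  Real.sqrt (Matrix.det (Matrix.of fun a b => g (ι q) (push ι q (w a)) (push ι q (w b))))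

/-- The orientation sign of tangent vectors `w` to `H`: they are positive when `(N, ξ, w)` is
positive for the coordinate orientation which defines `(d^{n-2}x)_{μν}`. This is the orientation
for which `√(-g) (d^{n-2}x)_{μν} = (1/2) (ξ_μ N_ν - N_μ ξ_ν) dA` on `H`. -/
def orientSign (ξ : VField (d + 2) M) (ι : H → M)
    (N : (q : H) → TangentSpace (𝓡 (d + 2)) (ι q)) (q : H)
    (w : Fin d → TangentSpace (𝓡 d) q) : ℝ :=
  Real.sign (volDet (Fin.cons (vecCoord (ι q) (N q)) (Fin.cons (vecCoord (ι q) (ξ (ι q)))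
    (fun a => vecCoord (ι q) (push ι q (w a))))))

/-- The pull-back to `H` of the Komar form `k^K_X`, as a density. -/
def komarDensity (GN : ℝ) (g : TField (d + 2) M) (ξ : VField (d + 2) M) (ι : H → M)
    (N : (q : H) → TangentSpace (𝓡 (d + 2)) (ι q)) (X : VField (d + 2) M) (q : H)
    (w : Fin d → TangentSpace (𝓡 d) q) : ℝ :=
  orientSign ξ ι N q w *
    komarForm GN (coordTensor g (ι q)) (coordVector X (ι q)) (extChartAt (𝓡 (d + 2)) (ι q) (ι q))
      (fun a => vecCoord (ι q) (push ι q (w a)))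

/-- The pull-back to `H` of the form `i_ξ I^n_T L_EH`, as a density. -/
def thetaDensity (GN : ℝ) (g : TField (d + 2) M) (ξ : VField (d + 2) M) (ι : H → M)
    (N : (q : H) → TangentSpace (𝓡 (d + 2)) (ι q)) (T : TField (d + 2) M) (q : H)
    (w : Fin d → TangentSpace (𝓡 d) q) : ℝ :=
  orientSign ξ ι N q w *
    thetaForm GN (coordTensor g (ι q)) (coordTensor T (ι q))
      (extChartAt (𝓡 (d + 2)) (ι q) (ι q))
      (Fin.cons (vecCoord (ι q) (ξ (ι q))) (fun a => vecCoord (ι q) (push ι q (w a))))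

end Section

end KillingHorizon

end

open scoped Manifold ContDiff
set_option linter.unusedSectionVars false

noncomputable section

namespace KillingHorizon

/-! ### Tensor and vector fields read in the preferred charts of a manifold. -/

section Charts

variable {n : ℕ} {M : Type*} [TopologicalSpace M] [ChartedSpace (Coord n) M]

/-! Write `a = δξ`, `h = δg`, `A = Dξ`, `B = Da`. Along `H` there is the null frame `(N, ξ, e_i)`,
with Gram matrix `γ_ij = g(e_i, e_j)` on `TH` and inverse metric `-ξ⊗N - N⊗ξ + γ^{ij} e_i⊗e_j`. In
this frame both forms become multiples of the area element (`komarForm_eq`, `thetaForm_eq`), because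
`-det g · vol(N, ξ, e)² = det γ`. Up to the factor `1/(16πG)`, the integrand of the left-hand side
is `g(D_ξ a, N) - g(D_N a, ξ) + ξ_μ θ^μ`, where `θ^μ = D_β h^{μβ} - D^μ h`.

The heart is the pointwise identity `komar_add_theta_eq`: this scalar equals `-2 δκ + γ^{ij} g(D_i
a, e_j)`. It is linear algebra from five facts. The Killing equation makes `A` antisymmetric, so its
trace against the symmetric `h` vanishes. Stationarity expresses `D_ξ h` through `A` and `B`. The
condition `δ(ξ_μ) = λ ξ_μ` holds at the point, and it may also be differentiated in directions
tangent to the horizon, up to a multiple of `ξ_μ`. Finally, the equation defining `κ` holds together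
with its first variation. `komar_add_thetaContr` verifies these inputs in coordinates.

The remaining trace is a divergence on `H`. Normality and nullness together give `g(a, ξ) = 0`, so
`a` is a multiple of `ξ` plus a field tangent to `H`. The multiple of `ξ` contributes nothing: the
second fundamental form of `H` along `ξ` is symmetric, and antisymmetric by the Killing equation, so
it is zero. Hence the trace is the intrinsic divergence of the tangent part (`sum_fderiv_sqrt_det`),
and it integrates to zero over the closed manifold `H` (`sum_integral_surfaceDiv`).

Splitting the integral requires integrability, although `κ`, `δκ` and `N` are arbitrary functions
and the field equations are imposed only at the centre of each preferred chart. Continuity is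
recovered from identities that hold in any chart: `-½ d(ξ²) = κ ξ_μ` and its variation for `δκ`, and
the exterior derivative of `g(a, ·)` for the Komar density. -/

/-- The tangent map of the inverse of the preferred chart around `x`. -/
def chartFrame (x : M) (u : Coord n) : Coord n →L[ℝ] Coord n :=
  (mfderiv 𝓘(ℝ, Coord n) (𝓡 n) (extChartAt (𝓡 n) x).symm u :)

/-- A field of bilinear forms, with the tangent spaces identified with the model space. -/
def TField.form (T : TField n M) (p : M) : Coord n →L[ℝ] Coord n →L[ℝ] ℝ := (T p :)

/-- A vector field in the preferred chart around `x`. -/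
def vecIn (X : VField n M) (x : M) (u : Coord n) : Coord n :=
  vecCoord x (X ((extChartAt (𝓡 n) x).symm u))

/-- A two-tensor in the preferred chart around `x`. -/
def tensorIn (T : TField n M) (x : M) (u : Coord n) : Coord n →L[ℝ] Coord n →L[ℝ] ℝ :=
  (T.form ((extChartAt (𝓡 n) x).symm u)).bilinearComp (chartFrame x u) (chartFrame x u)

lemma tensorIn_apply (T : TField n M) (x : M) (u v w : Coord n) :
    tensorIn T x u v w
      = T ((extChartAt (𝓡 n) x).symm u) (chartFrame x u v) (chartFrame x u w) := rfl

lemma target_mem_nhds {x : M} {u : Coord n} (hu : u ∈ (extChartAt (𝓡 n) x).target) :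
    (extChartAt (𝓡 n) x).target ∈ nhds u :=
  (isOpen_extChartAt_target x).mem_nhds hu

lemma exists_chart_point {x p : M} (hp : p ∈ (chartAt (Coord n) x).source) :
    ∃ u ∈ (extChartAt (𝓡 n) x).target, (extChartAt (𝓡 n) x).symm u = p :=
  have hp' : p ∈ (extChartAt (𝓡 n) x).source := by rwa [extChartAt_source]
  ⟨_, (extChartAt (𝓡 n) x).map_source hp', (extChartAt (𝓡 n) x).left_inv hp'⟩

variable [IsManifold (𝓡 n) ∞ M]

lemma mdifferentiableAt_symm {x : M} {u : Coord n} (hu : u ∈ (extChartAt (𝓡 n) x).target) :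
    MDifferentiableAt 𝓘(ℝ, Coord n) (𝓡 n) (extChartAt (𝓡 n) x).symm u :=
  ((contMDiffOn_extChartAt_symm (I := 𝓡 n) (n := ∞) x).contMDiffAt
    (target_mem_nhds hu)).mdifferentiableAt (by simp)

lemma vecCoord_chartFrame {x : M} {u : Coord n} (hu : u ∈ (extChartAt (𝓡 n) x).target)
    (v : Coord n) :
    vecCoord x (p := (extChartAt (𝓡 n) x).symm u) (chartFrame x u v) = v := by
  have : IsManifold (𝓡 n) 1 M := IsManifold.of_le (n := ∞) (by simp)
  have h := mfderiv_extChartAt_comp_mfderivWithin_extChartAt_symm (I := 𝓡 n) hu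
  rw [modelWithCornersSelf_coe, Set.range_id, mfderivWithin_univ] at h
  exact DFunLike.congr_fun h v

lemma chartFrame_vecCoord {x : M} {u : Coord n} (hu : u ∈ (extChartAt (𝓡 n) x).target)
    (w : TangentSpace (𝓡 n) ((extChartAt (𝓡 n) x).symm u)) :
    chartFrame x u (vecCoord x w) = w := by
  have : IsManifold (𝓡 n) 1 M := IsManifold.of_le (n := ∞) (by simp)
  have h := mfderivWithin_extChartAt_symm_comp_mfderiv_extChartAt (I := 𝓡 n) hu
  rw [modelWithCornersSelf_coe, Set.range_id, mfderivWithin_univ] at h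
  exact DFunLike.congr_fun h w

lemma tensorIn_vecCoord (T : TField n M) {x p : M} (hp : p ∈ (chartAt (Coord n) x).source)
    (v w : TangentSpace (𝓡 n) p) :
    tensorIn T x (extChartAt (𝓡 n) x p) (vecCoord x v) (vecCoord x w) = T p v w := by
  obtain ⟨u, hu, rfl⟩ := exists_chart_point hp
  rw [(extChartAt (𝓡 n) x).right_inv hu, tensorIn_apply, chartFrame_vecCoord hu,
    chartFrame_vecCoord hu]

lemma vecIn_extChartAt (X : VField n M) {x p : M} (hp : p ∈ (chartAt (Coord n) x).source) :
    vecIn X x (extChartAt (𝓡 n) x p) = vecCoord x (X p) := by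
  obtain ⟨u, hu, rfl⟩ := exists_chart_point hp
  rw [(extChartAt (𝓡 n) x).right_inv hu, vecIn]

/-- This field is the tangent map of the inverse chart applied to the constant field `v` of the
model space. -/
lemma contMDiffOn_chartFrame (x : M) (v : Coord n) :
    ContMDiffOn 𝓘(ℝ, Coord n) (𝓡 n).tangent ∞
      (fun u => (⟨(extChartAt (𝓡 n) x).symm u, chartFrame x u v⟩ : TangentBundle (𝓡 n) M))
      (extChartAt (𝓡 n) x).target := by
  have h1 := contMDiffOn_extChartAt_symm (I := 𝓡 n) (n := ∞) x
  have h2 := h1.contMDiffOn_tangentMapWithin (m := ∞) (by simp)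
    (isOpen_extChartAt_target x).uniqueMDiffOn
  have h3 : ContMDiff 𝓘(ℝ, Coord n) 𝓘(ℝ, Coord n).tangent ∞
      (fun u : Coord n => (⟨u, v⟩ : TangentBundle 𝓘(ℝ, Coord n) (Coord n))) :=
    contMDiff_vectorSpace_iff_contDiff.2 contDiff_const
  refine (h2.comp h3.contMDiffOn (fun u hu => hu)).congr fun u hu => ?_
  have h4 := mfderivWithin_of_mem_nhds (I := 𝓘(ℝ, Coord n)) (I' := 𝓡 n)
    (f := (extChartAt (𝓡 n) x).symm) (target_mem_nhds hu)
  simp only [Function.comp, tangentMapWithin, chartFrame]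
  exact congrArg (fun L : Coord n →L[ℝ] Coord n =>
    (⟨(extChartAt (𝓡 n) x).symm u, L v⟩ : TangentBundle (𝓡 n) M)) h4.symm

/-- Evaluating the section on two chart frame fields leaves scalar functions, for which bundle
smoothness and ordinary smoothness agree. -/
lemma contDiffOn_tensorIn {T : TField n M} (hT : SmoothTensor T) (x : M) :
    ContDiffOn ℝ ∞ (tensorIn T x) (extChartAt (𝓡 n) x).target := by
  have h1 := contMDiffOn_extChartAt_symm (I := 𝓡 n) (n := ∞) x
  rw [contDiffOn_clm_apply]
  intro v
  rw [contDiffOn_clm_apply]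
  intro w
  have h := ContMDiffOn.clm_bundle_apply₂ (F₁ := Coord n) (F₂ := Coord n) (F₃ := ℝ)
    (E₁ := fun q : M => TangentSpace (𝓡 n) q) (E₂ := fun q : M => TangentSpace (𝓡 n) q)
    (E₃ := fun _ : M => ℝ)
    (hT.comp_contMDiffOn h1) (contMDiffOn_chartFrame x v) (contMDiffOn_chartFrame x w)
  intro u hu
  have h' := h u hu
  rw [Bundle.contMDiffWithinAt_totalSpace] at h'
  have h'' : ContMDiffWithinAt 𝓘(ℝ, Coord n) 𝓘(ℝ, ℝ) ∞ (fun u => tensorIn T x u v w)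
    (extChartAt (𝓡 n) x).target u := h'.2
  exact contMDiffWithinAt_iff_contDiffWithinAt.1 h''

/-- The tangent map of the chart carries `X` to the trivial bundle over the model space, where the
fibre component is the coordinate expression. -/
lemma contDiffOn_vecIn {X : VField n M} (hX : SmoothVector X) (x : M) :
    ContDiffOn ℝ ∞ (vecIn X x) (extChartAt (𝓡 n) x).target := by
  have h1 := contMDiffOn_extChartAt_symm (I := 𝓡 n) (n := ∞) x
  have h2 := contMDiffOn_extChartAt (I := 𝓡 n) (n := ∞) (x := x)
  have h3 := h2.contMDiffOn_tangentMapWithin (m := ∞) (by simp)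
    ((chartAt (Coord n) x).open_source.uniqueMDiffOn)
  have hs : ∀ u ∈ (extChartAt (𝓡 n) x).target,
      (extChartAt (𝓡 n) x).symm u ∈ (chartAt (Coord n) x).source := fun u hu => by
    rw [← extChartAt_source (𝓡 n)]
    exact (extChartAt (𝓡 n) x).map_target hu
  have h4 := h3.comp (ContMDiff.comp_contMDiffOn hX h1) hs
  intro u hu
  have h' := h4 u hu
  rw [Bundle.contMDiffWithinAt_totalSpace] at h'
  have h'' := h'.2
  have h5 : ContMDiffWithinAt 𝓘(ℝ, Coord n) 𝓘(ℝ, Coord n) ∞ (vecIn X x)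
      (extChartAt (𝓡 n) x).target u := by
    have key : ∀ y ∈ (extChartAt (𝓡 n) x).target, vecIn X x y =
      mfderivWithin (𝓡 n) 𝓘(ℝ, Coord n) (extChartAt (𝓡 n) x) (chartAt (Coord n) x).source
        ((extChartAt (𝓡 n) x).symm y) (X ((extChartAt (𝓡 n) x).symm y)) := fun y hy => by
      rw [mfderivWithin_of_mem_nhds ((chartAt (Coord n) x).open_source.mem_nhds (hs y hy))]
      rfl
    refine ContMDiffWithinAt.congr ?_ key (key u hu)
    simp at h''
    simp
    exact h''
  exact contMDiffWithinAt_iff_contDiffWithinAt.1 h5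

/-- The coordinate change between two preferred charts. -/
def chartChange (x y : M) (u : Coord n) : Coord n :=
  extChartAt (𝓡 n) y ((extChartAt (𝓡 n) x).symm u)

lemma contDiffAt_chartChange {x y : M} {u : Coord n} (hu : u ∈ (extChartAt (𝓡 n) x).target)
    (hy : (extChartAt (𝓡 n) x).symm u ∈ (chartAt (Coord n) y).source) :
    ContDiffAt ℝ ∞ (chartChange x y) u := by
  have h1 := (contMDiffOn_extChartAt_symm (I := 𝓡 n) (n := ∞) x).contMDiffAt
    (target_mem_nhds hu)
  have h2 := (contMDiffOn_extChartAt (I := 𝓡 n) (n := ∞) (x := y)).contMDiffAt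
    ((chartAt (Coord n) y).open_source.mem_nhds hy)
  exact contMDiffAt_iff_contDiffAt.1 (h2.comp u h1)

lemma fderiv_chartChange {x y : M} {u : Coord n} (hu : u ∈ (extChartAt (𝓡 n) x).target)
    (hy : (extChartAt (𝓡 n) x).symm u ∈ (chartAt (Coord n) y).source) (v : Coord n) :
    fderiv ℝ (chartChange x y) u v
      = vecCoord y (p := (extChartAt (𝓡 n) x).symm u) (chartFrame x u v) := by
  have : IsManifold (𝓡 n) 1 M := IsManifold.of_le (n := ∞) (by simp)
  have h2 := mdifferentiableAt_extChartAt (I := 𝓡 n) hy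
  have h := mfderiv_comp u h2 (mdifferentiableAt_symm hu)
  have h' := mfderiv_eq_fderiv (𝕜 := ℝ) (f := chartChange x y) (x := u)
  exact DFunLike.congr_fun (h'.symm.trans h) v

lemma eventually_mem_source {x y : M} {u : Coord n} (hu : u ∈ (extChartAt (𝓡 n) x).target)
    (hy : (extChartAt (𝓡 n) x).symm u ∈ (chartAt (Coord n) y).source) :
    ∀ᶠ z in nhds u, z ∈ (extChartAt (𝓡 n) x).target ∧
      (extChartAt (𝓡 n) x).symm z ∈ (chartAt (Coord n) y).source := by
  refine Filter.Eventually.and (target_mem_nhds hu) ?_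
  exact (mdifferentiableAt_symm hu).continuousAt.eventually
    ((chartAt (Coord n) y).open_source.mem_nhds hy)

lemma vecIn_chartChange (X : VField n M) {x y : M} {u : Coord n}
    (hu : u ∈ (extChartAt (𝓡 n) x).target)
    (hy : (extChartAt (𝓡 n) x).symm u ∈ (chartAt (Coord n) y).source) :
    vecIn X y (chartChange x y u) = fderiv ℝ (chartChange x y) u (vecIn X x u) := by
  have h : chartFrame x u (vecIn X x u) = X ((extChartAt (𝓡 n) x).symm u) :=
    chartFrame_vecCoord hu _
  rw [fderiv_chartChange hu hy]
  exact (vecIn_extChartAt X hy).trans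
    (congrArg (fun w => vecCoord y (p := (extChartAt (𝓡 n) x).symm u) w) h.symm)

lemma tensorIn_chartChange (T : TField n M) {x y : M} {u : Coord n}
    (hu : u ∈ (extChartAt (𝓡 n) x).target)
    (hy : (extChartAt (𝓡 n) x).symm u ∈ (chartAt (Coord n) y).source) (v w : Coord n) :
    tensorIn T y (chartChange x y u) (fderiv ℝ (chartChange x y) u v)
      (fderiv ℝ (chartChange x y) u w) = tensorIn T x u v w := by
  rw [fderiv_chartChange hu hy, fderiv_chartChange hu hy]
  exact tensorIn_vecCoord T hy _ _

lemma fderiv_comp_symm {S : M → ℝ} {x : M} {u : Coord n}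
    (hu : u ∈ (extChartAt (𝓡 n) x).target)
    (hS : MDifferentiableAt (𝓡 n) 𝓘(ℝ, ℝ) S ((extChartAt (𝓡 n) x).symm u)) (v : Coord n) :
    fderiv ℝ (fun z => S ((extChartAt (𝓡 n) x).symm z)) u v
      = mvfderiv (𝓡 n) S ((extChartAt (𝓡 n) x).symm u) (chartFrame x u v) := by
  have h := mfderiv_comp u hS (mdifferentiableAt_symm hu)
  have h' := mfderiv_eq_fderiv (𝕜 := ℝ) (f := fun z => S ((extChartAt (𝓡 n) x).symm z)) (x := u)
  exact DFunLike.congr_fun (h'.symm.trans h) v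

end Charts

/-! ### A map between manifolds read in charts. -/

section Push

variable {d m : ℕ} {M : Type*} [TopologicalSpace M] [ChartedSpace (Coord (d + 2)) M]
  {H : Type*} [TopologicalSpace H] [ChartedSpace (Coord d) H]
  [IsManifold (𝓡 (d + 2)) ∞ M] [IsManifold (𝓡 d) ∞ H]

/-- A map `ι : H → M` in the preferred charts around `c` and `x`. -/
def mapIn (ι : H → M) (c : H) (x : M) (u : Coord d) : Coord (d + 2) :=
  extChartAt (𝓡 (d + 2)) x (ι ((extChartAt (𝓡 d) c).symm u))

variable {ι : H → M}

lemma contDiffAt_mapIn (hι : ContMDiff (𝓡 d) (𝓡 (d + 2)) ∞ ι) {c : H} {x : M} {u : Coord d}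
    (hu : u ∈ (extChartAt (𝓡 d) c).target)
    (hx : ι ((extChartAt (𝓡 d) c).symm u) ∈ (chartAt (Coord (d + 2)) x).source) :
    ContDiffAt ℝ ∞ (mapIn ι c x) u := by
  have h1 := (contMDiffOn_extChartAt_symm (I := 𝓡 d) (n := ∞) c).contMDiffAt
    (target_mem_nhds hu)
  have h2 := (contMDiffOn_extChartAt (I := 𝓡 (d + 2)) (n := ∞) (x := x)).contMDiffAt
    ((chartAt (Coord (d + 2)) x).open_source.mem_nhds hx)
  exact contMDiffAt_iff_contDiffAt.1 (h2.comp u (hι.contMDiffAt.comp u h1))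

lemma fderiv_mapIn (hι : ContMDiff (𝓡 d) (𝓡 (d + 2)) ∞ ι) {c : H} {x : M} {u : Coord d}
    (hu : u ∈ (extChartAt (𝓡 d) c).target)
    (hx : ι ((extChartAt (𝓡 d) c).symm u) ∈ (chartAt (Coord (d + 2)) x).source)
    (v : Coord d) :
    fderiv ℝ (mapIn ι c x) u v
      = vecCoord x (push ι ((extChartAt (𝓡 d) c).symm u) (chartFrame c u v)) := by
  have : IsManifold (𝓡 (d + 2)) 1 M := IsManifold.of_le (n := ∞) (by simp)
  have h2 := mdifferentiableAt_extChartAt (I := 𝓡 (d + 2)) hx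
  have h3 := (hι.mdifferentiable (by simp)) ((extChartAt (𝓡 d) c).symm u)
  have h := mfderiv_comp u (h2.comp _ h3) (mdifferentiableAt_symm hu)
  have h4 := mfderiv_comp ((extChartAt (𝓡 d) c).symm u) h2 h3
  have h' := mfderiv_eq_fderiv (𝕜 := ℝ) (f := mapIn ι c x) (x := u)
  have h5 := DFunLike.congr_fun (h'.symm.trans h) v
  refine h5.trans ?_
  exact DFunLike.congr_fun h4 (chartFrame c u v)

lemma eventually_mapIn (hι : ContMDiff (𝓡 d) (𝓡 (d + 2)) ∞ ι) {c : H} {x : M} {u : Coord d}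
    (hu : u ∈ (extChartAt (𝓡 d) c).target)
    (hx : ι ((extChartAt (𝓡 d) c).symm u) ∈ (chartAt (Coord (d + 2)) x).source) :
    ∀ᶠ z in nhds u, z ∈ (extChartAt (𝓡 d) c).target ∧
      ι ((extChartAt (𝓡 d) c).symm z) ∈ (chartAt (Coord (d + 2)) x).source := by
  refine Filter.Eventually.and (target_mem_nhds hu) ?_
  exact (hι.continuous.continuousAt.comp (mdifferentiableAt_symm hu).continuousAt).eventually
    ((chartAt (Coord (d + 2)) x).open_source.mem_nhds hx)

lemma tensorIn_mapIn (hι : ContMDiff (𝓡 d) (𝓡 (d + 2)) ∞ ι) (T : TField (d + 2) M)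
    {c : H} {x : M} {u : Coord d}
    (hu : u ∈ (extChartAt (𝓡 d) c).target)
    (hx : ι ((extChartAt (𝓡 d) c).symm u) ∈ (chartAt (Coord (d + 2)) x).source)
    (v w : Coord d) :
    tensorIn T x (mapIn ι c x u) (fderiv ℝ (mapIn ι c x) u v) (fderiv ℝ (mapIn ι c x) u w)
      = T (ι ((extChartAt (𝓡 d) c).symm u))
        (push ι ((extChartAt (𝓡 d) c).symm u) (chartFrame c u v))
        (push ι ((extChartAt (𝓡 d) c).symm u) (chartFrame c u w)) := by
  rw [fderiv_mapIn hι hu hx, fderiv_mapIn hι hu hx, mapIn, tensorIn_vecCoord T hx]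

lemma tensorIn_vecIn_mapIn (hι : ContMDiff (𝓡 d) (𝓡 (d + 2)) ∞ ι) (T : TField (d + 2) M)
    (X : VField (d + 2) M) {c : H} {x : M} {u : Coord d}
    (hu : u ∈ (extChartAt (𝓡 d) c).target)
    (hx : ι ((extChartAt (𝓡 d) c).symm u) ∈ (chartAt (Coord (d + 2)) x).source)
    (v : Coord d) :
    tensorIn T x (mapIn ι c x u) (vecIn X x (mapIn ι c x u)) (fderiv ℝ (mapIn ι c x) u v)
      = T (ι ((extChartAt (𝓡 d) c).symm u)) (X (ι ((extChartAt (𝓡 d) c).symm u)))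
        (push ι ((extChartAt (𝓡 d) c).symm u) (chartFrame c u v)) := by
  rw [fderiv_mapIn hι hu hx, mapIn, vecIn_extChartAt X hx, tensorIn_vecCoord T hx]

end Push

/-! ### The algebraic core of the theorem. -/

/-- The pointwise identity behind the theorem. Here `A = Dξ`, `B = Dδξ`, `Dh = Dδg`, and
`(ξ, N, e)` is a frame adapted to the horizon, with `γi` the inverse metric on the span of `e`. -/
theorem komar_add_theta_eq {E : Type*} {d : ℕ} (g h : E → E → ℝ) (Dh : E → E → E → ℝ)
    (A B : E → E) (ξ N a : E) (e : Fin d → E) (γi : Fin d → Fin d → ℝ) (lam κ δκ : ℝ)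
    (hγi : ∀ i j, γi i j = γi j i)
    (hg : ∀ v w, g v w = g w v) (hh : ∀ v w, h v w = h w v)
    (hDh : ∀ v w z, Dh v w z = Dh v z w)
    (hA : ∀ v w, g (A v) w + g v (A w) = 0)
    (stat : ∀ v w, Dh ξ v w + h (A v) w + h v (A w) + g (B v) w + g v (B w) = 0)
    (hb : ∀ v, h ξ v + g a v = lam * g ξ v)
    (tang : ∀ v, g ξ v = 0 → ∃ μ, ∀ w,
      Dh v ξ w + h (A v) w + g (B v) w = lam * g (A v) w + μ * g ξ w)
    (hξ : g ξ ξ = 0)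
    (acc : ∀ w, g (A ξ) w = κ * g ξ w)
    (dk : ∀ w, h (A ξ) w + g (B ξ) w + g (A a) w + Dh ξ ξ w - (1 / 2) * Dh w ξ ξ
      = δκ * g ξ w + κ * (h ξ w + g a w))
    (hNξ : g N ξ = -1) (heξ : ∀ i, g ξ (e i) = 0)
    (trA : -h (A ξ) N - h (A N) ξ + ∑ i, ∑ j, γi i j * h (A (e i)) (e j) = 0) :
    g (B ξ) N - g (B N) ξ
        + (-Dh ξ N ξ - Dh N ξ ξ + ∑ i, ∑ j, γi i j * Dh (e i) (e j) ξ)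
        - (-Dh ξ ξ N - Dh ξ N ξ + ∑ i, ∑ j, γi i j * Dh ξ (e i) (e j))
      = -2 * δκ + ∑ i, ∑ j, γi i j * g (B (e i)) (e j) := by
  have swap : ∀ f : Fin d → Fin d → ℝ,
      ∑ i, ∑ j, γi i j * f j i = ∑ i, ∑ j, γi i j * f i j := fun f => by
    rw [Finset.sum_comm]
    exact Finset.sum_congr rfl fun i _ => Finset.sum_congr rfl fun j _ => by rw [hγi]
  have hAA : ∑ i, ∑ j, γi i j * g (A (e i)) (e j) = 0 := by
    have h1 := swap fun i j => g (A (e i)) (e j)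
    have h2 : ∑ i, ∑ j, γi i j * g (A (e j)) (e i)
        = -∑ i, ∑ j, γi i j * g (A (e i)) (e j) := by
      rw [← Finset.sum_neg_distrib]
      refine Finset.sum_congr rfl fun i _ => ?_
      rw [← Finset.sum_neg_distrib]
      refine Finset.sum_congr rfl fun j _ => ?_
      have := hA (e i) (e j)
      rw [hg (e i)] at this
      rw [← eq_neg_iff_add_eq_zero] at this
      rw [this]; ring
    linarith
  -- The relation `tang`, traced over the section: the `λ` term is the trace `hAA` of an
  -- antisymmetric form, and the `μ` term dies because `e_j` is orthogonal to `ξ`.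
  have h1 : ∑ i, ∑ j, γi i j * Dh (e i) (e j) ξ + ∑ i, ∑ j, γi i j * h (A (e i)) (e j)
      + ∑ i, ∑ j, γi i j * g (B (e i)) (e j) = 0 := by
    rw [← mul_zero lam, ← hAA]
    simp only [Finset.mul_sum, ← Finset.sum_add_distrib]
    refine Finset.sum_congr rfl fun i _ => Finset.sum_congr rfl fun j _ => ?_
    obtain ⟨μ, hμ⟩ := tang (e i) (heξ i)
    have := hμ (e j)
    rw [heξ j] at this
    rw [hDh (e i)]
    linear_combination γi i j * this
  have h2 : ∑ i, ∑ j, γi i j * Dh ξ (e i) (e j) + 2 * ∑ i, ∑ j, γi i j * h (A (e i)) (e j)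
      + 2 * ∑ i, ∑ j, γi i j * g (B (e i)) (e j) = 0 := by
    rw [two_mul, two_mul]
    nth_rw 2 [← swap fun i j => h (A (e i)) (e j)]
    nth_rw 2 [← swap fun i j => g (B (e i)) (e j)]
    simp only [← Finset.sum_add_distrib]
    refine Finset.sum_eq_zero fun i _ => Finset.sum_eq_zero fun j _ => ?_
    have := stat (e i) (e j)
    rw [hh (e i), hg (e i)] at this
    linear_combination γi i j * this
  -- The traces over `e` are settled by `h1`, `h2` and `trA`; the transverse terms remain. Put `P =
  -- Dh ξ ξ N + h(Aξ, N) + g(Bξ, N)`. Contracting `dk` with `N` and removing `g(A a, N)` by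
  -- antisymmetry and `hb` gives `P + h(ξ, AN) - ½ Dh N ξ ξ = -δκ`, while `stat` gives `-g(BN, ξ) =
  -- P + h(ξ, AN)`. Together these produce `-2 δκ`.
  obtain ⟨μ, hμ⟩ := tang ξ hξ
  have t1 := hμ N
  have t2 := stat ξ N
  have t3 := hb (A N)
  have t4 := dk N
  have t5 := hA ξ N
  have t6 := acc N
  have t7 := hA a N
  have t8 := hb N
  rw [hg ξ N, hNξ] at t1 t4 t6 t8
  rw [hDh ξ N ξ]
  rw [hg ξ (B N)] at t2
  rw [hh (A N) ξ] at trA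
  rw [t6] at t5 t1
  have t9 : lam * g ξ (A N) = lam * κ := by rw [show g ξ (A N) = κ by linarith]
  rw [t8] at t4
  linarith

/-! ### Linear algebra of a frame adapted to a null hypersurface. -/

section Frame

variable {d : ℕ}

/-- Bilinear forms in terms of their components. -/
lemma clm_apply_eq_sum {n : ℕ} (g : Coord n →L[ℝ] Coord n →L[ℝ] ℝ) (v w : Coord n) :
    g v w = ∑ i, ∑ j, v i * w j
      * g (EuclideanSpace.single i 1) (EuclideanSpace.single j 1) := by
  have key : ∀ v : Coord n, v = ∑ i, v i • EuclideanSpace.single i (1 : ℝ) := fun v => by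
    ext j
    simp [Finset.sum_apply, Pi.single_apply]
  conv_lhs => rw [key v, key w]
  simp only [map_sum, map_smul, _root_.sum_apply, smul_eq_mul,
    _root_.smul_apply, Finset.mul_sum]
  rw [Finset.sum_comm]
  refine Finset.sum_congr rfl fun i _ => Finset.sum_congr rfl fun j _ => by ring

/-- The Gram determinant of a frame `(N, ξ, e)` with `N, ξ` null, `N · ξ = -1` and `e` orthogonal
to both. -/
lemma det_adapted (P : Matrix (Fin (d + 2)) (Fin (d + 2)) ℝ) (γ : Matrix (Fin d) (Fin d) ℝ)
    (h00 : P 0 0 = 0) (h01 : P 0 1 = -1) (h10 : P 1 0 = -1)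
    (h0 : ∀ k : Fin d, P 0 k.succ.succ = 0) (h1 : ∀ k : Fin d, P 1 k.succ.succ = 0)
    (hγ : ∀ i j : Fin d, P i.succ.succ j.succ.succ = γ i j) : P.det = -γ.det := by
  rw [Matrix.det_succ_row_zero, Fin.sum_univ_succ, Fin.sum_univ_succ]
  have e1 : (Fin.succ 0 : Fin (d + 2)) = 1 := rfl
  simp only [h00, e1, h01, h0, mul_zero, zero_mul, Finset.sum_const_zero, add_zero, zero_add]
  rw [Matrix.det_succ_row_zero, Fin.sum_univ_succ]
  have e2 : ∀ k : Fin d, (Fin.succAbove (1 : Fin (d + 2)) k.succ) = k.succ.succ := fun k => by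
    rw [← e1, Fin.succ_succAbove_succ, Fin.zero_succAbove]
  have e3 : (Fin.succAbove (1 : Fin (d + 2)) 0) = 0 := by
    rw [← e1, Fin.succ_succAbove_zero]
  simp only [Matrix.submatrix_apply, e1, e2, e3, h1, h10, mul_zero, zero_mul,
    Finset.sum_const_zero, add_zero]
  have e4 : ((P.submatrix Fin.succ (Fin.succAbove 1)).submatrix Fin.succ (Fin.succAbove 0)) = γ := by
    ext i j
    simp only [Matrix.submatrix_apply, Fin.zero_succAbove, e2, hγ]
  rw [e4]
  simp

/-- A frame `(N, ξ, e)` adapted to a horizon cross-section. -/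
structure IsAdaptedFrame (g : Coord (d + 2) →L[ℝ] Coord (d + 2) →L[ℝ] ℝ)
    (N ξ : Coord (d + 2)) (e : Fin d → Coord (d + 2)) (γ : Matrix (Fin d) (Fin d) ℝ) : Prop where
  symm : ∀ v w, g v w = g w v
  nullN : g N N = 0
  nullξ : g ξ ξ = 0
  norm : g N ξ = -1
  orthN : ∀ i, g N (e i) = 0
  orthξ : ∀ i, g ξ (e i) = 0
  gram : ∀ i j, γ i j = g (e i) (e j)
  posDet : 0 < γ.det

namespace IsAdaptedFrame

variable {g : Coord (d + 2) →L[ℝ] Coord (d + 2) →L[ℝ] ℝ} {N ξ : Coord (d + 2)}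
  {e : Fin d → Coord (d + 2)} {γ : Matrix (Fin d) (Fin d) ℝ}

/-- The components of a bilinear form. -/
def _root_.KillingHorizon.comps {n : ℕ} (g : Coord n →L[ℝ] Coord n →L[ℝ] ℝ) :
    Matrix (Fin n) (Fin n) ℝ :=
  Matrix.of fun i j => g (EuclideanSpace.single i 1) (EuclideanSpace.single j 1)

/-- With `W` the matrix of frame vectors, `W g Wᵀ` is the Gram matrix of the frame; compare
determinants using `det_adapted`. -/
lemma det_eq (hf : IsAdaptedFrame g N ξ e γ) :
    -(comps g).det * volDet (Fin.cons N (Fin.cons ξ e)) ^ 2 = γ.det := by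
  set f : Fin (d + 2) → Coord (d + 2) := Fin.cons N (Fin.cons ξ e) with hfdef
  set W : Matrix (Fin (d + 2)) (Fin (d + 2)) ℝ := Matrix.of fun a i => f a i with hW
  have hP : ∀ a b, (W * comps g * W.transpose) a b = g (f a) (f b) := fun a b => by
    rw [clm_apply_eq_sum g (f a) (f b), Matrix.mul_apply]
    simp only [Matrix.mul_apply, Matrix.transpose_apply, hW, Matrix.of_apply, comps,
      Finset.sum_mul]
    rw [Finset.sum_comm]
    exact Finset.sum_congr rfl fun i _ => Finset.sum_congr rfl fun j _ => by ring
  have f0 : f 0 = N := rfl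
  have f1 : f 1 = ξ := rfl
  have f2 : ∀ k : Fin d, f k.succ.succ = e k := fun k => rfl
  have h := det_adapted (W * comps g * W.transpose) γ
    (by rw [hP, f0, hf.nullN]) (by rw [hP, f0, f1, hf.norm])
    (by rw [hP, f0, f1, hf.symm, hf.norm]) (fun k => by rw [hP, f0, f2, hf.orthN])
    (fun k => by rw [hP, f1, f2, hf.orthξ]) (fun i j => by rw [hP, f2, f2, hf.gram])
  rw [Matrix.det_mul, Matrix.det_mul, Matrix.det_transpose] at h
  have hv : volDet f = W.det := rfl
  rw [hv]
  linear_combination -h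

lemma volDet_ne_zero (hf : IsAdaptedFrame g N ξ e γ) :
    volDet (Fin.cons N (Fin.cons ξ e)) ≠ 0 := fun h => by
  have := hf.det_eq
  have := hf.posDet
  rw [h] at *
  simp at *
  linarith

lemma det_ne_zero (hf : IsAdaptedFrame g N ξ e γ) : (comps g).det ≠ 0 := fun h => by
  have := hf.det_eq
  have := hf.posDet
  rw [h] at *
  simp at *
  linarith

/-- This converts the coordinate density `√(-g)` into the area element of the section. -/
lemma sqrt_det_eq (hf : IsAdaptedFrame g N ξ e γ) :
    Real.sqrt (-(comps g).det) * |volDet (Fin.cons N (Fin.cons ξ e))| = Real.sqrt γ.det := by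
  rw [← hf.det_eq, Real.sqrt_mul' _ (sq_nonneg _), Real.sqrt_sq_eq_abs]

/-- Completeness of an adapted frame. -/
lemma expand (hf : IsAdaptedFrame g N ξ e γ) (v : Coord (d + 2)) :
    v = -(g N v) • ξ - (g ξ v) • N + ∑ i, (∑ j, γ⁻¹ i j * g (e j) v) • e i := by
  -- The remainder `r` is orthogonal to every frame vector. Since both the frame matrix and the
  -- metric are invertible, `r = 0`.
  set r := v - (-(g N v) • ξ - (g ξ v) • N + ∑ i, (∑ j, γ⁻¹ i j * g (e j) v) • e i) with hr
  set f : Fin (d + 2) → Coord (d + 2) := Fin.cons N (Fin.cons ξ e) with hfdef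
  set W : Matrix (Fin (d + 2)) (Fin (d + 2)) ℝ := Matrix.of fun a i => f a i with hW
  have hγu : IsUnit γ.det := (ne_of_gt hf.posDet).isUnit
  have hrN : g N r = 0 := by
    simp [hr, hf.nullN, hf.norm, hf.orthN]
  have hrξ : g ξ r = 0 := by
    simp [hr, hf.nullξ, hf.symm ξ N, hf.norm, hf.orthξ]
  have hre : ∀ k, g (e k) r = 0 := fun k => by
    have h1 : ∑ i, (∑ j, γ⁻¹ i j * g (e j) v) * g (e k) (e i) = g (e k) v := by
      have h2 : γ.mulVec (γ⁻¹.mulVec fun j => g (e j) v) = fun j => g (e j) v := by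
        rw [Matrix.mulVec_mulVec, Matrix.mul_nonsing_inv _ hγu, Matrix.one_mulVec]
      rw [← congrFun h2 k]
      simp only [Matrix.mulVec, dotProduct, hf.gram]
      exact Finset.sum_congr rfl fun i _ => mul_comm _ _
    simp [hr, hf.symm (e k) ξ, hf.symm (e k) N, hf.orthN, hf.orthξ, h1]
  have hfr : ∀ a, g (f a) r = 0 := fun a => by
    refine Fin.cases hrN (fun b => ?_) a
    exact Fin.cases hrξ hre b
  have hdet : (W * comps g).det ≠ 0 := by
    rw [Matrix.det_mul]
    exact mul_ne_zero hf.volDet_ne_zero hf.det_ne_zero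
  have h0 : (W * comps g).mulVec (fun i => r i) = 0 := by
    ext a
    rw [Pi.zero_apply, ← hfr a, clm_apply_eq_sum g (f a) r]
    simp only [Matrix.mulVec, dotProduct, Matrix.mul_apply, hW, Matrix.of_apply, comps,
      Finset.sum_mul]
    rw [Finset.sum_comm]
    exact Finset.sum_congr rfl fun i _ => Finset.sum_congr rfl fun j _ => by ring
  have h1 := Matrix.eq_zero_of_mulVec_eq_zero hdet h0
  have h2 : r = 0 := by
    ext i
    exact congrFun h1 i
  exact sub_eq_zero.1 h2

/-- This is `expand` applied to the coordinate vectors: completeness of the frame says exactly that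
the matrix on the right is a left inverse of the metric. -/
lemma inv_comps (hf : IsAdaptedFrame g N ξ e γ) :
    (comps g)⁻¹ = Matrix.of fun i j =>
      -(ξ i * N j) - N i * ξ j + ∑ a, ∑ b, γ⁻¹ a b * (e a i * e b j) := by
  refine Matrix.inv_eq_left_inv ?_
  have hg : ∀ (v : Coord (d + 2)) (k : Fin (d + 2)),
      g v (EuclideanSpace.single k 1) = ∑ j, v j * comps g j k := fun v k => by
    rw [clm_apply_eq_sum]
    simp [comps]
  ext i k
  have h := congrArg (fun v : Coord (d + 2) => v i) (hf.expand (EuclideanSpace.single k 1))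
  simp only [hg] at h
  rw [Matrix.mul_apply]
  have h3 : (1 : Matrix (Fin (d + 2)) (Fin (d + 2)) ℝ) i k
      = (EuclideanSpace.single k (1 : ℝ) : Coord (d + 2)) i := by
    simp [Matrix.one_apply]
  rw [h3, h]
  simp only [Matrix.of_apply, PiLp.add_apply, PiLp.sub_apply, PiLp.smul_apply, smul_eq_mul,
    WithLp.ofLp_sum, Finset.sum_apply, add_mul, sub_mul, Finset.sum_add_distrib,
    Finset.sum_sub_distrib, Finset.sum_mul, Finset.mul_sum, neg_mul, Finset.sum_neg_distrib,
    WithLp.ofLp_smul, Pi.smul_apply]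
  congr 1
  · congr 1
    · congr 1
      exact Finset.sum_congr rfl fun j _ => by ring
    · exact Finset.sum_congr rfl fun j _ => by ring
  · rw [Finset.sum_comm]
    refine Finset.sum_congr rfl fun a _ => ?_
    rw [Finset.sum_comm]
    exact Finset.sum_congr rfl fun b _ => Finset.sum_congr rfl fun j _ => by ring

/-- The determinant as an alternating form. -/
def _root_.KillingHorizon.volForm (n : ℕ) : Coord n [⋀^Fin n]→ₗ[ℝ] ℝ :=
  Matrix.detRowAlternating.compLinearMap (WithLp.linearEquiv 2 ℝ (Fin n → ℝ)).toLinearMap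

lemma volDet_eq_zero_of_eq (x : Coord (d + 2)) (i : Fin d) :
    volDet (Fin.cons x (Fin.cons (e i) e)) = 0 :=
  (volForm (d + 2)).map_eq_zero_of_eq _ (i := 1) (j := i.succ.succ) rfl
    (by rw [ne_eq, ← Fin.succ_zero_eq_one, Fin.succ_inj]; exact (Fin.succ_ne_zero i).symm)

lemma volDet_swap (x y : Coord (d + 2)) (w : Fin d → Coord (d + 2)) :
    volDet (Fin.cons x (Fin.cons y w)) = -volDet (Fin.cons y (Fin.cons x w)) := by
  have h := (volForm (d + 2)).map_swap (Fin.cons x (Fin.cons y w)) (i := 0) (j := 1) (by simp)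
  have h2 : (Fin.cons x (Fin.cons y w) : Fin (d + 2) → Coord (d + 2)) ∘ Equiv.swap 0 1
      = Fin.cons y (Fin.cons x w) := by
    funext a
    refine Fin.cases rfl (fun b => Fin.cases rfl (fun c => ?_) b) a
    have : Equiv.swap (0 : Fin (d + 2)) 1 c.succ.succ = c.succ.succ := by
      refine Equiv.swap_apply_of_ne_of_ne (Fin.succ_ne_zero _) ?_
      rw [ne_eq, ← Fin.succ_zero_eq_one, Fin.succ_inj]
      exact Fin.succ_ne_zero c
    rw [Function.comp_apply, this]
    rfl
  rw [h2] at h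
  exact eq_neg_of_add_eq_zero_left (by
    rw [show volDet (Fin.cons y (Fin.cons x w)) = _ from h]; exact add_neg_cancel _)

/-- In the frame expansion of `x` the components along `e` repeat a row of the determinant and drop
out. -/
lemma volDet_expand (hf : IsAdaptedFrame g N ξ e γ) (x y : Coord (d + 2)) :
    volDet (Fin.cons x (Fin.cons y e))
      = -(g N x) * volDet (Fin.cons ξ (Fin.cons y e))
        - (g ξ x) * volDet (Fin.cons N (Fin.cons y e)) := by
  have h : ∀ z : Coord (d + 2), volDet (Fin.cons z (Fin.cons y e))
      = (volForm (d + 2)).curryLeft z (Fin.cons y e) := fun z => rfl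
  have h0 : ∀ i, (volForm (d + 2)).curryLeft (e i) (Fin.cons y e) = 0 := fun i => by
    rw [← h, volDet_swap, volDet_eq_zero_of_eq, neg_zero]
  have hL : ∀ (L : Coord (d + 2) →ₗ[ℝ] ℝ), (∀ i, L (e i) = 0) →
      L x = -(g N x) * L ξ - (g ξ x) * L N := fun L hL => by
    conv_lhs => rw [hf.expand x]
    simp [hL]
  have := hL { toFun := fun z => (volForm (d + 2)).curryLeft z (Fin.cons y e)
               map_add' := fun a b => by simp
               map_smul' := fun a b => by simp } h0
  exact this

/-- Expanding both slots with `volDet_expand` leaves only the `ξ, N` plane. This is the binormal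
formula for `(d^{n-2}x)_{μν}` on the section, including its sign. -/
lemma volDet_pair (hf : IsAdaptedFrame g N ξ e γ) (x y : Coord (d + 2)) :
    volDet (Fin.cons x (Fin.cons y e))
      = (g ξ x * g N y - g N x * g ξ y) * volDet (Fin.cons N (Fin.cons ξ e)) := by
  rw [hf.volDet_expand x y, volDet_swap ξ y, volDet_swap N y, hf.volDet_expand y ξ,
    hf.volDet_expand y N, volDet_swap ξ N]
  have hs : ∀ z : Coord (d + 2), volDet (Fin.cons z (Fin.cons z e)) = 0 := fun z => by
    have := volDet_swap z z e
    linarith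
  rw [hs, hs]
  ring

/-- The trace of a bilinear form in an adapted frame. -/
lemma trace_eq (hf : IsAdaptedFrame g N ξ e γ) (B : Coord (d + 2) → Coord (d + 2) → ℝ)
    (b : Fin (d + 2) → Fin (d + 2) → ℝ)
    (hB : ∀ v w, B v w = ∑ i, ∑ j, v i * w j * b i j) :
    ∑ i, ∑ j, (comps g)⁻¹ i j * b i j
      = -B ξ N - B N ξ + ∑ i, ∑ j, γ⁻¹ i j * B (e i) (e j) := by
  rw [hf.inv_comps]
  simp only [Matrix.of_apply, hB, add_mul, sub_mul, Finset.sum_add_distrib,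
    Finset.sum_sub_distrib, neg_mul, Finset.sum_neg_distrib]
  congr 1
  simp only [Finset.sum_mul, Finset.mul_sum]
  have : ∀ f : Fin (d + 2) → Fin (d + 2) → Fin d → Fin d → ℝ,
      ∑ i, ∑ j, ∑ a, ∑ b, f i j a b = ∑ a, ∑ b, ∑ i, ∑ j, f i j a b := fun f => by
    calc ∑ i, ∑ j, ∑ a, ∑ b, f i j a b = ∑ i, ∑ a, ∑ b, ∑ j, f i j a b := by
          refine Finset.sum_congr rfl fun i _ => ?_
          rw [Finset.sum_comm]
          exact Finset.sum_congr rfl fun a _ => Finset.sum_comm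
      _ = _ := by
          rw [Finset.sum_comm]
          exact Finset.sum_congr rfl fun a _ => Finset.sum_comm
  rw [this]
  exact Finset.sum_congr rfl fun a _ => Finset.sum_congr rfl fun b _ =>
    Finset.sum_congr rfl fun i _ => Finset.sum_congr rfl fun j _ => by ring

end IsAdaptedFrame
end Frame

/-! ### Covariant and Lie derivatives without indices. -/

section CovariantCalculus

variable {n : ℕ}

/-- The components of a vector field. -/
def vcomps (X : Coord n → Coord n) (y : Coord n) (i : Fin n) : ℝ := X y i

/-- The components of a field of bilinear forms. -/
def tcomps (T : Coord n → Coord n →L[ℝ] Coord n →L[ℝ] ℝ) (y : Coord n) :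
    Matrix (Fin n) (Fin n) ℝ := comps (T y)

lemma clm_eq_sum {F : Type*} [NormedAddCommGroup F] [NormedSpace ℝ F]
    (L : Coord n →L[ℝ] F) (v : Coord n) :
    L v = ∑ i, v i • L (EuclideanSpace.single i 1) := by
  have key : v = ∑ i, v i • EuclideanSpace.single i (1 : ℝ) := by
    ext j
    simp [Finset.sum_apply, Pi.single_apply]
  conv_lhs => rw [key]
  simp

variable {G T : Coord n → Coord n →L[ℝ] Coord n →L[ℝ] ℝ} {X : Coord n → Coord n} {u : Coord n}

lemma fderiv_clm_apply₂ (hT : DifferentiableAt ℝ T u) (v w z : Coord n) :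
    fderiv ℝ (fun y => T y w z) u v = fderiv ℝ T u v w z := by
  have h := (hT.hasFDerivAt.clm_apply (hasFDerivAt_const w u)).clm_apply (hasFDerivAt_const z u)
  rw [h.fderiv]
  simp

lemma pd_tcomps (hT : DifferentiableAt ℝ T u) (k i j : Fin n) :
    pd k (fun y => tcomps T y i j) u
      = fderiv ℝ T u (EuclideanSpace.single k 1) (EuclideanSpace.single i 1)
        (EuclideanSpace.single j 1) :=
  fderiv_clm_apply₂ hT _ _ _

lemma pd_vcomps (hX : DifferentiableAt ℝ X u) (k i : Fin n) :
    pd k (fun y => vcomps X y i) u = fderiv ℝ X u (EuclideanSpace.single k 1) i := by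
  have h1 : HasFDerivAt (fun y => X y i)
      ((EuclideanSpace.proj i : Coord n →L[ℝ] ℝ).comp (fderiv ℝ X u)) u :=
    (EuclideanSpace.proj i : Coord n →L[ℝ] ℝ).hasFDerivAt.comp u hX.hasFDerivAt
  show fderiv ℝ (fun y => X y i) u _ = _
  rw [h1.fderiv]
  rfl

/-- The Lie derivative `L_X T` as a bilinear form. -/
def lieForm (X : Coord n → Coord n) (T : Coord n → Coord n →L[ℝ] Coord n →L[ℝ] ℝ)
    (u : Coord n) : Coord n →L[ℝ] Coord n →L[ℝ] ℝ :=
  fderiv ℝ T u (X u) + (T u).bilinearComp (fderiv ℝ X u) (ContinuousLinearMap.id ℝ _)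
    + (T u).bilinearComp (ContinuousLinearMap.id ℝ _) (fderiv ℝ X u)

lemma lieForm_apply (v w : Coord n) :
    lieForm X T u v w
      = fderiv ℝ T u (X u) v w + T u (fderiv ℝ X u v) w + T u v (fderiv ℝ X u w) := rfl

lemma lieDeriv_eq (hT : DifferentiableAt ℝ T u) (hX : DifferentiableAt ℝ X u) (i j : Fin n) :
    lieDeriv (vcomps X) (tcomps T) u i j
      = lieForm X T u (EuclideanSpace.single i 1) (EuclideanSpace.single j 1) := by
  rw [lieForm_apply, lieDeriv]
  simp only [pd_tcomps hT, pd_vcomps hX, Finset.sum_add_distrib]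
  congr 1
  · congr 1
    · rw [clm_eq_sum (fderiv ℝ T u) (X u)]
      simp [vcomps]
    · rw [clm_eq_sum (T u) (fderiv ℝ X u _)]
      simp [tcomps, comps]
  · rw [clm_eq_sum (T u (EuclideanSpace.single i 1)) (fderiv ℝ X u _)]
    simp [tcomps, comps]

/-- The Christoffel symbols contracted with two vectors. -/
def chr (G : Coord n → Coord n →L[ℝ] Coord n →L[ℝ] ℝ) (u v w : Coord n) : Coord n :=
  WithLp.toLp 2 fun k => ∑ i, ∑ j, v i * w j * christoffel (tcomps G) u k i j

/-- The covariant derivative `D_v X`. -/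
def cov (G : Coord n → Coord n →L[ℝ] Coord n →L[ℝ] ℝ) (X : Coord n → Coord n)
    (u v : Coord n) : Coord n :=
  WithLp.toLp 2 fun i => ∑ k, v k * covVector (tcomps G) (vcomps X) u k i

/-- The covariant derivative `(D_v T)(w, z)`. -/
def covT (G T : Coord n → Coord n →L[ℝ] Coord n →L[ℝ] ℝ) (u v w z : Coord n) : ℝ :=
  ∑ k, ∑ i, ∑ j, v k * w i * z j * covTensor (tcomps G) (tcomps T) u k i j

lemma cov_eq (hX : DifferentiableAt ℝ X u) (v : Coord n) :
    cov G X u v = fderiv ℝ X u v + chr G u v (X u) := by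
  ext i
  simp only [cov, covVector, chr, PiLp.add_apply, pd_vcomps hX, mul_add, Finset.sum_add_distrib]
  congr 1
  · rw [clm_eq_sum (fderiv ℝ X u) v]
    simp [Finset.sum_apply]
  · simp only [Finset.mul_sum, vcomps]
    exact Finset.sum_congr rfl fun k _ => Finset.sum_congr rfl fun l _ => by ring

lemma sum_perm₁ (f : Fin n → Fin n → Fin n → Fin n → ℝ) :
    ∑ l, ∑ j, ∑ k, ∑ i, f l j k i = ∑ k, ∑ i, ∑ j, ∑ l, f l j k i := by
  simp_rw [← Fintype.sum_prod_type']
  exact Fintype.sum_equiv ⟨fun p => (p.2.2.1, p.2.2.2, p.2.1, p.1),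
    fun p => (p.2.2.2, p.2.2.1, p.1, p.2.1), fun _ => rfl, fun _ => rfl⟩ _ _ fun _ => rfl

lemma sum_perm₂ (f : Fin n → Fin n → Fin n → Fin n → ℝ) :
    ∑ i, ∑ l, ∑ k, ∑ j, f i l k j = ∑ k, ∑ i, ∑ j, ∑ l, f i l k j := by
  simp_rw [← Fintype.sum_prod_type']
  exact Fintype.sum_equiv ⟨fun p => (p.2.2.1, p.1, p.2.2.2, p.2.1),
    fun p => (p.2.1, p.2.2.2, p.1, p.2.2.1), fun _ => rfl, fun _ => rfl⟩ _ _ fun _ => rfl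

lemma sum_perm₃ (f : Fin n → Fin n → Fin n → ℝ) :
    ∑ i, ∑ j, ∑ l, f i j l = ∑ l, ∑ i, ∑ j, f i j l := by
  simp_rw [← Fintype.sum_prod_type']
  exact Fintype.sum_equiv ⟨fun p => (p.2.2, p.1, p.2.1),
    fun p => (p.2.1, p.2.2, p.1), fun _ => rfl, fun _ => rfl⟩ _ _ fun _ => rfl

lemma covT_eq (hT : DifferentiableAt ℝ T u) (v w z : Coord n) :
    covT G T u v w z
      = fderiv ℝ T u v w z - T u (chr G u v w) z - T u w (chr G u v z) := by
  have h1 : fderiv ℝ T u v w z = ∑ k, ∑ i, ∑ j, v k * w i * z j *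
      fderiv ℝ T u (EuclideanSpace.single k 1) (EuclideanSpace.single i 1)
        (EuclideanSpace.single j 1) := by
    rw [clm_eq_sum (fderiv ℝ T u) v]
    simp only [_root_.sum_apply, _root_.smul_apply, smul_eq_mul]
    refine Finset.sum_congr rfl fun k _ => ?_
    rw [clm_apply_eq_sum, Finset.mul_sum]
    refine Finset.sum_congr rfl fun i _ => ?_
    rw [Finset.mul_sum]
    exact Finset.sum_congr rfl fun j _ => by ring
  have h2 : T u (chr G u v w) z = ∑ k, ∑ i, ∑ j, v k * w i * z j *
      ∑ l, christoffel (tcomps G) u l k i * tcomps T u l j := by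
    rw [clm_apply_eq_sum]
    simp only [chr, Finset.sum_mul, Finset.mul_sum]
    rw [sum_perm₁]
    refine Finset.sum_congr rfl fun k _ => Finset.sum_congr rfl fun i _ =>
      Finset.sum_congr rfl fun j _ => Finset.sum_congr rfl fun l _ => ?_
    simp only [tcomps, comps, Matrix.of_apply]
    ring
  have h3 : T u w (chr G u v z) = ∑ k, ∑ i, ∑ j, v k * w i * z j *
      ∑ l, christoffel (tcomps G) u l k j * tcomps T u i l := by
    rw [clm_apply_eq_sum]
    simp only [chr, Finset.sum_mul, Finset.mul_sum]
    rw [sum_perm₂]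
    refine Finset.sum_congr rfl fun k _ => Finset.sum_congr rfl fun i _ =>
      Finset.sum_congr rfl fun j _ => Finset.sum_congr rfl fun l _ => ?_
    simp only [tcomps, comps, Matrix.of_apply]
    ring
  rw [h1, h2, h3]
  simp only [covT, covTensor, pd_tcomps hT, mul_sub, Finset.sum_sub_distrib]

/-- Raising an index. -/
lemma apply_of_raise (hG : ∀ v w, G u v w = G u w v) (hdet : (tcomps G u).det ≠ 0)
    {c : Coord n} {F : Fin n → ℝ} (hc : ∀ k, c k = ∑ l, (tcomps G u)⁻¹ k l * F l)
    (z : Coord n) : G u c z = ∑ l, z l * F l := by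
  have h1 : (tcomps G u).mulVec ((tcomps G u)⁻¹.mulVec F) = F := by
    rw [Matrix.mulVec_mulVec, Matrix.mul_nonsing_inv _ hdet.isUnit, Matrix.one_mulVec]
  have h2 : ∀ m, F m = ∑ k, tcomps G u m k * c k := fun m => by
    rw [← congrFun h1 m]
    simp only [Matrix.mulVec, dotProduct, hc]
  rw [hG, clm_apply_eq_sum]
  simp only [h2, Finset.mul_sum]
  refine Finset.sum_congr rfl fun l _ => Finset.sum_congr rfl fun k _ => ?_
  simp only [tcomps, comps, Matrix.of_apply]
  ring

/-- A metric at the point `u`, differentiable, symmetric and nondegenerate. -/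
structure IsMetricAt (G : Coord n → Coord n →L[ℝ] Coord n →L[ℝ] ℝ) (u : Coord n) : Prop where
  diff : DifferentiableAt ℝ G u
  symm : ∀ y v w, G y v w = G y w v
  det : (tcomps G u).det ≠ 0

lemma fderiv_symm (hT : DifferentiableAt ℝ T u) (hs : ∀ y v w, T y v w = T y w v)
    (v w z : Coord n) : fderiv ℝ T u v w z = fderiv ℝ T u v z w := by
  rw [← fderiv_clm_apply₂ hT, ← fderiv_clm_apply₂ hT]
  simp only [hs _ w z]

namespace IsMetricAt

variable (hG : IsMetricAt G u)
include hG

/-- The Koszul formula. Together with nondegeneracy it replaces the index definition of the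
Christoffel symbols in what follows. -/
lemma chr_spec (v w z : Coord n) :
    G u (chr G u v w) z
      = (1 / 2) * (fderiv ℝ G u v w z + fderiv ℝ G u w v z - fderiv ℝ G u z v w) := by
  rw [apply_of_raise (F := fun l => (1 / 2) *
    (fderiv ℝ G u v (EuclideanSpace.single l 1) w + fderiv ℝ G u w (EuclideanSpace.single l 1) v
      - fderiv ℝ G u (EuclideanSpace.single l 1) v w)) (hG.symm u) hG.det ?_ z]
  · rw [fderiv_symm hG.diff hG.symm v w z, fderiv_symm hG.diff hG.symm w v z,
      clm_eq_sum (fderiv ℝ G u v) z, clm_eq_sum (fderiv ℝ G u w) z, clm_eq_sum (fderiv ℝ G u) z]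
    simp only [_root_.sum_apply, _root_.smul_apply, smul_eq_mul, ← Finset.sum_add_distrib,
      ← Finset.sum_sub_distrib, Finset.mul_sum]
    exact Finset.sum_congr rfl fun l _ => by ring
  · intro k
    simp only [chr, christoffel, pd_tcomps hG.diff]
    have e1 : ∀ l, fderiv ℝ G u v (EuclideanSpace.single l 1) w = ∑ i, ∑ j, v i * w j *
        fderiv ℝ G u (EuclideanSpace.single i 1) (EuclideanSpace.single l 1)
          (EuclideanSpace.single j 1) := fun l => by
      rw [clm_eq_sum (fderiv ℝ G u) v]
      simp only [_root_.sum_apply, _root_.smul_apply, smul_eq_mul]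
      refine Finset.sum_congr rfl fun i _ => ?_
      rw [clm_eq_sum _ w, Finset.mul_sum]
      exact Finset.sum_congr rfl fun j _ => by rw [smul_eq_mul]; ring
    have e2 : ∀ l, fderiv ℝ G u w (EuclideanSpace.single l 1) v = ∑ i, ∑ j, v i * w j *
        fderiv ℝ G u (EuclideanSpace.single j 1) (EuclideanSpace.single l 1)
          (EuclideanSpace.single i 1) := fun l => by
      rw [clm_eq_sum (fderiv ℝ G u) w, Finset.sum_comm]
      simp only [_root_.sum_apply, _root_.smul_apply, smul_eq_mul]
      refine Finset.sum_congr rfl fun i _ => ?_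
      rw [clm_eq_sum _ v, Finset.mul_sum]
      exact Finset.sum_congr rfl fun j _ => by rw [smul_eq_mul]; ring
    simp only [e1, e2, clm_apply_eq_sum (fderiv ℝ G u _) v w, ← Finset.sum_add_distrib,
      ← Finset.sum_sub_distrib, Finset.mul_sum]
    rw [sum_perm₃]
    exact Finset.sum_congr rfl fun l _ => Finset.sum_congr rfl fun i _ =>
      Finset.sum_congr rfl fun j _ => by ring

lemma nondeg {c c' : Coord n} (h : ∀ z, G u c z = G u c' z) : c = c' := by
  have h0 : (tcomps G u).mulVec (fun i => (c - c') i) = 0 := by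
    ext j
    have : G u (c - c') (EuclideanSpace.single j 1) = 0 := by
      rw [map_sub, _root_.sub_apply, h, sub_self]
    rw [hG.symm, clm_apply_eq_sum] at this
    simpa [Matrix.mulVec, dotProduct, tcomps, comps, mul_comm] using this
  have h1 := Matrix.eq_zero_of_mulVec_eq_zero hG.det h0
  refine sub_eq_zero.1 ?_
  ext i
  exact congrFun h1 i

lemma chr_symm (v w : Coord n) : chr G u v w = chr G u w v := by
  refine hG.nondeg fun z => ?_
  rw [hG.chr_spec, hG.chr_spec, fderiv_symm hG.diff hG.symm z v w]
  ring

/-- Metric compatibility `Dg = 0`, in terms of partial derivatives. -/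
lemma fderiv_eq (v w z : Coord n) :
    fderiv ℝ G u v w z = G u (chr G u v w) z + G u w (chr G u v z) := by
  rw [hG.symm u w, hG.chr_spec, hG.chr_spec, fderiv_symm hG.diff hG.symm w v z,
    fderiv_symm hG.diff hG.symm v z w, fderiv_symm hG.diff hG.symm z v w]
  ring

/-- The classical `(L_X g)_{ij} = D_i X_j + D_j X_i`: compatibility turns `∂g` into Christoffel
terms, which the symmetry of `chr` matches with those in `DX`. -/
lemma lieForm_self (hX : DifferentiableAt ℝ X u) (v w : Coord n) :
    lieForm X G u v w = G u (cov G X u v) w + G u v (cov G X u w) := by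
  rw [lieForm_apply, cov_eq hX, cov_eq hX, hG.fderiv_eq, hG.chr_symm v, hG.chr_symm w]
  simp only [map_add, _root_.add_apply]
  ring

/-- Absence of torsion lets covariant derivatives replace partial ones in the Lie derivative of any
two-tensor. -/
lemma lieForm_eq (hT : DifferentiableAt ℝ T u) (hX : DifferentiableAt ℝ X u) (v w : Coord n) :
    lieForm X T u v w
      = covT G T u (X u) v w + T u (cov G X u v) w + T u v (cov G X u w) := by
  rw [lieForm_apply, cov_eq hX, cov_eq hX, covT_eq hT, hG.chr_symm v, hG.chr_symm w]
  simp only [map_add, _root_.add_apply]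
  ring

end IsMetricAt

end CovariantCalculus

/-! ### The Komar form and the boundary form in an adapted frame. -/

section Forms

variable {d : ℕ} {g h : Coord (d + 2) → Coord (d + 2) →L[ℝ] Coord (d + 2) →L[ℝ] ℝ}
  {ξ a : Coord (d + 2) → Coord (d + 2)} {u N : Coord (d + 2)}
  {e : Fin d → Coord (d + 2)} {γ : Matrix (Fin d) (Fin d) ℝ}

lemma IsMetricAt.sum_lower_inv {n : ℕ} {g : Coord n → Coord n →L[ℝ] Coord n →L[ℝ] ℝ}
    {u : Coord n} (hG : IsMetricAt g u) (x : Coord n) (k : Fin n) :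
    ∑ μ, g u x (EuclideanSpace.single μ 1) * (tcomps g u)⁻¹ μ k = x k := by
  have h1 : Matrix.vecMul (Matrix.vecMul (fun i => x i) (tcomps g u)) (tcomps g u)⁻¹
      = fun i => x i := by
    rw [Matrix.vecMul_vecMul, Matrix.mul_nonsing_inv _ hG.det.isUnit, Matrix.vecMul_one]
  have h2 : ∀ μ, g u x (EuclideanSpace.single μ 1)
      = Matrix.vecMul (fun i => x i) (tcomps g u) μ := fun μ => by
    rw [clm_apply_eq_sum]
    simp [Matrix.vecMul, dotProduct, tcomps, comps]
  simp only [h2]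
  exact congrFun h1 k

lemma IsMetricAt.sum_covVectorUp {n : ℕ} {g : Coord n → Coord n →L[ℝ] Coord n →L[ℝ] ℝ}
    {X : Coord n → Coord n} {u : Coord n} (hG : IsMetricAt g u) (x y : Coord n) :
    ∑ μ, ∑ ν, g u x (EuclideanSpace.single μ 1) * g u y (EuclideanSpace.single ν 1)
      * covVectorUp (tcomps g) (vcomps X) u μ ν = g u (cov g X u x) y := by
  rw [hG.symm, clm_eq_sum (g u y) (cov g X u x), Finset.sum_comm]
  refine Finset.sum_congr rfl fun ν _ => ?_
  simp only [covVectorUp, cov, smul_eq_mul, Finset.mul_sum, Finset.sum_mul]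
  rw [Finset.sum_comm]
  refine Finset.sum_congr rfl fun k _ => ?_
  rw [← hG.sum_lower_inv x k]
  simp only [Finset.sum_mul]
  exact Finset.sum_congr rfl fun μ _ => by ring

/-- By `volDet_pair` the form contracts `D^μ X^ν - D^ν X^μ` with the antisymmetric binormal. Each of
the two terms gives the same contraction, which absorbs the factor `1/2` of `(d^{n-2}x)_{μν}`. -/
lemma komarForm_eq (GN : ℝ) (hG : IsMetricAt g u) (hf : IsAdaptedFrame (g u) N (ξ u) e γ) :
    komarForm GN (tcomps g) (vcomps a) u e
      = Real.sqrt (-(tcomps g u).det) / (16 * Real.pi * GN) *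
        ((g u (cov g a u (ξ u)) N - g u (cov g a u N) (ξ u))
          * volDet (Fin.cons N (Fin.cons (ξ u) e))) := by
  rw [komarForm, ← hG.sum_covVectorUp, ← hG.sum_covVectorUp]
  congr 1
  have hc : ∀ μ ν, codimTwoForm μ ν e = _ := fun μ ν =>
    congrArg (fun x => 1 / 2 * x) (hf.volDet_pair _ _)
  simp only [hc]
  set V := volDet (Fin.cons N (Fin.cons (ξ u) e))
  set p := fun μ => g u (ξ u) (EuclideanSpace.single μ 1)
  set q := fun μ => g u N (EuclideanSpace.single μ 1)
  set C := covVectorUp (tcomps g) (vcomps a) u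
  show ∑ μ, ∑ ν, (C μ ν - C ν μ) * (1 / 2 * ((p μ * q ν - q μ * p ν) * V))
    = (∑ μ, ∑ ν, p μ * q ν * C μ ν - ∑ μ, ∑ ν, q μ * p ν * C μ ν) * V
  have h1 : ∑ μ, ∑ ν, C ν μ * (p μ * q ν - q μ * p ν)
      = ∑ μ, ∑ ν, C μ ν * (p ν * q μ - q ν * p μ) := Finset.sum_comm
  have h2 : ∑ μ, ∑ ν, (C μ ν - C ν μ) * (1 / 2 * ((p μ * q ν - q μ * p ν) * V))
      = (1 / 2) * V * (∑ μ, ∑ ν, C μ ν * (p μ * q ν - q μ * p ν)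
        - ∑ μ, ∑ ν, C ν μ * (p μ * q ν - q μ * p ν)) := by
    simp only [mul_sub, sub_mul, Finset.mul_sum, ← Finset.sum_sub_distrib]
    exact Finset.sum_congr rfl fun μ _ => Finset.sum_congr rfl fun ν _ => by ring
  rw [h2, h1]
  simp only [mul_sub, sub_mul, Finset.mul_sum, Finset.sum_mul, ← Finset.sum_sub_distrib]
  exact Finset.sum_congr rfl fun μ _ => Finset.sum_congr rfl fun ν _ => by ring

lemma IsMetricAt.inv_symm {n : ℕ} {g : Coord n → Coord n →L[ℝ] Coord n →L[ℝ] ℝ}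
    {u : Coord n} (hG : IsMetricAt g u) (i j : Fin n) :
    (tcomps g u)⁻¹ i j = (tcomps g u)⁻¹ j i := by
  have h1 : (tcomps g u).transpose = tcomps g u := by
    ext i j
    exact hG.symm u _ _
  conv_lhs => rw [← h1, ← Matrix.transpose_nonsing_inv]
  rfl

/-- The contraction of the boundary vector with `ξ`, in an adapted frame. -/
def thetaContr (g h : Coord (d + 2) → Coord (d + 2) →L[ℝ] Coord (d + 2) →L[ℝ] ℝ)
    (u N x : Coord (d + 2)) (e : Fin d → Coord (d + 2)) (γ : Matrix (Fin d) (Fin d) ℝ) : ℝ :=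
  (-covT g h u x N x - covT g h u N x x + ∑ i, ∑ j, γ⁻¹ i j * covT g h u (e i) (e j) x)
    - (-covT g h u x x N - covT g h u x N x + ∑ i, ∑ j, γ⁻¹ i j * covT g h u x (e i) (e j))

lemma covT_symm {n : ℕ} {g h : Coord n → Coord n →L[ℝ] Coord n →L[ℝ] ℝ} {u : Coord n}
    (hh : DifferentiableAt ℝ h u) (hs : ∀ y v w, h y v w = h y w v)
    (v w z : Coord n) : covT g h u v w z = covT g h u v z w := by
  rw [covT_eq hh, covT_eq hh, fderiv_symm hh hs v w z, hs u _ z, hs u w]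
  ring

/-- Each term of the boundary vector, contracted with `ξ`, is a metric trace of a bilinear form, so
`trace_eq` applies to it. The first one uses the symmetry of `h` in the last two slots of `Dh`. -/
lemma sum_thetaVector (hG : IsMetricAt g u) (hf : IsAdaptedFrame (g u) N (ξ u) e γ)
    (hh : DifferentiableAt ℝ h u) (hs : ∀ y v w, h y v w = h y w v) :
    ∑ μ, g u (ξ u) (EuclideanSpace.single μ 1) * thetaVector (tcomps g) (tcomps h) u μ
      = thetaContr g h u N (ξ u) e γ := by
  have t1 := hf.trace_eq (fun v w => covT g h u v w (ξ u))
    (fun k β => ∑ α, (ξ u) α * covTensor (tcomps g) (tcomps h) u k β α) (fun v w => by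
      simp only [covT, Finset.mul_sum]
      exact Finset.sum_congr rfl fun _ _ => Finset.sum_congr rfl fun _ _ =>
        Finset.sum_congr rfl fun _ _ => by ring)
  have t2 := hf.trace_eq (fun v w => covT g h u (ξ u) v w)
    (fun α β => ∑ k, (ξ u) k * covTensor (tcomps g) (tcomps h) u k α β) (fun v w => by
      simp only [covT, Finset.mul_sum]
      rw [sum_perm₃ (fun i j k => v i * w j * (ξ u k * covTensor (tcomps g) (tcomps h) u k i j))]
      exact Finset.sum_congr rfl fun _ _ => Finset.sum_congr rfl fun _ _ =>
        Finset.sum_congr rfl fun _ _ => by ring)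
  have hsym : ∀ k α β, covTensor (tcomps g) (tcomps h) u k α β
      = covTensor (tcomps g) (tcomps h) u k β α := fun k α β => by
    have := covT_symm (g := g) hh hs (EuclideanSpace.single k 1) (EuclideanSpace.single α 1)
      (EuclideanSpace.single β 1)
    simpa [covT] using this
  rw [thetaContr, ← t1, ← t2]
  simp only [thetaVector, mul_sub, Finset.sum_sub_distrib]
  congr 1
  · simp only [← hG.sum_lower_inv (ξ u), Finset.mul_sum, Finset.sum_mul]
    simp_rw [← Fintype.sum_prod_type']
    refine Fintype.sum_equiv ⟨fun p => (p.2.2.2, p.2.2.1, p.2.1, p.1),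
      fun p => (p.2.2.2, p.2.2.1, p.2.1, p.1), fun _ => rfl, fun _ => rfl⟩ _ _ fun p => ?_
    obtain ⟨μ, α, β, k⟩ := p
    show _ * (_ * _ * _) = (tcomps g u)⁻¹ k β * (g u (ξ u) (EuclideanSpace.single μ 1)
      * (tcomps g u)⁻¹ μ α * covTensor (tcomps g) (tcomps h) u k β α)
    rw [hG.inv_symm k β, hsym]
    ring
  · simp only [← hG.sum_lower_inv (ξ u), Finset.mul_sum, Finset.sum_mul]
    simp_rw [← Fintype.sum_prod_type']
    refine Fintype.sum_equiv ⟨fun p => (p.2.1, p.2.2.1, p.2.2.2, p.1),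
      fun p => (p.2.2.2, p.1, p.2.1, p.2.2.1), fun _ => rfl, fun _ => rfl⟩ _ _ fun p => ?_
    obtain ⟨μ, α, β, k⟩ := p
    show _ * (_ * _ * _) = (tcomps g u)⁻¹ α β * (g u (ξ u) (EuclideanSpace.single μ 1)
      * (tcomps g u)⁻¹ μ k * covTensor (tcomps g) (tcomps h) u k α β)
    ring

/-- With `ξ` in the first slot, `volDet_pair` reduces `(d^{n-1}x)_μ` to `-ξ_μ vol(N, ξ, e)`, because
`ξ` is null and `N · ξ = -1`. Hence the minus sign. -/
lemma thetaForm_eq (GN : ℝ) (hG : IsMetricAt g u) (hf : IsAdaptedFrame (g u) N (ξ u) e γ)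
    (hh : DifferentiableAt ℝ h u) (hs : ∀ y v w, h y v w = h y w v) :
    thetaForm GN (tcomps g) (tcomps h) u (Fin.cons (ξ u) e)
      = Real.sqrt (-(tcomps g u).det) / (16 * Real.pi * GN) *
        (-thetaContr g h u N (ξ u) e γ * volDet (Fin.cons N (Fin.cons (ξ u) e))) := by
  rw [thetaForm, ← sum_thetaVector hG hf hh hs]
  congr 1
  have hc : ∀ μ, codimOneForm μ (Fin.cons (ξ u) e) = _ := fun μ => hf.volDet_pair _ _
  simp only [hc, hf.norm, hf.nullξ]
  rw [neg_mul, Finset.sum_mul, ← Finset.sum_neg_distrib]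
  exact Finset.sum_congr rfl fun μ _ => by ring

/-- The Killing equation says that `D^i X^l`, the matrix `Gi * A`, is antisymmetric; its trace
against a symmetric matrix is zero. -/
lemma IsMetricAt.trace_antisymm {n : ℕ} {g : Coord n → Coord n →L[ℝ] Coord n →L[ℝ] ℝ}
    {X : Coord n → Coord n} {u : Coord n} (hG : IsMetricAt g u)
    (hA : ∀ v w, g u (cov g X u v) w + g u v (cov g X u w) = 0)
    (k : Coord n →L[ℝ] Coord n →L[ℝ] ℝ) (hk : ∀ v w, k v w = k w v) :
    ∑ i, ∑ j, (tcomps g u)⁻¹ i j * k (cov g X u (EuclideanSpace.single i 1))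
      (EuclideanSpace.single j 1) = 0 := by
  set A : Matrix (Fin n) (Fin n) ℝ := Matrix.of fun i l => cov g X u (EuclideanSpace.single i 1) l
  set Gi := (tcomps g u)⁻¹ with hGi
  have hGi1 : tcomps g u * Gi = 1 := Matrix.mul_nonsing_inv _ hG.det.isUnit
  have hGi2 : Gi * tcomps g u = 1 := Matrix.nonsing_inv_mul _ hG.det.isUnit
  have hGit : Gi.transpose = Gi := by
    ext i j
    exact hG.inv_symm j i
  have hAG : A * tcomps g u = -(A * tcomps g u).transpose := by
    ext i j
    have := hA (EuclideanSpace.single i 1) (EuclideanSpace.single j 1)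
    rw [hG.symm u (EuclideanSpace.single i 1), clm_apply_eq_sum,
      clm_apply_eq_sum _ (cov g X u (EuclideanSpace.single j 1))] at this
    simp only [Matrix.neg_apply, Matrix.transpose_apply, Matrix.mul_apply]
    rw [eq_neg_iff_add_eq_zero]
    simpa [A, tcomps, comps] using this
  have hS : (Gi * A).transpose = -(Gi * A) := by
    have h1 : Gi * A = Gi * (A * tcomps g u) * Gi := by
      rw [Matrix.mul_assoc, Matrix.mul_assoc, hGi1, Matrix.mul_one]
    rw [h1, Matrix.transpose_mul, Matrix.transpose_mul, hGit, ← Matrix.mul_assoc]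
    conv_rhs => rw [hAG]
    simp
  have hkt : (comps k).transpose = comps k := by
    ext i j
    exact hk _ _
  have h0 : (Gi * A * comps k).trace = 0 := by
    have h1 : (Gi * A * comps k).trace = -(Gi * A * comps k).trace := by
      conv_lhs => rw [← Matrix.trace_transpose, Matrix.transpose_mul, hS, hkt, Matrix.mul_neg,
        Matrix.trace_neg, Matrix.trace_mul_comm]
    linarith
  rw [← h0]
  simp only [Matrix.trace, Matrix.diag, Matrix.mul_apply, Finset.sum_mul]
  rw [Finset.sum_comm]
  refine Finset.sum_congr rfl fun j _ => ?_
  rw [Finset.sum_comm]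
  refine Finset.sum_congr rfl fun i _ => ?_
  rw [clm_apply_eq_sum, Finset.mul_sum]
  refine Finset.sum_congr rfl fun l _ => ?_
  rw [show Gi j i = Gi i j from hG.inv_symm j i]
  simp [A, comps, mul_assoc]

end Forms

/-! ### First variation of the surface gravity equation and the pointwise identity in coordinates.
-/

section Pointwise

/-- Once its index is lowered, the perturbed equation for `κ` is a cubic polynomial in `s`; this
reads off its linear term. -/
lemma hasDerivAt_cubic (c0 c1 c2 c3 : ℝ) :
    HasDerivAt (fun s : ℝ => c0 + s * c1 + s ^ 2 * c2 + s ^ 3 * c3) c1 0 := by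
  have h1 := (hasDerivAt_id (0 : ℝ)).mul_const c1
  have h2 := ((hasDerivAt_id (0 : ℝ)).pow 2).mul_const c2
  have h3 := ((hasDerivAt_id (0 : ℝ)).pow 3).mul_const c3
  have h := ((h1.const_add c0).add h2).add h3
  refine (h.congr_deriv (by simp)).congr_of_eventuallyEq (Filter.Eventually.of_forall fun s => ?_)
  simp

section Line

variable {n : ℕ} {F : Type*} [NormedAddCommGroup F] [NormedSpace ℝ F] {A B : Coord n → F}
  {u : Coord n}

lemma differentiableAt_line (hA : DifferentiableAt ℝ A u) (hB : DifferentiableAt ℝ B u) (s : ℝ) :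
    DifferentiableAt ℝ (fun y => A y + s • B y) u := hA.add (hB.const_smul s)

lemma fderiv_line (hA : DifferentiableAt ℝ A u) (hB : DifferentiableAt ℝ B u) (s : ℝ) :
    fderiv ℝ (fun y => A y + s • B y) u = fderiv ℝ A u + s • fderiv ℝ B u := by
  have h : HasFDerivAt (fun y => A y + s • B y) _ u :=
    hA.hasFDerivAt.add (hB.hasFDerivAt.const_smul s)
  exact h.fderiv

lemma line_zero (A B : Coord n → F) : (fun y => A y + (0 : ℝ) • B y) = A := by
  funext y
  simp

end Line

variable {n : ℕ} {g h : Coord n → Coord n →L[ℝ] Coord n →L[ℝ] ℝ}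
  {ξ a : Coord n → Coord n} {u : Coord n}

lemma form_line_zero (g h : Coord n → Coord n →L[ℝ] Coord n →L[ℝ] ℝ) :
    (fun y => g y + (0 : ℝ) • h y) = g :=
  line_zero (F := Coord n →L[ℝ] Coord n →L[ℝ] ℝ) g h

lemma differentiableAt_form_line (hg : DifferentiableAt ℝ g u) (hh : DifferentiableAt ℝ h u)
    (s : ℝ) : DifferentiableAt ℝ (fun y => g y + s • h y) u :=
  differentiableAt_line (F := Coord n →L[ℝ] Coord n →L[ℝ] ℝ) hg hh s

set_option synthInstance.maxHeartbeats 200000 in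
lemma fderiv_form_line (hg : DifferentiableAt ℝ g u) (hh : DifferentiableAt ℝ h u) (s : ℝ) :
    fderiv ℝ (fun y => g y + s • h y) u = fderiv ℝ g u + s • fderiv ℝ h u :=
  fderiv_line (F := Coord n →L[ℝ] Coord n →L[ℝ] ℝ) hg hh s

lemma fderiv_clm_field {T : Coord n → Coord n →L[ℝ] Coord n →L[ℝ] ℝ} {X : Coord n → Coord n}
    (hT : DifferentiableAt ℝ T u) (hX : DifferentiableAt ℝ X u) (v w : Coord n) :
    fderiv ℝ (fun y => T y (X y) w) u v = fderiv ℝ T u v (X u) w + T u (fderiv ℝ X u v) w := by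
  have h := (hT.hasFDerivAt.clm_apply hX.hasFDerivAt).clm_apply (hasFDerivAt_const w u)
  rw [h.fderiv]
  simp
  ring

lemma cov_eq_sum (v : Coord n) :
    cov g ξ u v = ∑ k, v k • cov g ξ u (EuclideanSpace.single k 1) := by
  ext i
  simp [cov, Finset.sum_apply]

lemma differentiableAt_clm_field {T : Coord n → Coord n →L[ℝ] Coord n →L[ℝ] ℝ}
    {X : Coord n → Coord n} (hT : DifferentiableAt ℝ T u) (hX : DifferentiableAt ℝ X u)
    (w : Coord n) : DifferentiableAt ℝ (fun y => T y (X y) w) u :=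
  (hT.clm_apply hX).clm_apply (differentiableAt_const w)

lemma acceleration_eq (i : Fin n) : acceleration (tcomps g) (vcomps ξ) u i = cov g ξ u (ξ u) i :=
  rfl

/-- Nondegeneracy is an open condition, since the determinant of `g + s h` is continuous in `s`. -/
lemma IsMetricAt.eventually (hg : IsMetricAt g u) (hh : DifferentiableAt ℝ h u)
    (hs : ∀ y v w, h y v w = h y w v) :
    ∀ᶠ s in nhds (0 : ℝ), IsMetricAt (fun y => g y + s • h y) u := by
  have hc : Continuous fun s : ℝ => (tcomps (fun y => g y + s • h y) u).det := by
    refine Continuous.matrix_det ?_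
    refine continuous_pi fun i => continuous_pi fun j => ?_
    simp only [tcomps, comps, Matrix.of_apply, _root_.add_apply, _root_.smul_apply, smul_eq_mul]
    fun_prop
  have h0 : (tcomps (fun y => g y + (0 : ℝ) • h y) u).det ≠ 0 := by
    rw [form_line_zero]
    exact hg.det
  filter_upwards [hc.continuousAt.eventually_ne h0] with s hs'
  refine ⟨differentiableAt_form_line hg.diff hh s, fun y v w => ?_, hs'⟩
  simp [hg.symm y v, hs y v]

/-- Lowering the index removes the inverse metric from the acceleration, leaving a polynomial
expression in the fields and their first derivatives. The variation can then be computed without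
differentiating an inverse matrix. -/
lemma IsMetricAt.lower_cov (hg : IsMetricAt g u) (hξ : DifferentiableAt ℝ ξ u) (w : Coord n) :
    g u (cov g ξ u (ξ u)) w = g u (fderiv ℝ ξ u (ξ u)) w + fderiv ℝ g u (ξ u) (ξ u) w
      - (1 / 2) * fderiv ℝ g u w (ξ u) (ξ u) := by
  rw [cov_eq hξ, map_add, _root_.add_apply, hg.chr_spec]
  ring

set_option synthInstance.maxHeartbeats 200000 in
/-- The first variation of the equation `ξ^ν D_ν ξ_μ = κ ξ_μ`, in coordinates. -/
lemma IsMetricAt.variation_acceleration (hg : IsMetricAt g u) (hh : DifferentiableAt ℝ h u)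
    (hs : ∀ y v w, h y v w = h y w v) (hξ : DifferentiableAt ℝ ξ u) (ha : DifferentiableAt ℝ a u)
    {κ δκ : ℝ} (hκ : ∀ i, acceleration (tcomps g) (vcomps ξ) u i = κ * ξ u i)
    (hδκ : ∀ i, HasDerivAt (fun s : ℝ =>
      acceleration (tcomps fun y => g y + s • h y) (vcomps fun y => ξ y + s • a y) u i
        - (κ + s * δκ) * (ξ u + s • a u) i) 0 0) (w : Coord n) :
    h u (fderiv ℝ ξ u (ξ u)) w + g u (fderiv ℝ a u (ξ u)) w + g u (fderiv ℝ ξ u (a u)) w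
      + (fderiv ℝ h u (ξ u) (ξ u) w + fderiv ℝ g u (a u) (ξ u) w + fderiv ℝ g u (ξ u) (a u) w)
      - (1 / 2) * (fderiv ℝ h u w (ξ u) (ξ u) + fderiv ℝ g u w (a u) (ξ u)
        + fderiv ℝ g u w (ξ u) (a u))
      = δκ * g u (ξ u) w + κ * (h u (ξ u) w + g u (a u) w) := by
  set D : Fin n → ℝ → ℝ := fun i s =>
      acceleration (tcomps fun y => g y + s • h y) (vcomps fun y => ξ y + s • a y) u i
        - (κ + s * δκ) * (ξ u + s • a u) i with hD
  have hD0 : ∀ i, D i 0 = 0 := fun i => by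
    simp only [hD]
    rw [form_line_zero, line_zero, hκ]
    simp
  -- Lowering the index with the perturbed metric keeps the derivative zero: the variation of the
  -- metric multiplies `D i 0`, which vanishes by the unperturbed equation.
  have e1 : HasDerivAt (fun s : ℝ => ∑ i, ∑ j, D i s * w j *
      (g u (EuclideanSpace.single i 1) (EuclideanSpace.single j 1)
        + s * h u (EuclideanSpace.single i 1) (EuclideanSpace.single j 1))) 0 0 := by
    refine HasDerivAt.congr_deriv (f' := ∑ i : Fin n, ∑ j : Fin n, (0 : ℝ)) ?_ (by simp)
    refine HasDerivAt.fun_sum fun i _ => HasDerivAt.fun_sum fun j _ => ?_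
    have h2 := ((hasDerivAt_id (0 : ℝ)).mul_const
      (h u (EuclideanSpace.single i 1) (EuclideanSpace.single j 1))).const_add
      (g u (EuclideanSpace.single i 1) (EuclideanSpace.single j 1))
    have h3 := ((hδκ i).mul_const (w j)).mul h2
    refine (h3.congr_deriv ?_).congr_of_eventuallyEq (Filter.Eventually.of_forall fun s => rfl)
    have := hD0 i
    simp only [hD] at this
    rw [this, zero_mul, zero_mul, zero_mul, add_zero]
  set x := ξ u
  set b := a u
  set dx := fderiv ℝ ξ u
  set db := fderiv ℝ a u
  set dg := fderiv ℝ g u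
  set dh := fderiv ℝ h u
  -- For `s` near zero `g + s h` is a metric, so `lower_cov` applies to it and exhibits the cubic.
  have e2 : (fun s : ℝ => ∑ i, ∑ j, D i s * w j *
      (g u (EuclideanSpace.single i 1) (EuclideanSpace.single j 1)
        + s * h u (EuclideanSpace.single i 1) (EuclideanSpace.single j 1)))
      =ᶠ[nhds 0] fun s : ℝ =>
        (g u + s • h u) ((dx + s • db) (x + s • b)) w
          + (dg + s • dh) (x + s • b) (x + s • b) w
          - (1 / 2) * (dg + s • dh) w (x + s • b) (x + s • b)
          - (κ + s * δκ) * (g u + s • h u) (x + s • b) w := by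
    filter_upwards [hg.eventually hh hs] with s hgs
    have hX : DifferentiableAt ℝ (fun y => ξ y + s • a y) u :=
      differentiableAt_line hξ ha s
    have h1 := hgs.lower_cov hX w
    have d1 : fderiv ℝ (fun y => ξ y + s • a y) u = dx + s • db :=
      fderiv_line hξ ha s
    have d2 : fderiv ℝ (fun y => g y + s • h y) u = dg + s • dh :=
      fderiv_form_line hg.diff hh s
    rw [d1, d2] at h1
    rw [← h1]
    set Gs := fun y => g y + s • h y with hGs
    have h4 : ∑ i, ∑ j, D i s * w j *
        (g u (EuclideanSpace.single i 1) (EuclideanSpace.single j 1)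
          + s * h u (EuclideanSpace.single i 1) (EuclideanSpace.single j 1))
        = Gs u (cov Gs (fun y => ξ y + s • a y) u (ξ u + s • a u)
            - (κ + s * δκ) • (ξ u + s • a u)) w := by
      rw [clm_apply_eq_sum (Gs u)]
      rfl
    rw [h4, map_sub, map_smul, _root_.sub_apply, _root_.smul_apply, smul_eq_mul]
  have e3 := (e1.congr_of_eventuallyEq e2.symm)
  -- The four coefficients of the cubic; the second is the claimed identity, and uniqueness of the
  -- derivative makes it zero.
  have e4 := hasDerivAt_cubic
    (g u (dx x) w + dg x x w - (1 / 2) * dg w x x - κ * g u x w)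
    (h u (dx x) w + g u (db x) w + g u (dx b) w + (dh x x w + dg b x w + dg x b w)
      - (1 / 2) * (dh w x x + dg w b x + dg w x b)
      - (δκ * g u x w + κ * (h u x w + g u b w)))
    (h u (db x) w + h u (dx b) w + g u (db b) w + (dh b x w + dh x b w + dg b b w)
      - (1 / 2) * (dh w b x + dh w x b + dg w b b)
      - (δκ * (h u x w + g u b w) + κ * h u b w))
    (h u (db b) w + dh b b w - (1 / 2) * dh w b b - δκ * h u b w)
  have e5 := e3.unique (e4.congr_of_eventuallyEq (Filter.Eventually.of_forall fun s => by
    simp only [map_add, map_smul, _root_.add_apply, _root_.smul_apply, smul_eq_mul]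
    ring))
  linarith

variable {d : ℕ}

/-- The pointwise form of the theorem, in coordinates. -/
theorem komar_add_thetaContr {g h : Coord (d + 2) → Coord (d + 2) →L[ℝ] Coord (d + 2) →L[ℝ] ℝ}
    {ξ a : Coord (d + 2) → Coord (d + 2)} {u N : Coord (d + 2)}
    {e : Fin d → Coord (d + 2)} {γ : Matrix (Fin d) (Fin d) ℝ}
    (hg : IsMetricAt g u) (hf : IsAdaptedFrame (g u) N (ξ u) e γ)
    (hh : DifferentiableAt ℝ h u) (hs : ∀ y v w, h y v w = h y w v)
    (hξ : DifferentiableAt ℝ ξ u) (ha : DifferentiableAt ℝ a u)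
    (killing : ∀ i j, lieDeriv (vcomps ξ) (tcomps g) u i j = 0)
    (stat : ∀ i j, lieDeriv (vcomps ξ) (tcomps h) u i j + lieDeriv (vcomps a) (tcomps g) u i j = 0)
    {κ δκ lam : ℝ} (hκ : ∀ i, acceleration (tcomps g) (vcomps ξ) u i = κ * ξ u i)
    (hδκ : ∀ i, HasDerivAt (fun s : ℝ =>
      acceleration (tcomps fun y => g y + s • h y) (vcomps fun y => ξ y + s • a y) u i
        - (κ + s * δκ) * (ξ u + s • a u) i) 0 0)
    (hb : ∀ v, h u (ξ u) v + g u (a u) v = lam * g u (ξ u) v)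
    (tang : ∀ w z v, g u (ξ u) v = 0 →
      fderiv ℝ (fun y => (h y (ξ y) w + g y (a y) w) * g y (ξ y) z
        - (h y (ξ y) z + g y (a y) z) * g y (ξ y) w) u v = 0) :
    g u (cov g a u (ξ u)) N - g u (cov g a u N) (ξ u) + thetaContr g h u N (ξ u) e γ
      = -2 * δκ + ∑ i, ∑ j, γ⁻¹ i j * g u (cov g a u (e i)) (e j) := by
  have hKill : ∀ v w, g u (cov g ξ u v) w + g u v (cov g ξ u w) = 0 := fun v w => by
    rw [← hg.lieForm_self hξ, clm_apply_eq_sum]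
    simp only [← lieDeriv_eq hg.diff hξ, killing, mul_zero, Finset.sum_const_zero]
  have hStat : ∀ v w, covT g h u (ξ u) v w + h u (cov g ξ u v) w + h u v (cov g ξ u w)
      + g u (cov g a u v) w + g u v (cov g a u w) = 0 := fun v w => by
    have h1 : (lieForm ξ h u + lieForm a g u) v w = 0 := by
      rw [clm_apply_eq_sum]
      simp only [_root_.add_apply, ← lieDeriv_eq hg.diff ha, ← lieDeriv_eq hh hξ, stat, mul_zero,
        Finset.sum_const_zero]
    rw [_root_.add_apply, _root_.add_apply, hg.lieForm_self ha, hg.lieForm_eq hh hξ] at h1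
    linarith
  have hcovsymm := covT_symm (g := g) hh hs
  rw [thetaContr, ← add_sub_assoc]
  refine komar_add_theta_eq (fun v w => g u v w) (fun v w => h u v w) (covT g h u)
    (cov g ξ u) (cov g a u) (ξ u) N (a u) e (fun i j => γ⁻¹ i j) lam κ δκ ?_ (hg.symm u) (hs u)
    hcovsymm hKill hStat hb ?_ hf.nullξ ?_ ?_ hf.norm hf.orthξ ?_
  · intro i j
    have h1 : γ.transpose = γ := by
      ext i j
      rw [Matrix.transpose_apply, hf.gram, hf.gram, hf.symm]
    conv_lhs => rw [← h1, ← Matrix.transpose_nonsing_inv]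
    rfl
  · intro v hv
    -- Write `b` for the covector `δ(ξ_μ)`. Differentiating `b_w ξ_z - b_z ξ_w` instead of `b = λ ξ`
    -- avoids any regularity of `λ`. Choosing `z = N`, where `ξ · N = -1`, solves for the derivative
    -- of `b` and yields the multiplier `μ`.
    obtain ⟨μ, key⟩ : ∃ μ, ∀ w, (fderiv ℝ h u v (ξ u) w + h u (fderiv ℝ ξ u v) w
        + (fderiv ℝ g u v (a u) w + g u (fderiv ℝ a u v) w))
        - lam * (fderiv ℝ g u v (ξ u) w + g u (fderiv ℝ ξ u v) w)
        = μ * g u (ξ u) w := by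
      refine ⟨-((fderiv ℝ h u v (ξ u) N + h u (fderiv ℝ ξ u v) N
        + (fderiv ℝ g u v (a u) N + g u (fderiv ℝ a u v) N))
        - lam * (fderiv ℝ g u v (ξ u) N + g u (fderiv ℝ ξ u v) N)), fun w => ?_⟩
      have t := tang w N v hv
      have db : ∀ w, DifferentiableAt ℝ (fun y => h y (ξ y) w + g y (a y) w) u := fun w =>
        (differentiableAt_clm_field hh hξ w).add (differentiableAt_clm_field hg.diff ha w)
      have dx := differentiableAt_clm_field hg.diff hξ
      have fb : ∀ w, fderiv ℝ (fun y => h y (ξ y) w + g y (a y) w) u v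
          = fderiv ℝ h u v (ξ u) w + h u (fderiv ℝ ξ u v) w
            + (fderiv ℝ g u v (a u) w + g u (fderiv ℝ a u v) w) := fun w => by
        rw [fderiv_fun_add (differentiableAt_clm_field hh hξ w)
          (differentiableAt_clm_field hg.diff ha w), _root_.add_apply, fderiv_clm_field hh hξ,
          fderiv_clm_field hg.diff ha]
      have t1 := ((db w).hasFDerivAt.mul (dx N).hasFDerivAt).sub
        ((db N).hasFDerivAt.mul (dx w).hasFDerivAt)
      have t2 : HasFDerivAt (fun y => (h y (ξ y) w + g y (a y) w) * g y (ξ y) N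
        - (h y (ξ y) N + g y (a y) N) * g y (ξ y) w) _ u := t1
      rw [t2.fderiv] at t
      simp only [_root_.sub_apply, _root_.add_apply, _root_.smul_apply, smul_eq_mul, fb,
        fderiv_clm_field hg.diff hξ, hb] at t
      have hn : g u (ξ u) N = -1 := by rw [hg.symm, hf.norm]
      rw [hn] at t
      linarith
    refine ⟨μ, fun w => ?_⟩
    -- Passing from partial to covariant derivatives changes the relation by `b - λ ξ` evaluated on
    -- `chr g u v w`, and this vanishes by `hb`.
    have k := key w
    have b1 := hb (chr g u v w)
    have m1 := hg.fderiv_eq v (a u) w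
    have m2 := hg.fderiv_eq v (ξ u) w
    rw [covT_eq hh, cov_eq hξ, cov_eq ha, map_add, map_add, map_add, _root_.add_apply,
      _root_.add_apply, _root_.add_apply]
    linear_combination k + lam * m2 - m1 - b1
  · intro w
    have : cov g ξ u (ξ u) = κ • ξ u := by
      ext i
      exact hκ i
    rw [this, map_smul, _root_.smul_apply, smul_eq_mul]
  · intro w
    rw [← hg.variation_acceleration hh hs hξ ha hκ hδκ w, covT_eq hh, covT_eq hh, cov_eq hξ,
      cov_eq ha, cov_eq hξ]
    simp only [map_add, _root_.add_apply]
    rw [hg.chr_spec (ξ u) (a u), hg.chr_spec (a u) (ξ u), hs u _ (chr g u w (ξ u)),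
      hg.chr_symm w (ξ u), fderiv_symm hg.diff hg.symm w (a u)]
    rw [hs u (ξ u) (chr g u (ξ u) w)]
    ring
  · have h1 := hf.trace_eq (fun v w => h u (cov g ξ u v) w) (fun i j =>
      h u (cov g ξ u (EuclideanSpace.single i 1)) (EuclideanSpace.single j 1)) (fun v w => by
        rw [cov_eq_sum, map_sum, _root_.sum_apply]
        refine Finset.sum_congr rfl fun i _ => ?_
        rw [map_smul, _root_.smul_apply, clm_eq_sum _ w, Finset.smul_sum]
        exact Finset.sum_congr rfl fun j _ => by simp only [smul_eq_mul]; ring)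
    rw [← h1]
    exact hg.trace_antisymm hKill (h u) (hs u)

end Pointwise

/-! ### Functions vanishing on a Killing horizon. -/

section Horizon

variable {n : ℕ} {M : Type*} [TopologicalSpace M] [ChartedSpace (Coord n) M]
  [IsManifold (𝓡 n) ∞ M] {g : TField n M} {ξ : VField n M} {𝓗 : Set M}

lemma tensorIn_symm {T : TField n M} (hT : SymmTensor T) (x : M) (y v w : Coord n) :
    tensorIn T x y v w = tensorIn T x y w v := hT _ _ _

lemma tensorIn_differentiableAt {T : TField n M} (hT : SmoothTensor T) {x : M} {u : Coord n}
    (hu : u ∈ (extChartAt (𝓡 n) x).target) : DifferentiableAt ℝ (tensorIn T x) u :=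
  ((contDiffOn_tensorIn hT x).contDiffAt (target_mem_nhds hu)).differentiableAt (by simp)

lemma vecIn_differentiableAt {X : VField n M} (hX : SmoothVector X) {x : M} {u : Coord n}
    (hu : u ∈ (extChartAt (𝓡 n) x).target) : DifferentiableAt ℝ (vecIn X x) u :=
  ((contDiffOn_vecIn hX x).contDiffAt (target_mem_nhds hu)).differentiableAt (by simp)

lemma tensorIn_vecIn (T : TField n M) (X : VField n M) {x : M} {u : Coord n}
    (hu : u ∈ (extChartAt (𝓡 n) x).target) (v : Coord n) :
    tensorIn T x u (vecIn X x u) v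
      = T ((extChartAt (𝓡 n) x).symm u) (X ((extChartAt (𝓡 n) x).symm u)) (chartFrame x u v) := by
  have h : chartFrame x u (vecIn X x u) = X ((extChartAt (𝓡 n) x).symm u) :=
    chartFrame_vecCoord hu _
  rw [tensorIn_apply, h]

lemma tensorIn_vecIn_vecIn (T : TField n M) (X Y : VField n M) {x : M} {u : Coord n}
    (hu : u ∈ (extChartAt (𝓡 n) x).target) :
    tensorIn T x u (vecIn X x u) (vecIn Y x u)
      = T ((extChartAt (𝓡 n) x).symm u) (X ((extChartAt (𝓡 n) x).symm u))
        (Y ((extChartAt (𝓡 n) x).symm u)) := by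
  have h : chartFrame x u (vecIn Y x u) = Y ((extChartAt (𝓡 n) x).symm u) :=
    chartFrame_vecCoord hu _
  rw [tensorIn_vecIn T X hu, h]

/-- The differential of a function vanishing on the horizon is proportional to `ξ_μ`. -/
lemma IsKillingHorizon.exists_fderiv_eq (hhor : IsKillingHorizon g ξ 𝓗) {x : M} {u : Coord n}
    (hu : u ∈ (extChartAt (𝓡 n) x).target) (hp : (extChartAt (𝓡 n) x).symm u ∈ 𝓗)
    {F : Coord n → ℝ} (hF : ContDiffAt ℝ ∞ F u)
    (hF0 : ∀ y ∈ (extChartAt (𝓡 n) x).target, (extChartAt (𝓡 n) x).symm y ∈ 𝓗 → F y = 0) :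
    ∃ μ : ℝ, ∀ v, fderiv ℝ F u v = μ * tensorIn g x u (vecIn ξ x u) v := by
  obtain ⟨U, hUo, hpU, S, hS, hSU, hd⟩ := hhor.hypersurface _ hp
  obtain ⟨hdS, f, hf, hfS⟩ := hd _ ⟨hp, hpU⟩
  have hSp : ContMDiffAt (𝓡 n) 𝓘(ℝ, ℝ) ∞ S ((extChartAt (𝓡 n) x).symm u) :=
    hS.contMDiffAt (hUo.mem_nhds hpU)
  have h1 := (contMDiffOn_extChartAt_symm (I := 𝓡 n) (n := ∞) x).contMDiffAt
    (target_mem_nhds hu)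
  have hSx : ContDiffAt ℝ ∞ (fun y => S ((extChartAt (𝓡 n) x).symm y)) u :=
    contMDiffAt_iff_contDiffAt.1 (hSp.comp u h1)
  have hdSx := fderiv_comp_symm hu (hSp.mdifferentiableAt (by simp))
  have hSu : S ((extChartAt (𝓡 n) x).symm u) = 0 := by
    have : (extChartAt (𝓡 n) x).symm u ∈ 𝓗 ∩ U := ⟨hp, hpU⟩
    rw [hSU] at this
    exact this.2
  -- Since `F` is constant on the level set of `S` near `u`, the point is trivially a constrained
  -- extremum, and Lagrange multipliers give `α dS + β dF = 0`.
  have hext : IsLocalExtrOn F {y | S ((extChartAt (𝓡 n) x).symm y)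
      = S ((extChartAt (𝓡 n) x).symm u)} u := by
    refine Or.inl ?_
    have hev : ∀ᶠ y in nhdsWithin u {y | S ((extChartAt (𝓡 n) x).symm y)
      = S ((extChartAt (𝓡 n) x).symm u)}, F u ≤ F y := by
      have hU : ∀ᶠ y in nhds u, (extChartAt (𝓡 n) x).symm y ∈ U :=
        (mdifferentiableAt_symm hu).continuousAt.eventually (hUo.mem_nhds hpU)
      filter_upwards [nhdsWithin_le_nhds hU, nhdsWithin_le_nhds (target_mem_nhds hu),
        self_mem_nhdsWithin] with y hyU hyt hyS
      have hy : (extChartAt (𝓡 n) x).symm y ∈ 𝓗 ∩ U := by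
        rw [hSU]
        exact ⟨hyU, hyS.trans hSu⟩
      rw [hF0 u hu hp, hF0 y hyt hy.1]
    exact hev
  obtain ⟨α, β, hαβ, hsum⟩ := hext.exists_multipliers_of_hasStrictFDerivAt_1d
    (hSx.hasStrictFDerivAt (by simp)) (hF.hasStrictFDerivAt (by simp))
  -- If `β` were zero, the relation would force `dS = 0`.
  have hβ : β ≠ 0 := by
    rintro rfl
    have hα : α ≠ 0 := fun h => hαβ (by simp [h])
    refine hdS ?_
    ext w
    have h2 := hdSx (vecCoord x w)
    have h3 := DFunLike.congr_fun hsum (vecCoord x w)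
    have h4 : α * fderiv ℝ (fun z => S ((extChartAt (𝓡 n) x).symm z)) u (vecCoord x w) = 0 := by
      simpa using h3
    have h5 := (mul_eq_zero.1 h4).resolve_left hα
    rw [h5] at h2
    have h6 : chartFrame x u (vecCoord x w) = w := chartFrame_vecCoord hu w
    rw [h6] at h2
    exact h2.symm
  refine ⟨-(α / (β * f)), fun v => ?_⟩
  have h3 : α * fderiv ℝ (fun z => S ((extChartAt (𝓡 n) x).symm z)) u v + β * fderiv ℝ F u v
      = 0 := DFunLike.congr_fun hsum v
  have h7 := hfS (chartFrame x u v)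
  rw [tensorIn_vecIn g ξ hu, h7, ← hdSx v]
  field_simp
  linarith

end Horizon

/-! ### The pointwise identity on a spacelike section of the horizon. -/

section Section

variable {d : ℕ} {M : Type*} [TopologicalSpace M] [ChartedSpace (Coord (d + 2)) M]
  [IsManifold (𝓡 (d + 2)) ∞ M]
  {H : Type*} [TopologicalSpace H] [ChartedSpace (Coord d) H] [IsManifold (𝓡 d) ∞ H]
  {g δg : TField (d + 2) M} {ξ δξ : VField (d + 2) M} {𝓗 : Set M} {κ δκ : M → ℝ} {ι : H → M}
  {N : (q : H) → TangentSpace (𝓡 (d + 2)) (ι q)} {GN : ℝ}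

/-- The defining function `S` vanishes along `ι`, so `dS` kills the tangent vectors of `H`, and
`ξ_μ` is a multiple of `dS`. -/
lemma IsKillingHorizon.orthogonal_push (hhor : IsKillingHorizon g ξ 𝓗)
    (hι : IsSpacelikeSection g 𝓗 ι) (q : H) (w : TangentSpace (𝓡 d) q) :
    g (ι q) (ξ (ι q)) (push ι q w) = 0 := by
  obtain ⟨U, hUo, hpU, S, hS, hSU, hd⟩ := hhor.hypersurface _ (hι.mem q)
  obtain ⟨hdS, f, hf, hfS⟩ := hd _ ⟨hι.mem q, hpU⟩
  have hSp : MDifferentiableAt (𝓡 (d + 2)) 𝓘(ℝ, ℝ) S (ι q) :=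
    (hS.contMDiffAt (hUo.mem_nhds hpU)).mdifferentiableAt (by simp)
  have hιd : MDifferentiableAt (𝓡 d) (𝓡 (d + 2)) ι q := hι.smooth.mdifferentiable (by simp) q
  have h1 := mfderiv_comp q hSp hιd
  have h2 : S ∘ ι =ᶠ[nhds q] fun _ => (0 : ℝ) := by
    filter_upwards [hι.smooth.continuous.continuousAt.eventually (hUo.mem_nhds hpU)] with y hy
    have : ι y ∈ 𝓗 ∩ U := ⟨hι.mem y, hy⟩
    rw [hSU] at this
    exact this.2
  have h3 : mfderiv (𝓡 d) 𝓘(ℝ, ℝ) (S ∘ ι) q = 0 := by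
    rw [h2.mfderiv_eq]
    exact mfderiv_const
  rw [h3] at h1
  rw [hfS]
  have h4 : mvfderiv (𝓡 (d + 2)) S (ι q) (push ι q w) = 0 := (DFunLike.congr_fun h1 w).symm
  rw [h4, mul_zero]

/-- The coordinate vectors of `H` in the chart around `c`, pushed to the preferred chart of `M`
around `ι q`. -/
def pushFrame (ι : H → M) (c : H) (u : Coord d) (i : Fin d) : Coord (d + 2) :=
  vecCoord (ι ((extChartAt (𝓡 d) c).symm u))
    (push ι ((extChartAt (𝓡 d) c).symm u) (basisVec c u i))

/-- The components of the induced metric on `H`. -/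
def induced (g : TField (d + 2) M) (ι : H → M) (c : H) (u : Coord d) :
    Matrix (Fin d) (Fin d) ℝ :=
  Matrix.of fun i j => g (ι ((extChartAt (𝓡 d) c).symm u))
    (push ι ((extChartAt (𝓡 d) c).symm u) (basisVec c u i))
    (push ι ((extChartAt (𝓡 d) c).symm u) (basisVec c u j))

lemma tensorIn_vecCoord_self (T : TField (d + 2) M) (p : M) (v w : TangentSpace (𝓡 (d + 2)) p) :
    tensorIn T p (extChartAt (𝓡 (d + 2)) p p) (vecCoord p v) (vecCoord p w) = T p v w :=
  tensorIn_vecCoord T (mem_chart_source _ p) v w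

lemma vecIn_self (X : VField (d + 2) M) (p : M) :
    vecIn X p (extChartAt (𝓡 (d + 2)) p p) = vecCoord p (X p) :=
  vecIn_extChartAt X (mem_chart_source _ p)

/-- The push-forward of coordinate vectors, as a linear map. -/
def pushIn (ι : H → M) (c : H) (u : Coord d) : Coord d →L[ℝ] Coord (d + 2) :=
  (mfderiv (𝓡 d) (𝓡 (d + 2)) ι ((extChartAt (𝓡 d) c).symm u) :
    Coord d →L[ℝ] Coord (d + 2)).comp (chartFrame c u)

lemma pushIn_apply (c : H) (u v : Coord d) :
    pushIn ι c u v = push ι ((extChartAt (𝓡 d) c).symm u) (chartFrame c u v) := rfl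

/-- The induced metric as a bilinear form in the chart around `c`. -/
def inducedForm (g : TField (d + 2) M) (ι : H → M) (c : H) (u : Coord d) :
    Coord d →L[ℝ] Coord d →L[ℝ] ℝ :=
  (g.form (ι ((extChartAt (𝓡 d) c).symm u))).bilinearComp (pushIn ι c u) (pushIn ι c u)

lemma induced_eq (c : H) (u : Coord d) : induced g ι c u = comps (inducedForm g ι c u) := rfl

/-- The coordinate frame of `H` is injective, so a nonzero coefficient vector gives a nonzero
tangent vector, on which the section is spacelike. -/
lemma posDef_induced (hg : SymmTensor g) (hι : IsSpacelikeSection g 𝓗 ι) {c : H} {u : Coord d}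
    (hu : u ∈ (extChartAt (𝓡 d) c).target) : (induced g ι c u).PosDef := by
  refine Matrix.posDef_iff_dotProduct_mulVec.2 ⟨?_, fun {x} hx => ?_⟩
  · ext i j
    exact hg _ _ _
  · have h1 : inducedForm g ι c u (WithLp.toLp 2 x) (WithLp.toLp 2 x)
        = star x ⬝ᵥ (induced g ι c u).mulVec x := by
      rw [clm_apply_eq_sum]
      simp only [dotProduct, Matrix.mulVec, induced_eq, comps, Matrix.of_apply, Finset.mul_sum,
        star_trivial]
      exact Finset.sum_congr rfl fun i _ => Finset.sum_congr rfl fun j _ => by ring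
    rw [← h1]
    refine hι.spacelike _ (chartFrame c u (WithLp.toLp 2 x)) fun h => hx ?_
    have h2 := vecCoord_chartFrame hu (WithLp.toLp 2 x)
    rw [h] at h2
    have h3 : (WithLp.toLp 2 x : Coord d) = 0 := by
      rw [← h2]
      exact map_zero (mfderiv (𝓡 d) 𝓘(ℝ, Coord d) (extChartAt (𝓡 d) c)
        ((extChartAt (𝓡 d) c).symm u))
    funext i
    exact congrArg (fun v : Coord d => v i) h3

lemma isAdaptedFrame (hg : IsLorentzMetric g) (hhor : IsKillingHorizon g ξ 𝓗)
    (hι : IsSpacelikeSection g 𝓗 ι) (hN : IsTransverseNull g ξ ι N) {c : H} {u : Coord d}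
    (hu : u ∈ (extChartAt (𝓡 d) c).target) {q : H} (hq : q = (extChartAt (𝓡 d) c).symm u) :
    IsAdaptedFrame (tensorIn g (ι q) (extChartAt (𝓡 (d + 2)) (ι q) (ι q)))
      (vecCoord (ι q) (N q)) (vecIn ξ (ι q) (extChartAt (𝓡 (d + 2)) (ι q) (ι q)))
      (pushFrame ι c u) (induced g ι c u) := by
  subst hq
  set q := (extChartAt (𝓡 d) c).symm u
  rw [vecIn_self]
  refine ⟨fun v w => tensorIn_symm hg.symm _ _ _ _, ?_, ?_, ?_, fun i => ?_, fun i => ?_,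
    fun i j => ?_, (posDef_induced hg.symm hι hu).det_pos⟩
  · rw [tensorIn_vecCoord_self]; exact hN.null q
  · rw [tensorIn_vecCoord_self]; exact hhor.null _ (hι.mem q)
  · rw [tensorIn_vecCoord_self]; exact hN.normalized q
  · exact (tensorIn_vecCoord_self g _ _ _).trans (hN.orthogonal q _)
  · exact (tensorIn_vecCoord_self g _ _ _).trans (hhor.orthogonal_push hι q _)
  · exact (tensorIn_vecCoord_self g _ _ _).symm

/-- The density of `k^K_X` relative to the area: `(D_ξ X) · N - (D_N X) · ξ`. -/
def komarScalar (g : TField (d + 2) M) (ξ : VField (d + 2) M) (ι : H → M)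
    (N : (q : H) → TangentSpace (𝓡 (d + 2)) (ι q)) (X : VField (d + 2) M) (q : H) : ℝ :=
  let u := extChartAt (𝓡 (d + 2)) (ι q) (ι q)
  let G := tensorIn g (ι q)
  let x := vecIn ξ (ι q) u
  let y := vecCoord (ι q) (N q)
  G u (cov G (vecIn X (ι q)) u x) y - G u (cov G (vecIn X (ι q)) u y) x

/-- `γ^{AB} g(D_A X, e_B)`, the trace over `H` of the covariant derivative of a vector field. -/
def surfaceDiv (g : TField (d + 2) M) (ι : H → M) (X : VField (d + 2) M) (c : H) (v : Coord d) :
    ℝ :=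
  let p := ι ((extChartAt (𝓡 d) c).symm v)
  let u := extChartAt (𝓡 (d + 2)) p p
  ∑ i, ∑ j, (induced g ι c v)⁻¹ i j *
    tensorIn g p u (cov (tensorIn g p) (vecIn X p) u (pushFrame ι c v i)) (pushFrame ι c v j)

/-- Nondegeneracy at points of `H` is read off the adapted frame through `det_ne_zero`. -/
lemma isMetricAt (hg : IsLorentzMetric g) (hhor : IsKillingHorizon g ξ 𝓗)
    (hι : IsSpacelikeSection g 𝓗 ι) (hN : IsTransverseNull g ξ ι N) (q : H) :
    IsMetricAt (tensorIn g (ι q)) (extChartAt (𝓡 (d + 2)) (ι q) (ι q)) := by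
  exact ⟨tensorIn_differentiableAt hg.smooth (mem_extChartAt_target _),
    fun y v w => tensorIn_symm hg.symm _ _ _ _,
    (isAdaptedFrame hg hhor hι hN (mem_extChartAt_target q)
      (extChartAt_to_inv (I := 𝓡 d) q).symm).det_ne_zero⟩

lemma sign_mul_eq_abs (r : ℝ) : Real.sign r * r = |r| := by
  rcases lt_trichotomy r 0 with h | rfl | h
  · rw [Real.sign_of_neg h, abs_of_neg h]; ring
  · simp
  · rw [Real.sign_of_pos h, abs_of_pos h]; ring

/-- The orientation sign turns `vol(N, ξ, e)` into its absolute value, and `sqrt_det_eq` then turns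
`√(-g) |vol|` into the area element. Both densities get the same treatment. -/
lemma orientSign_mul (hg : IsLorentzMetric g) (hhor : IsKillingHorizon g ξ 𝓗)
    (hι : IsSpacelikeSection g 𝓗 ι) (hN : IsTransverseNull g ξ ι N) {c : H} {u : Coord d}
    (hu : u ∈ (extChartAt (𝓡 d) c).target) {q : H} (hq : q = (extChartAt (𝓡 d) c).symm u) (k : ℝ) :
    orientSign ξ ι N ((extChartAt (𝓡 d) c).symm u) (fun i => basisVec c u i)
      * (Real.sqrt (-(tcomps (tensorIn g (ι q)) (extChartAt (𝓡 (d + 2)) (ι q) (ι q))).det)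
          / (16 * Real.pi * GN) * (k * volDet (Fin.cons (vecCoord (ι q) (N q))
            (Fin.cons (vecIn ξ (ι q) (extChartAt (𝓡 (d + 2)) (ι q) (ι q))) (pushFrame ι c u)))))
      = 1 / (16 * Real.pi * GN) * k * Real.sqrt (induced g ι c u).det := by
  have hf := isAdaptedFrame hg hhor hι hN hu hq
  rw [← hf.sqrt_det_eq, ← sign_mul_eq_abs]
  have h1 : orientSign ξ ι N ((extChartAt (𝓡 d) c).symm u) (fun i => basisVec c u i)
      = Real.sign (volDet (Fin.cons (vecCoord (ι q) (N q))
            (Fin.cons (vecIn ξ (ι q) (extChartAt (𝓡 (d + 2)) (ι q) (ι q))) (pushFrame ι c u)))) := by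
    subst hq
    rw [vecIn_self]
    rfl
  rw [h1, tcomps]
  ring

lemma komarDensity_eq (hg : IsLorentzMetric g) (hhor : IsKillingHorizon g ξ 𝓗)
    (hι : IsSpacelikeSection g 𝓗 ι) (hN : IsTransverseNull g ξ ι N) {c : H} {u : Coord d}
    (hu : u ∈ (extChartAt (𝓡 d) c).target) :
    komarDensity GN g ξ ι N δξ ((extChartAt (𝓡 d) c).symm u) (fun i => basisVec c u i)
      = 1 / (16 * Real.pi * GN) * komarScalar g ξ ι N δξ ((extChartAt (𝓡 d) c).symm u)
        * Real.sqrt (induced g ι c u).det := by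
  have hf := isAdaptedFrame hg hhor hι hN hu rfl
  have hG := isMetricAt hg hhor hι hN ((extChartAt (𝓡 d) c).symm u)
  have h1 := komarForm_eq (a := vecIn δξ (ι ((extChartAt (𝓡 d) c).symm u))) GN hG hf
  rw [← orientSign_mul hg hhor hι hN hu rfl]
  refine Eq.trans ?_ (congrArg (fun z =>
    orientSign ξ ι N ((extChartAt (𝓡 d) c).symm u) (fun i => basisVec c u i) * z) h1)
  rfl

lemma thetaDensity_eq (hg : IsLorentzMetric g) (hhor : IsKillingHorizon g ξ 𝓗)
    (hvar : IsStationaryVariation g ξ 𝓗 δg δξ)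
    (hι : IsSpacelikeSection g 𝓗 ι) (hN : IsTransverseNull g ξ ι N) {c : H} {u : Coord d}
    (hu : u ∈ (extChartAt (𝓡 d) c).target) {q : H} (hq : q = (extChartAt (𝓡 d) c).symm u) :
    thetaDensity GN g ξ ι N δg ((extChartAt (𝓡 d) c).symm u) (fun i => basisVec c u i)
      = 1 / (16 * Real.pi * GN) * (-thetaContr (tensorIn g (ι q)) (tensorIn δg (ι q))
          (extChartAt (𝓡 (d + 2)) (ι q) (ι q)) (vecCoord (ι q) (N q))
          (vecIn ξ (ι q) (extChartAt (𝓡 (d + 2)) (ι q) (ι q))) (pushFrame ι c u)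
          (induced g ι c u))
        * Real.sqrt (induced g ι c u).det := by
  have hf := isAdaptedFrame hg hhor hι hN hu hq
  have hG := isMetricAt hg hhor hι hN q
  have h1 := thetaForm_eq GN hG hf (tensorIn_differentiableAt hvar.smooth_metric
    (mem_extChartAt_target _)) (fun y v w => tensorIn_symm hvar.symm _ _ _ _)
  rw [← orientSign_mul hg hhor hι hN hu hq]
  refine Eq.trans ?_ (congrArg (fun z =>
    orientSign ξ ι N ((extChartAt (𝓡 d) c).symm u) (fun i => basisVec c u i) * z) h1)
  subst hq
  rw [vecIn_self]
  rfl

lemma coordTensor_line (s : ℝ) (p : M) :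
    coordTensor (fun q => g q + s • δg q) p
      = tcomps fun y => tensorIn g p y + s • tensorIn δg p y := by
  funext y
  ext i j
  rfl

lemma vecCoord_line (s : ℝ) (x : M) {p : M} (v w : TangentSpace (𝓡 (d + 2)) p) :
    vecCoord x (v + s • w) = vecCoord x v + s • vecCoord x w := by
  simp only [vecCoord]
  rw [map_add, map_smul]
  rfl

lemma coordVector_line (s : ℝ) (p : M) :
    coordVector (fun q => ξ q + s • δξ q) p
      = vcomps fun y => vecIn ξ p y + s • vecIn δξ p y := by
  funext y i
  exact congrArg (fun v : Coord (d + 2) => v i) (vecCoord_line s p _ _)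

/-- The pointwise identity behind the theorem, on the section `H`. -/
theorem komarDensity_sub_thetaDensity (hg : IsLorentzMetric g) (hhor : IsKillingHorizon g ξ 𝓗)
    (hvar : IsStationaryVariation g ξ 𝓗 δg δξ) (hκ : IsSurfaceGravity g ξ 𝓗 κ)
    (hδκ : IsSurfaceGravityVariation g ξ 𝓗 δg δξ κ δκ)
    (hι : IsSpacelikeSection g 𝓗 ι) (hN : IsTransverseNull g ξ ι N) {c : H} {u : Coord d}
    (hu : u ∈ (extChartAt (𝓡 d) c).target) :
    komarDensity GN g ξ ι N δξ ((extChartAt (𝓡 d) c).symm u) (fun i => basisVec c u i)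
      - thetaDensity GN g ξ ι N δg ((extChartAt (𝓡 d) c).symm u) (fun i => basisVec c u i)
      = 1 / (16 * Real.pi * GN) * (-2 * δκ (ι ((extChartAt (𝓡 d) c).symm u))
          + surfaceDiv g ι δξ c u) * Real.sqrt (induced g ι c u).det := by
  rw [komarDensity_eq hg hhor hι hN hu, thetaDensity_eq hg hhor hvar hι hN hu rfl, ← sub_mul,
    ← mul_sub, sub_neg_eq_add]
  congr 2
  have hf := isAdaptedFrame hg hhor hι hN hu rfl
  have hG := isMetricAt hg hhor hι hN ((extChartAt (𝓡 d) c).symm u)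
  have hmem := hι.mem ((extChartAt (𝓡 d) c).symm u)
  simp only [komarScalar, surfaceDiv]
  generalize (extChartAt (𝓡 d) c).symm u = q at *
  set p := ι q with hp
  have ht := mem_extChartAt_target (I := 𝓡 (d + 2)) p
  -- The normality condition is needed at all horizon points of the chart, not only at its centre,
  -- since it is about to be differentiated along the horizon.
  have hnormal : ∀ y ∈ (extChartAt (𝓡 (d + 2)) p).target,
      (extChartAt (𝓡 (d + 2)) p).symm y ∈ 𝓗 → ∃ lam, ∀ w, tensorIn δg p y (vecIn ξ p y) w
        + tensorIn g p y (vecIn δξ p y) w = lam * tensorIn g p y (vecIn ξ p y) w := by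
    intro y hy hyH
    obtain ⟨lam, hlam⟩ := hvar.normal _ hyH
    refine ⟨lam, fun w => ?_⟩
    rw [tensorIn_vecIn _ _ hy, tensorIn_vecIn _ _ hy, tensorIn_vecIn _ _ hy]
    exact hlam _
  have hmem' : (extChartAt (𝓡 (d + 2)) p).symm (extChartAt (𝓡 (d + 2)) p p) ∈ 𝓗 := by
    rw [extChartAt_to_inv]
    exact hmem
  obtain ⟨lam, hb⟩ := hnormal _ ht hmem'
  refine komar_add_thetaContr hG hf (tensorIn_differentiableAt hvar.smooth_metric ht)
    (fun y v w => tensorIn_symm hvar.symm _ _ _ _) (vecIn_differentiableAt hhor.smooth ht)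
    (vecIn_differentiableAt hvar.smooth_vector ht) (hhor.killing p) (hvar.stationary p)
    (κ := κ p) (fun i => ?_) (fun i => ?_) hb ?_
  · rw [vecIn_self]
    exact hκ p hmem i
  · have h1 := hδκ p hmem i
    refine h1.congr_of_eventuallyEq (Filter.Eventually.of_forall fun s => ?_)
    beta_reduce
    rw [vecIn_self, vecIn_self, ← vecCoord_line, ← coordTensor_line, ← coordVector_line]
    rfl
  · intro w z v hv
    have c1 := (contDiffOn_tensorIn hvar.smooth_metric p).contDiffAt (target_mem_nhds ht)
    have c2 := (contDiffOn_tensorIn hg.smooth p).contDiffAt (target_mem_nhds ht)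
    have c3 := (contDiffOn_vecIn hhor.smooth p).contDiffAt (target_mem_nhds ht)
    have c4 := (contDiffOn_vecIn hvar.smooth_vector p).contDiffAt (target_mem_nhds ht)
    have b : ∀ w, ContDiffAt ℝ ∞ (fun y => tensorIn δg p y (vecIn ξ p y) w
        + tensorIn g p y (vecIn δξ p y) w) (extChartAt (𝓡 (d + 2)) p p) := fun w =>
      ((c1.clm_apply c3).clm_apply contDiffAt_const).add
        ((c2.clm_apply c4).clm_apply contDiffAt_const)
    have x : ∀ w, ContDiffAt ℝ ∞ (fun y => tensorIn g p y (vecIn ξ p y) w)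
        (extChartAt (𝓡 (d + 2)) p p) := fun w => (c2.clm_apply c3).clm_apply contDiffAt_const
    -- The antisymmetrized product of `δ(ξ_μ)` and `ξ_μ` vanishes on the horizon whatever the
    -- multipliers are there. Its differential is therefore a multiple of `ξ_μ`, and is zero on
    -- vectors orthogonal to `ξ`.
    obtain ⟨μ, hμ⟩ := hhor.exists_fderiv_eq ht hmem'
      (((b w).mul (x z)).sub ((b z).mul (x w))) fun y hy hyH => by
        obtain ⟨lam', h1⟩ := hnormal y hy hyH
        rw [h1, h1]
        ring
    exact (hμ v).trans (by rw [hv, mul_zero])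

end Section

/-! ### Derivatives of determinants and inverse matrices. -/

section MatrixCalculus

variable {E : Type*} [NormedAddCommGroup E] [NormedSpace ℝ E] {d : ℕ}

lemma contDiffAt_det {γ : E → Matrix (Fin d) (Fin d) ℝ} {u : E} {m : WithTop ℕ∞}
    (hγ : ∀ i j, ContDiffAt ℝ m (fun y => γ y i j) u) :
    ContDiffAt ℝ m (fun y => (γ y).det) u := by
  simp only [Matrix.det_apply']
  exact ContDiffAt.sum fun σ _ => contDiffAt_const.mul (contDiffAt_prod fun i _ => hγ _ _)

/-- By Cramer's rule an entry of the inverse is a quotient of determinants, hence a smooth function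
of the entries. -/
lemma contDiffAt_inv_apply {γ : E → Matrix (Fin d) (Fin d) ℝ} {u : E} {m : WithTop ℕ∞}
    (hγ : ∀ i j, ContDiffAt ℝ m (fun y => γ y i j) u) (hdet : (γ u).det ≠ 0) (i j : Fin d) :
    ContDiffAt ℝ m (fun y => (γ y)⁻¹ i j) u := by
  have h : (fun y => (γ y)⁻¹ i j)
      = fun y => ((γ y).det)⁻¹ * ((γ y).updateRow j (Pi.single i 1)).det := by
    funext y
    rw [Matrix.inv_def, Matrix.smul_apply, Ring.inverse_eq_inv', Matrix.adjugate_apply, smul_eq_mul]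
  rw [h]
  refine ((contDiffAt_det hγ).inv hdet).mul (contDiffAt_det fun k l => ?_)
  simp only [Matrix.updateRow_apply]
  split_ifs
  · exact contDiffAt_const
  · exact hγ k l

/-- Jacobi's formula for the derivative of a determinant. -/
lemma fderiv_det {γ : E → Matrix (Fin d) (Fin d) ℝ} {u : E}
    (hγ : ∀ i j, DifferentiableAt ℝ (fun y => γ y i j) u) (hdet : (γ u).det ≠ 0) (v : E) :
    fderiv ℝ (fun y => (γ y).det) u v
      = (γ u).det * ∑ i, ∑ j, (γ u)⁻¹ i j * fderiv ℝ (fun y => γ y j i) u v := by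
  let D : ContinuousMultilinearMap ℝ (fun _ : Fin d => Fin d → ℝ) ℝ :=
    ⟨(Matrix.detRowAlternating (R := ℝ) (n := Fin d)).toMultilinearMap,
      Continuous.matrix_det (continuous_id (X := Matrix (Fin d) (Fin d) ℝ))⟩
  let c : E → Fin d → Fin d → ℝ := fun y => γ y
  have hc : HasFDerivAt c (ContinuousLinearMap.pi fun i => ContinuousLinearMap.pi fun j =>
      fderiv ℝ (fun y => γ y i j) u) u :=
    hasFDerivAt_pi.2 fun i => hasFDerivAt_pi.2 fun j => (hγ i j).hasFDerivAt
  have h := (D.hasFDerivAt (c u)).comp u hc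
  have h' : HasFDerivAt (fun y => (γ y).det) _ u := h
  rw [h'.fderiv, ContinuousLinearMap.comp_apply, ContinuousMultilinearMap.linearDeriv_apply]
  -- The derivative of the multilinear determinant replaces one row at a time; Cramer's rule writes
  -- each result with the inverse matrix.
  have hrow : ∀ (i : Fin d) (b : Fin d → ℝ), D (Function.update (c u) i b)
      = (γ u).det * ∑ j, (γ u)⁻¹ j i * b j := fun i b => by
    have h1 : D (Function.update (c u) i b) = ((γ u).updateRow i b).det := rfl
    have h2 := Matrix.cramer_transpose_apply (γ u) b i
    rw [h1, ← h2, Matrix.cramer_eq_adjugate_mulVec, ← Matrix.adjugate_transpose]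
    have h3 : (γ u).adjugate = (γ u).det • (γ u)⁻¹ := by
      rw [Matrix.inv_def, smul_smul, Ring.inverse_eq_inv', mul_inv_cancel₀ hdet, one_smul]
    rw [h3]
    simp [Matrix.mulVec, dotProduct, Finset.mul_sum, mul_assoc]
  simp only [hrow]
  rw [← Finset.mul_sum, Finset.sum_comm]
  rfl

lemma fderiv_sqrt_det {γ : E → Matrix (Fin d) (Fin d) ℝ} {u : E}
    (hγ : ∀ i j, DifferentiableAt ℝ (fun y => γ y i j) u) (hdet : 0 < (γ u).det)
    (hd : DifferentiableAt ℝ (fun y => (γ y).det) u) (v : E) :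
    fderiv ℝ (fun y => Real.sqrt (γ y).det) u v
      = Real.sqrt (γ u).det
        * ((1 / 2) * ∑ i, ∑ j, (γ u)⁻¹ i j * fderiv ℝ (fun y => γ y j i) u v) := by
  rw [(hd.hasFDerivAt.sqrt hdet.ne').fderiv, _root_.smul_apply, fderiv_det hγ hdet.ne', smul_eq_mul]
  have h := Real.mul_self_sqrt hdet.le
  have h0 := (Real.sqrt_pos.2 hdet).ne'
  set s := Real.sqrt (γ u).det
  rw [← h]
  field_simp

end MatrixCalculus

/-! ### The trace of a covariant derivative over a surface as an intrinsic divergence. -/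

section Divergence

variable {d : ℕ} {n : ℕ} {G : Coord n → Coord n →L[ℝ] Coord n →L[ℝ] ℝ}
  {a ξ : Coord n → Coord n} {X : Coord d → Coord n} {u : Coord d}

lemma two_le_infty : (2 : WithTop ℕ∞) ≤ ∞ := WithTop.coe_le_coe.2 (le_top : (2 : ℕ∞) ≤ ⊤)

/-- The covariant derivative along the map `X` of a vector field `Y` along `X`. -/
def covAlong (G : Coord n → Coord n →L[ℝ] Coord n →L[ℝ] ℝ) (X Y : Coord d → Coord n)
    (u v : Coord d) : Coord n :=
  fderiv ℝ Y u v + chr G (X u) (fderiv ℝ X u v) (Y u)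

lemma covAlong_comp (hX : DifferentiableAt ℝ X u) (ha : DifferentiableAt ℝ a (X u))
    (v : Coord d) : covAlong G X (fun y => a (X y)) u v = cov G a (X u) (fderiv ℝ X u v) := by
  have h : HasFDerivAt (fun y => a (X y)) _ u := ha.hasFDerivAt.comp u hX.hasFDerivAt
  rw [cov_eq ha, covAlong, h.fderiv]
  rfl

lemma hasFDerivAt_comp_field {F : Type*} [NormedAddCommGroup F] [NormedSpace ℝ F]
    {T : Coord n → F} (hT : DifferentiableAt ℝ T (X u)) (hX : DifferentiableAt ℝ X u) :
    HasFDerivAt (fun y => T (X y)) ((fderiv ℝ T (X u)).comp (fderiv ℝ X u)) u :=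
  hT.hasFDerivAt.comp u hX.hasFDerivAt

lemma IsMetricAt.fderiv_apply_along (hG : IsMetricAt G (X u)) (hX : DifferentiableAt ℝ X u)
    {Y Z : Coord d → Coord n} (hY : DifferentiableAt ℝ Y u) (hZ : DifferentiableAt ℝ Z u)
    (v : Coord d) :
    fderiv ℝ (fun y => G (X y) (Y y) (Z y)) u v
      = G (X u) (covAlong G X Y u v) (Z u) + G (X u) (Y u) (covAlong G X Z u v) := by
  have h1 : HasFDerivAt (fun y => G (X y)) _ u := hasFDerivAt_comp_field (T := G) hG.diff hX
  have h2 := (h1.clm_apply hY.hasFDerivAt).clm_apply hZ.hasFDerivAt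
  rw [h2.fderiv]
  have h3 : ((fderiv ℝ G (X u)).comp (fderiv ℝ X u)) v (Y u) (Z u)
      = fderiv ℝ G (X u) (fderiv ℝ X u v) (Y u) (Z u) := rfl
  have h4 := hG.fderiv_eq (fderiv ℝ X u v) (Y u) (Z u)
  simp only [covAlong, map_add, _root_.add_apply, ContinuousLinearMap.comp_apply,
    ContinuousLinearMap.flip_apply]
  rw [h4]
  ring

/-- Second partial derivatives commute and the connection has no torsion. This is what makes second
fundamental forms symmetric. -/
lemma IsMetricAt.covAlong_symm (hG : IsMetricAt G (X u)) (hX : ContDiffAt ℝ ∞ X u)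
    (v w : Coord d) :
    covAlong G X (fun y => fderiv ℝ X y w) u v = covAlong G X (fun y => fderiv ℝ X y v) u w := by
  have h1 : DifferentiableAt ℝ (fderiv ℝ X) u :=
    (hX.fderiv_right (m := ∞) (by simp)).differentiableAt (by simp)
  have h2 : ∀ v w, fderiv ℝ (fun y => fderiv ℝ X y w) u v = fderiv ℝ (fderiv ℝ X) u v w :=
    fun v w => by
      rw [(h1.hasFDerivAt.clm_apply (hasFDerivAt_const w u)).fderiv]
      simp
  have h3 := (hX.isSymmSndFDerivAt (by simp only [minSmoothness_of_isRCLikeNormedField]; exact two_le_infty)).eq v w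
  rw [covAlong, covAlong, h2, h2, h3, hG.chr_symm]

lemma sum_mul_antisymm {P Q : Fin d → Fin d → ℝ} (hP : ∀ i j, P i j = P j i)
    (hQ : ∀ i j, Q i j = -Q j i) : ∑ i, ∑ j, P i j * Q i j = 0 := by
  have h : ∑ i, ∑ j, P i j * Q i j = -∑ i, ∑ j, P i j * Q i j := by
    conv_lhs => rw [Finset.sum_comm]
    rw [← Finset.sum_neg_distrib]
    refine Finset.sum_congr rfl fun i _ => ?_
    rw [← Finset.sum_neg_distrib]
    exact Finset.sum_congr rfl fun j _ => by rw [hP j i, hQ j i]; ring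
  linarith

/-- The divergence of the projection to a surface of a vector field `a`, where `ξ` is a Killing
field normal to the surface and to `a`. -/
theorem sum_fderiv_sqrt_det {G : Coord (d + 2) → Coord (d + 2) →L[ℝ] Coord (d + 2) →L[ℝ] ℝ}
    {a ξ : Coord (d + 2) → Coord (d + 2)} {X : Coord d → Coord (d + 2)} {N : Coord (d + 2)}
    {γ : Coord d → Matrix (Fin d) (Fin d) ℝ} {b : Fin d → Coord d → ℝ}
    (hG : IsMetricAt G (X u)) (hX : ContDiffAt ℝ ∞ X u)
    (ha : DifferentiableAt ℝ a (X u)) (hξ : DifferentiableAt ℝ ξ (X u))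
    (hf : IsAdaptedFrame (G (X u)) N (ξ (X u))
      (fun i => fderiv ℝ X u (EuclideanSpace.single i 1)) (γ u))
    (hγ : ∀ᶠ y in nhds u, ∀ i j, γ y i j = G (X y) (fderiv ℝ X y (EuclideanSpace.single i 1))
      (fderiv ℝ X y (EuclideanSpace.single j 1)))
    (hξe : ∀ᶠ y in nhds u, ∀ j,
      G (X y) (ξ (X y)) (fderiv ℝ X y (EuclideanSpace.single j 1)) = 0)
    (hA : ∀ v w, G (X u) (cov G ξ (X u) v) w + G (X u) v (cov G ξ (X u) w) = 0)
    (hξa : G (X u) (ξ (X u)) (a (X u)) = 0)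
    (hγd : ∀ i j, DifferentiableAt ℝ (fun y => γ y i j) u)
    (hdd : DifferentiableAt ℝ (fun y => (γ y).det) u)
    (hbd : ∀ i, DifferentiableAt ℝ (b i) u)
    (hb : ∀ᶠ y in nhds u, ∀ j,
      G (X y) (a (X y)) (fderiv ℝ X y (EuclideanSpace.single j 1)) = ∑ k, γ y j k * b k y) :
    ∑ i, fderiv ℝ (fun y => Real.sqrt (γ y).det * b i y) u (EuclideanSpace.single i 1)
      = Real.sqrt (γ u).det * ∑ i, ∑ j, (γ u)⁻¹ i j
        * G (X u) (cov G a (X u) (fderiv ℝ X u (EuclideanSpace.single i 1)))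
          (fderiv ℝ X u (EuclideanSpace.single j 1)) := by
  set s : Fin d → Coord d := fun i => EuclideanSpace.single i 1 with hs
  have hXd : DifferentiableAt ℝ X u := hX.differentiableAt (by simp)
  have hEd : ∀ j, DifferentiableAt ℝ (fun y => fderiv ℝ X y (s j)) u := fun j =>
    (((hX.fderiv_right (m := ∞) (by simp)).differentiableAt (by simp)).clm_apply
      (differentiableAt_const _))
  set E : Fin d → Coord (d + 2) := fun j => fderiv ℝ X u (s j) with hE
  set D : Fin d → Fin d → Coord (d + 2) := fun i j =>
    covAlong G X (fun y => fderiv ℝ X y (s j)) u (s i) with hD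
  have hDs : ∀ i j, D i j = D j i := fun i j => hG.covAlong_symm hX _ _
  have hcomp : ∀ c : Coord (d + 2) → Coord (d + 2), DifferentiableAt ℝ c (X u) → ∀ i j,
      fderiv ℝ (fun y => G (X y) (c (X y)) (fderiv ℝ X y (s j))) u (s i)
        = G (X u) (cov G c (X u) (E i)) (E j) + G (X u) (c (X u)) (D i j) := fun c hc i j => by
    rw [hG.fderiv_apply_along hXd (Y := fun y => c (X y)) (hc.comp u hXd) (hEd j),
      covAlong_comp hXd hc]
  have h1 : ∀ i j, G (X u) (cov G a (X u) (E i)) (E j) + G (X u) (a (X u)) (D i j)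
      = ∑ k, (fderiv ℝ (fun y => γ y j k) u (s i) * b k u
        + γ u j k * fderiv ℝ (b k) u (s i)) := fun i j => by
    rw [← hcomp a ha]
    have e : (fun y => G (X y) (a (X y)) (fderiv ℝ X y (s j)))
        =ᶠ[nhds u] fun y => ∑ k, γ y j k * b k y := hb.mono fun y hy => hy j
    have e2 : HasFDerivAt (fun y => ∑ k, γ y j k * b k y) _ u :=
      HasFDerivAt.fun_sum fun k _ => (hγd j k).hasFDerivAt.mul (hbd k).hasFDerivAt
    rw [e.fderiv_eq, e2.fderiv, _root_.sum_apply]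
    refine Finset.sum_congr rfl fun k _ => ?_
    rw [_root_.add_apply, _root_.smul_apply, _root_.smul_apply, smul_eq_mul, smul_eq_mul]
    ring
  have h2 : ∀ k i j, fderiv ℝ (fun y => γ y i j) u (s k)
      = G (X u) (D k i) (E j) + G (X u) (E i) (D k j) := fun k i j => by
    have e : (fun y => γ y i j) =ᶠ[nhds u]
        fun y => G (X y) (fderiv ℝ X y (s i)) (fderiv ℝ X y (s j)) := hγ.mono fun y hy => hy i j
    rw [e.fderiv_eq, hG.fderiv_apply_along hXd (hEd i) (hEd j)]
  have h3 : ∀ i j, G (X u) (cov G ξ (X u) (E i)) (E j) + G (X u) (ξ (X u)) (D i j) = 0 :=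
    fun i j => by
    rw [← hcomp ξ hξ]
    have e : (fun y => G (X y) (ξ (X y)) (fderiv ℝ X y (s j))) =ᶠ[nhds u] fun _ => (0 : ℝ) :=
      hξe.mono fun y hy => hy j
    rw [e.fderiv_eq]
    simp
  have hunit : IsUnit (γ u).det := isUnit_iff_ne_zero.2 hf.posDet.ne'
  have hinv : ∀ (i : Fin d) (x : Fin d → ℝ),
      ∑ j, (γ u)⁻¹ i j * ∑ k, γ u j k * x k = x i := fun i x => by
    have e : (γ u)⁻¹.mulVec ((γ u).mulVec x) = x := by
      rw [Matrix.mulVec_mulVec, Matrix.nonsing_inv_mul _ hunit, Matrix.one_mulVec]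
    exact congrFun e i
  have hγs : ∀ i j, γ u i j = γ u j i := fun i j => by
    rw [hγ.self_of_nhds, hγ.self_of_nhds, hG.symm]
  have hPs : ∀ i j, (γ u)⁻¹ i j = (γ u)⁻¹ j i := fun i j => by
    have e : (γ u).transpose = γ u := by ext i j; exact hγs j i
    have e2 : (γ u)⁻¹.transpose = (γ u)⁻¹ := by rw [Matrix.transpose_nonsing_inv, e]
    exact congrFun (congrFun e2 j) i
  -- The component of `a` along `N` is `-g(ξ, a) = 0`, so only `ξ` and the tangent vectors remain,
  -- the latter with coefficients `b`.
  have h4 : ∀ z, G (X u) (a (X u)) z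
      = -(G (X u) N (a (X u))) * G (X u) (ξ (X u)) z + ∑ k, b k u * G (X u) (E k) z := fun z => by
    have e := hf.expand (a (X u))
    have e2 : ∀ i, ∑ j, (γ u)⁻¹ i j * G (X u) (E j) (a (X u)) = b i u := fun i => by
      rw [← hinv i fun k => b k u]
      refine Finset.sum_congr rfl fun j _ => ?_
      rw [hG.symm, hb.self_of_nhds]
    simp only [e2, hξa, zero_smul, sub_zero] at e
    have e3 := congrArg (fun x => G (X u) x z) e
    refine e3.trans ?_
    simp only [map_add, map_sum, map_smul, _root_.add_apply, _root_.sum_apply, _root_.smul_apply,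
      smul_eq_mul]
  -- The tangential part of `D i j` is the Levi-Civita connection of the induced metric: these are
  -- its Christoffel symbols of the first kind.
  have h5 : ∀ i j k, G (X u) (E k) (D i j) = (1 / 2) * (fderiv ℝ (fun y => γ y j k) u (s i)
      + fderiv ℝ (fun y => γ y i k) u (s j) - fderiv ℝ (fun y => γ y i j) u (s k)) :=
    fun i j k => by
    rw [h2, h2, h2, hDs j i, hDs k i, hDs k j, hG.symm _ (E k) (D i j), hG.symm _ (E j) (D i k)]
    ring
  have h6 : ∑ i, ∑ j, (γ u)⁻¹ i j * G (X u) (cov G a (X u) (E i)) (E j)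
      = ∑ i, fderiv ℝ (b i) u (s i)
        + ∑ k, b k u * ((1 / 2) * ∑ i, ∑ j, (γ u)⁻¹ i j * fderiv ℝ (fun y => γ y j i) u (s k)) := by
    -- By `h3` this is minus `g(A e_i, e_j)`. It is symmetric in `i, j` since `D` is, and
    -- antisymmetric by the Killing equation.
    have hξD : ∀ i j, G (X u) (ξ (X u)) (D i j) = 0 := fun i j => by
      have e1 := h3 i j
      have e2 := h3 j i
      have e3 := hA (E i) (E j)
      rw [hG.symm _ (E i)] at e3
      rw [hDs j i] at e2
      linarith
    -- After subtracting the terms that make up the divergence, what is left of `g(D_i a, e_j)` is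
    -- antisymmetric in `i, j`, so the inverse metric kills it.
    have h7 := sum_mul_antisymm hPs (Q := fun i j => G (X u) (cov G a (X u) (E i)) (E j)
      - ∑ k, γ u j k * fderiv ℝ (b k) u (s i)
      - ∑ k, b k u * ((1 / 2) * fderiv ℝ (fun y => γ y j i) u (s k))) fun i j => by
        have e : ∀ i j, G (X u) (cov G a (X u) (E i)) (E j)
            - ∑ k, γ u j k * fderiv ℝ (b k) u (s i)
            - ∑ k, b k u * ((1 / 2) * fderiv ℝ (fun y => γ y j i) u (s k))
            = ∑ k, b k u * ((1 / 2) * (fderiv ℝ (fun y => γ y j k) u (s i)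
              - fderiv ℝ (fun y => γ y i k) u (s j))) := fun i j => by
          have e1 := h1 i j
          rw [h4, hξD, Finset.sum_add_distrib] at e1
          have e2 : ∑ k, b k u * G (X u) (E k) (D i j)
              = ∑ k, fderiv ℝ (fun y => γ y j k) u (s i) * b k u
                - ∑ k, b k u * ((1 / 2) * fderiv ℝ (fun y => γ y j i) u (s k))
                - ∑ k, b k u * ((1 / 2) * (fderiv ℝ (fun y => γ y j k) u (s i)
                  - fderiv ℝ (fun y => γ y i k) u (s j))) := by
            rw [← Finset.sum_sub_distrib, ← Finset.sum_sub_distrib]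
            refine Finset.sum_congr rfl fun k _ => ?_
            rw [h5, h2 k i j, h2 k j i, hG.symm _ (D k j), hG.symm _ (E j)]
            ring
          linarith
        rw [e, e, ← Finset.sum_neg_distrib]
        exact Finset.sum_congr rfl fun k _ => by ring
    simp only [mul_sub, Finset.sum_sub_distrib] at h7
    have h8 : ∑ i, ∑ j, (γ u)⁻¹ i j * ∑ k, γ u j k * fderiv ℝ (b k) u (s i)
        = ∑ i, fderiv ℝ (b i) u (s i) := Finset.sum_congr rfl fun i _ => hinv i _
    have h9 : ∑ i, ∑ j, (γ u)⁻¹ i j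
          * ∑ k, b k u * ((1 / 2) * fderiv ℝ (fun y => γ y j i) u (s k))
        = ∑ k, b k u
          * ((1 / 2) * ∑ i, ∑ j, (γ u)⁻¹ i j * fderiv ℝ (fun y => γ y j i) u (s k)) := by
      simp only [Finset.mul_sum]
      rw [sum_perm₃]
      refine Finset.sum_congr rfl fun k _ => Finset.sum_congr rfl fun i _ =>
        Finset.sum_congr rfl fun j _ => by ring
    linarith
  rw [h6, mul_add, Finset.mul_sum, Finset.mul_sum, ← Finset.sum_add_distrib]
  refine Finset.sum_congr rfl fun i _ => ?_
  have e : HasFDerivAt (fun y => Real.sqrt (γ y).det * b i y) _ u :=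
    (hdd.sqrt hf.posDet.ne').hasFDerivAt.mul (hbd i).hasFDerivAt
  rw [e.fderiv, _root_.add_apply, _root_.smul_apply, _root_.smul_apply, smul_eq_mul, smul_eq_mul,
    fderiv_sqrt_det hγd hf.posDet hdd]
  ring

end Divergence

/-! ### The tangential part of the variation of the generator. -/

section SectionCalculus

variable {d : ℕ} {M : Type*} [TopologicalSpace M] [ChartedSpace (Coord (d + 2)) M]
  [IsManifold (𝓡 (d + 2)) ∞ M]
  {H : Type*} [TopologicalSpace H] [ChartedSpace (Coord d) H] [IsManifold (𝓡 d) ∞ H]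
  {g δg : TField (d + 2) M} {ξ δξ X : VField (d + 2) M} {𝓗 : Set M} {ι : H → M}
  {N : (q : H) → TangentSpace (𝓡 (d + 2)) (ι q)} {c : H} {u : Coord d}

/-- The components of the one-form `g(X, ·)` pulled back to `H`. -/
def pairing (g : TField (d + 2) M) (ι : H → M) (X : VField (d + 2) M) (c : H) (u : Coord d)
    (j : Fin d) : ℝ :=
  g (ι ((extChartAt (𝓡 d) c).symm u)) (X (ι ((extChartAt (𝓡 d) c).symm u)))
    (push ι ((extChartAt (𝓡 d) c).symm u) (basisVec c u j))

/-- The components of the projection of `X` to the tangent spaces of `H`. -/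
def tangentPart (g : TField (d + 2) M) (ι : H → M) (X : VField (d + 2) M) (c : H) (u : Coord d)
    (i : Fin d) : ℝ :=
  ∑ j, (induced g ι c u)⁻¹ i j * pairing g ι X c u j

lemma induced_eq_mapIn (hι : ContMDiff (𝓡 d) (𝓡 (d + 2)) ∞ ι) {x : M}
    (hu : u ∈ (extChartAt (𝓡 d) c).target)
    (hx : ι ((extChartAt (𝓡 d) c).symm u) ∈ (chartAt (Coord (d + 2)) x).source) (i j : Fin d) :
    induced g ι c u i j = tensorIn g x (mapIn ι c x u)
      (fderiv ℝ (mapIn ι c x) u (EuclideanSpace.single i 1))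
      (fderiv ℝ (mapIn ι c x) u (EuclideanSpace.single j 1)) :=
  (tensorIn_mapIn hι g hu hx _ _).symm

lemma pairing_eq_mapIn (hι : ContMDiff (𝓡 d) (𝓡 (d + 2)) ∞ ι) {x : M}
    (hu : u ∈ (extChartAt (𝓡 d) c).target)
    (hx : ι ((extChartAt (𝓡 d) c).symm u) ∈ (chartAt (Coord (d + 2)) x).source) (j : Fin d) :
    pairing g ι X c u j = tensorIn g x (mapIn ι c x u) (vecIn X x (mapIn ι c x u))
      (fderiv ℝ (mapIn ι c x) u (EuclideanSpace.single j 1)) :=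
  (tensorIn_vecIn_mapIn hι g X hu hx _).symm

lemma mapIn_mem_target {x : M}
    (hx : ι ((extChartAt (𝓡 d) c).symm u) ∈ (chartAt (Coord (d + 2)) x).source) :
    mapIn ι c x u ∈ (extChartAt (𝓡 (d + 2)) x).target :=
  (extChartAt (𝓡 (d + 2)) x).map_source (by rwa [extChartAt_source])

lemma contDiffAt_tensorIn_mapIn (hι : ContMDiff (𝓡 d) (𝓡 (d + 2)) ∞ ι) {T : TField (d + 2) M}
    (hT : SmoothTensor T) {x : M} (hu : u ∈ (extChartAt (𝓡 d) c).target)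
    (hx : ι ((extChartAt (𝓡 d) c).symm u) ∈ (chartAt (Coord (d + 2)) x).source) :
    ContDiffAt ℝ ∞ (fun y => tensorIn T x (mapIn ι c x y)) u :=
  ((contDiffOn_tensorIn hT x).contDiffAt (target_mem_nhds (mapIn_mem_target hx))).comp u
    (contDiffAt_mapIn hι hu hx)

lemma contDiffAt_vecIn_mapIn (hι : ContMDiff (𝓡 d) (𝓡 (d + 2)) ∞ ι)
    (hX : SmoothVector X) {x : M} (hu : u ∈ (extChartAt (𝓡 d) c).target)
    (hx : ι ((extChartAt (𝓡 d) c).symm u) ∈ (chartAt (Coord (d + 2)) x).source) :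
    ContDiffAt ℝ ∞ (fun y => vecIn X x (mapIn ι c x y)) u :=
  ((contDiffOn_vecIn hX x).contDiffAt (target_mem_nhds (mapIn_mem_target hx))).comp u
    (contDiffAt_mapIn hι hu hx)

lemma contDiffAt_fderiv_mapIn (hι : ContMDiff (𝓡 d) (𝓡 (d + 2)) ∞ ι) {x : M}
    (hu : u ∈ (extChartAt (𝓡 d) c).target)
    (hx : ι ((extChartAt (𝓡 d) c).symm u) ∈ (chartAt (Coord (d + 2)) x).source) (v : Coord d) :
    ContDiffAt ℝ ∞ (fun y => fderiv ℝ (mapIn ι c x) y v) u :=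
  ((contDiffAt_mapIn hι hu hx).fderiv_right (m := ∞) (by simp)).clm_apply contDiffAt_const

lemma contDiffAt_induced (hι : ContMDiff (𝓡 d) (𝓡 (d + 2)) ∞ ι) (hg : SmoothTensor g)
    (hu : u ∈ (extChartAt (𝓡 d) c).target) (i j : Fin d) :
    ContDiffAt ℝ ∞ (fun y => induced g ι c y i j) u := by
  have hx := mem_chart_source (Coord (d + 2)) (ι ((extChartAt (𝓡 d) c).symm u))
  refine ContDiffAt.congr_of_eventuallyEq ?_ ((eventually_mapIn hι hu hx).mono fun y hy =>
    induced_eq_mapIn hι hy.1 hy.2 i j)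
  exact ((contDiffAt_tensorIn_mapIn hι hg hu hx).clm_apply
    (contDiffAt_fderiv_mapIn hι hu hx _)).clm_apply (contDiffAt_fderiv_mapIn hι hu hx _)

lemma contDiffAt_pairing (hι : ContMDiff (𝓡 d) (𝓡 (d + 2)) ∞ ι) (hg : SmoothTensor g)
    (hX : SmoothVector X) (hu : u ∈ (extChartAt (𝓡 d) c).target) (j : Fin d) :
    ContDiffAt ℝ ∞ (fun y => pairing g ι X c y j) u := by
  have hx := mem_chart_source (Coord (d + 2)) (ι ((extChartAt (𝓡 d) c).symm u))
  refine ContDiffAt.congr_of_eventuallyEq ?_ ((eventually_mapIn hι hu hx).mono fun y hy =>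
    pairing_eq_mapIn hι hy.1 hy.2 j)
  exact ((contDiffAt_tensorIn_mapIn hι hg hu hx).clm_apply
    (contDiffAt_vecIn_mapIn hι hX hu hx)).clm_apply (contDiffAt_fderiv_mapIn hι hu hx _)

lemma contDiffAt_tangentPart (hg : IsLorentzMetric g) (hι : IsSpacelikeSection g 𝓗 ι)
    (hX : SmoothVector X) (hu : u ∈ (extChartAt (𝓡 d) c).target) (i : Fin d) :
    ContDiffAt ℝ ∞ (fun y => tangentPart g ι X c y i) u :=
  ContDiffAt.sum fun j _ => (contDiffAt_inv_apply (fun i j =>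
    contDiffAt_induced hι.smooth hg.smooth hu i j) (posDef_induced hg.symm hι hu).det_pos.ne' i
      j).mul (contDiffAt_pairing hι.smooth hg.smooth hX hu j)

lemma contDiffAt_sqrt_det_induced (hg : IsLorentzMetric g) (hι : IsSpacelikeSection g 𝓗 ι)
    (hu : u ∈ (extChartAt (𝓡 d) c).target) :
    ContDiffAt ℝ ∞ (fun y => Real.sqrt (induced g ι c y).det) u :=
  (contDiffAt_det fun i j => contDiffAt_induced hι.smooth hg.smooth hu i j).sqrt
    (posDef_induced hg.symm hι hu).det_pos.ne'

lemma pairing_eq_sum (hg : SymmTensor g) (hι : IsSpacelikeSection g 𝓗 ι)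
    (hu : u ∈ (extChartAt (𝓡 d) c).target) (j : Fin d) :
    pairing g ι X c u j = ∑ k, induced g ι c u j k * tangentPart g ι X c u k := by
  have e : (induced g ι c u).mulVec ((induced g ι c u)⁻¹.mulVec (pairing g ι X c u))
      = pairing g ι X c u := by
    rw [Matrix.mulVec_mulVec, Matrix.mul_nonsing_inv _
      (isUnit_iff_ne_zero.2 (posDef_induced hg hι hu).det_pos.ne'), Matrix.one_mulVec]
  exact (congrFun e j).symm

lemma IsKillingHorizon.cov_antisymm (hhor : IsKillingHorizon g ξ 𝓗)
    {p : M} (hG : IsMetricAt (tensorIn g p) (extChartAt (𝓡 (d + 2)) p p))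
    (v w : Coord (d + 2)) :
    let u := extChartAt (𝓡 (d + 2)) p p
    tensorIn g p u (cov (tensorIn g p) (vecIn ξ p) u v) w
      + tensorIn g p u v (cov (tensorIn g p) (vecIn ξ p) u w) = 0 := by
  have ht := mem_extChartAt_target (I := 𝓡 (d + 2)) p
  have hξd := vecIn_differentiableAt hhor.smooth ht
  intro u
  rw [← hG.lieForm_self hξd, clm_apply_eq_sum]
  refine Finset.sum_eq_zero fun i _ => Finset.sum_eq_zero fun j _ => ?_
  rw [← lieDeriv_eq hG.diff hξd]
  exact mul_eq_zero_of_right _ (hhor.killing p i j)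

/-- Normality evaluated on the null vector `ξ` gives `δg(ξ, ξ) + g(δξ, ξ) = 0`, whereas nullness
gives the same with coefficient `2` on the second term; subtract. -/
lemma IsStationaryVariation.orthogonal (hhor : IsKillingHorizon g ξ 𝓗)
    (hvar : IsStationaryVariation g ξ 𝓗 δg δξ) {p : M} (hp : p ∈ 𝓗) :
    g p (δξ p) (ξ p) = 0 := by
  obtain ⟨lam, h⟩ := hvar.normal p hp
  have h1 := h (ξ p)
  rw [hhor.null p hp] at h1
  linarith [hvar.null p hp]

/-- On a section of the horizon, the trace of the covariant derivative of `δξ` is the divergence of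
the projection of `δξ`. -/
theorem sum_fderiv_tangentPart (hg : IsLorentzMetric g) (hhor : IsKillingHorizon g ξ 𝓗)
    (hvar : IsStationaryVariation g ξ 𝓗 δg δξ) (hι : IsSpacelikeSection g 𝓗 ι)
    (hN : IsTransverseNull g ξ ι N) (hu : u ∈ (extChartAt (𝓡 d) c).target) :
    ∑ i, fderiv ℝ (fun y => Real.sqrt (induced g ι c y).det * tangentPart g ι δξ c y i) u
        (EuclideanSpace.single i 1)
      = Real.sqrt (induced g ι c u).det * surfaceDiv g ι δξ c u := by
  -- One ambient chart, centred at the image of `u`, is kept fixed while differentiating. The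
  -- relations that get differentiated hold in it near `u`; the Killing equation is needed only at
  -- its centre.
  set p := ι ((extChartAt (𝓡 d) c).symm u) with hp
  have hx : ι ((extChartAt (𝓡 d) c).symm u) ∈ (chartAt (Coord (d + 2)) p).source :=
    mem_chart_source _ _
  have ht := mem_extChartAt_target (I := 𝓡 (d + 2)) p
  have hG : IsMetricAt (tensorIn g p) (mapIn ι c p u) := isMetricAt hg hhor hι hN _
  have hev := eventually_mapIn hι.smooth hu hx
  have hE : ∀ i, fderiv ℝ (mapIn ι c p) u (EuclideanSpace.single i 1) = pushFrame ι c u i :=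
    fun i => fderiv_mapIn hι.smooth hu hx _
  have hf : IsAdaptedFrame (tensorIn g p (mapIn ι c p u)) (vecCoord p (N ((extChartAt (𝓡 d) c).symm u)))
      (vecIn ξ p (mapIn ι c p u))
      (fun i => fderiv ℝ (mapIn ι c p) u (EuclideanSpace.single i 1)) (induced g ι c u) := by
    simp only [hE]
    exact isAdaptedFrame hg hhor hι hN hu rfl
  have hγ := contDiffAt_induced hι.smooth hg.smooth hu
  have h := sum_fderiv_sqrt_det (γ := induced g ι c) (b := fun i y => tangentPart g ι δξ c y i)
    hG (contDiffAt_mapIn hι.smooth hu hx)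
    (vecIn_differentiableAt hvar.smooth_vector ht) (vecIn_differentiableAt hhor.smooth ht) hf
    (hev.mono fun y hy i j => induced_eq_mapIn hι.smooth hy.1 hy.2 i j)
    (hev.mono fun y hy j => (tensorIn_vecIn_mapIn hι.smooth g ξ hy.1 hy.2 _).trans
      (hhor.orthogonal_push hι _ _))
    (hhor.cov_antisymm hG) ?_ (fun i j => (hγ i j).differentiableAt (by simp))
    ((contDiffAt_det hγ).differentiableAt (by simp))
    (fun i => (contDiffAt_tangentPart hg hι hvar.smooth_vector hu i).differentiableAt (by simp))
    (hev.mono fun y hy j => (pairing_eq_mapIn hι.smooth hy.1 hy.2 j).symm.trans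
      (pairing_eq_sum hg.symm hι hy.1 j))
  · rw [h]
    simp only [hE]
    rfl
  · have h1 := tensorIn_vecIn_vecIn g ξ δξ (x := p) (u := mapIn ι c p u) ht
    rw [h1, hg.symm]
    refine hvar.orthogonal hhor ?_
    have h2 : (extChartAt (𝓡 (d + 2)) p).symm (mapIn ι c p u) = p := extChartAt_to_inv p
    rw [h2]
    exact hι.mem _

end SectionCalculus

/-! ### Chart independence of area integrals and of the tangential vector field. -/

section ChangeOfChart

variable {d : ℕ} {M : Type*} [TopologicalSpace M] [ChartedSpace (Coord (d + 2)) M]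
  [IsManifold (𝓡 (d + 2)) ∞ M]
  {H : Type*} [TopologicalSpace H] [ChartedSpace (Coord d) H] [IsManifold (𝓡 d) ∞ H]
  {g : TField (d + 2) M} {X : VField (d + 2) M} {𝓗 : Set M} {ι : H → M}
  {c c' : H} {u : Coord d}

lemma clm_det_eq (L : Coord d →L[ℝ] Coord d) :
    L.det = (Matrix.of fun i j => L (EuclideanSpace.single j 1) i).det := by
  rw [ContinuousLinearMap.det, ← LinearMap.det_toMatrix (EuclideanSpace.basisFun (Fin d) ℝ).toBasis]
  rfl

lemma det_comps_bilinearComp (B : Coord d →L[ℝ] Coord d →L[ℝ] ℝ) (L : Coord d →L[ℝ] Coord d) :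
    (comps (B.bilinearComp L L)).det = L.det ^ 2 * (comps B).det := by
  set A : Matrix (Fin d) (Fin d) ℝ := Matrix.of fun i j => L (EuclideanSpace.single j 1) i with hA
  have h : comps (B.bilinearComp L L) = A.transpose * comps B * A := by
    ext i j
    have h1 : comps (B.bilinearComp L L) i j
        = B (L (EuclideanSpace.single i 1)) (L (EuclideanSpace.single j 1)) := rfl
    rw [h1, clm_apply_eq_sum, Matrix.mul_apply, Finset.sum_comm]
    refine Finset.sum_congr rfl fun k _ => ?_
    rw [Matrix.mul_apply, Finset.sum_mul]
    refine Finset.sum_congr rfl fun l _ => ?_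
    simp only [Matrix.transpose_apply, hA, Matrix.of_apply, comps]
    ring
  rw [h, Matrix.det_mul, Matrix.det_mul, Matrix.det_transpose, clm_det_eq]
  ring

/-- The induced metric, as a field of bilinear forms on `H`. -/
def inducedField (g : TField (d + 2) M) (ι : H → M) : TField d H := fun q =>
  ((g.form (ι q)).bilinearComp (mfderiv (𝓡 d) (𝓡 (d + 2)) ι q : Coord d →L[ℝ] Coord (d + 2))
    (mfderiv (𝓡 d) (𝓡 (d + 2)) ι q : Coord d →L[ℝ] Coord (d + 2)) :
    Coord d →L[ℝ] Coord d →L[ℝ] ℝ)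

lemma induced_eq_comps : induced g ι c u = comps (tensorIn (inducedField g ι) c u) := rfl

/-- The induced metric pulls back under the change of chart, so its determinant picks up the square
of the Jacobian. -/
lemma sqrt_det_chartChange (hu : u ∈ (extChartAt (𝓡 d) c).target)
    (hc' : (extChartAt (𝓡 d) c).symm u ∈ (chartAt (Coord d) c').source) :
    Real.sqrt (induced g ι c u).det
      = |(fderiv ℝ (chartChange c c') u).det|
        * Real.sqrt (induced g ι c' (chartChange c c' u)).det := by
  have h : tensorIn (inducedField g ι) c u
      = (tensorIn (inducedField g ι) c' (chartChange c c' u)).bilinearComp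
        (fderiv ℝ (chartChange c c') u) (fderiv ℝ (chartChange c c') u) := by
    ext v w
    exact (tensorIn_chartChange _ hu hc' v w).symm
  rw [induced_eq_comps, h, det_comps_bilinearComp, Real.sqrt_mul (sq_nonneg _), Real.sqrt_sq_eq_abs,
    ← induced_eq_comps]

/-- The integral of a function with respect to the area does not depend on the chart. -/
lemma integral_area_chart (f : H → ℝ)
    (hf : ∀ q, f q ≠ 0 → q ∈ (chartAt (Coord d) c).source ∧ q ∈ (chartAt (Coord d) c').source) :
    ∫ u in (extChartAt (𝓡 d) c).target,
        f ((extChartAt (𝓡 d) c).symm u) * Real.sqrt (induced g ι c u).det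
      = ∫ u in (extChartAt (𝓡 d) c').target,
        f ((extChartAt (𝓡 d) c').symm u) * Real.sqrt (induced g ι c' u).det := by
  have hopen : ∀ a b : H, IsOpen ((extChartAt (𝓡 d) a).target
      ∩ (extChartAt (𝓡 d) a).symm ⁻¹' (chartAt (Coord d) b).source) := fun a b =>
    (continuousOn_extChartAt_symm a).isOpen_inter_preimage (isOpen_extChartAt_target a)
      (chartAt (Coord d) b).open_source
  set V := (extChartAt (𝓡 d) c).target
    ∩ (extChartAt (𝓡 d) c).symm ⁻¹' (chartAt (Coord d) c').source with hV
  set V' := (extChartAt (𝓡 d) c').target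
    ∩ (extChartAt (𝓡 d) c').symm ⁻¹' (chartAt (Coord d) c).source with hV'
  have hback : ∀ a b : H, ∀ x ∈ (extChartAt (𝓡 d) a).target,
      (extChartAt (𝓡 d) a).symm x ∈ (chartAt (Coord d) b).source →
      chartChange a b x ∈ (extChartAt (𝓡 d) b).target ∧
      (extChartAt (𝓡 d) b).symm (chartChange a b x) = (extChartAt (𝓡 d) a).symm x ∧
      chartChange b a (chartChange a b x) = x := fun a b x hx hb => by
    have hb' : (extChartAt (𝓡 d) a).symm x ∈ (extChartAt (𝓡 d) b).source := by
      rwa [extChartAt_source]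
    have h1 : (extChartAt (𝓡 d) b).symm (chartChange a b x) = (extChartAt (𝓡 d) a).symm x :=
      (extChartAt (𝓡 d) b).left_inv hb'
    refine ⟨(extChartAt (𝓡 d) b).map_source hb', h1, ?_⟩
    rw [chartChange, h1, (extChartAt (𝓡 d) a).right_inv hx]
  have hsrc : ∀ a : H, ∀ x ∈ (extChartAt (𝓡 d) a).target,
      (extChartAt (𝓡 d) a).symm x ∈ (chartAt (Coord d) a).source := fun a x hx => by
    rw [← extChartAt_source (𝓡 d)]
    exact (extChartAt (𝓡 d) a).map_target hx
  have himg : chartChange c c' '' V = V' := by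
    ext x
    constructor
    · rintro ⟨y, ⟨hy, hy'⟩, rfl⟩
      obtain ⟨h1, h2, -⟩ := hback c c' y hy hy'
      refine ⟨h1, ?_⟩
      rw [Set.mem_preimage, h2]
      exact hsrc c y hy
    · rintro ⟨hx, hx'⟩
      obtain ⟨h1, h2, h3⟩ := hback c' c x hx hx'
      refine ⟨_, ⟨h1, ?_⟩, h3⟩
      rw [Set.mem_preimage, h2]
      exact hsrc c' x hx
  have hinj : Set.InjOn (chartChange c c') V := fun x hx y hy hxy => by
    rw [← (hback c c' x hx.1 hx.2).2.2, hxy, (hback c c' y hy.1 hy.2).2.2]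
  have hzero : ∀ a b : H, (∀ q, f q ≠ 0 → q ∈ (chartAt (Coord d) b).source) →
      ∀ x ∈ (extChartAt (𝓡 d) a).target \ ((extChartAt (𝓡 d) a).target
        ∩ (extChartAt (𝓡 d) a).symm ⁻¹' (chartAt (Coord d) b).source),
      f ((extChartAt (𝓡 d) a).symm x) * Real.sqrt (induced g ι a x).det = 0 := by
    intro a b hb x hx
    have : f ((extChartAt (𝓡 d) a).symm x) = 0 := by
      by_contra h
      exact hx.2 ⟨hx.1, hb _ h⟩
    rw [this, zero_mul]
  -- Both integrands vanish off the overlap of the charts; on the overlap this is the change of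
  -- variables formula, with the Jacobian absorbed by `sqrt_det_chartChange`.
  rw [MeasureTheory.setIntegral_eq_of_subset_of_forall_sdiff_eq_zero
      (isOpen_extChartAt_target c).measurableSet Set.inter_subset_left
      (hzero c c' fun q hq => (hf q hq).2),
    MeasureTheory.setIntegral_eq_of_subset_of_forall_sdiff_eq_zero
      (isOpen_extChartAt_target c').measurableSet Set.inter_subset_left
      (hzero c' c fun q hq => (hf q hq).1), ← hV, ← hV', ← himg,
    MeasureTheory.integral_image_eq_integral_abs_det_fderiv_smul _ (hopen c c').measurableSet
      (fun x hx => ((contDiffAt_chartChange hx.1 hx.2).differentiableAt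
        (by simp)).hasFDerivAt.hasFDerivWithinAt) hinj]
  refine MeasureTheory.setIntegral_congr_fun (hopen c c').measurableSet fun x hx => ?_
  simp only [smul_eq_mul]
  rw [(hback c c' x hx.1 hx.2).2.1, sqrt_det_chartChange hx.1 hx.2]
  ring

/-- The projection of `X` to the tangent space of `H`. -/
def tangentVec (g : TField (d + 2) M) (ι : H → M) (X : VField (d + 2) M) (q : H) : Coord d :=
  chartFrame q (extChartAt (𝓡 d) q q)
    (WithLp.toLp 2 (tangentPart g ι X q (extChartAt (𝓡 d) q q)))

/-- The tangential part represents the functional `g(X, ·)` on `TH` with respect to the induced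
metric, a characterization that refers to no chart. -/
lemma inducedField_tangentPart (hg : SymmTensor g) (hι : IsSpacelikeSection g 𝓗 ι)
    (hu : u ∈ (extChartAt (𝓡 d) c).target) {q : H} (hq : (extChartAt (𝓡 d) c).symm u = q)
    (w : TangentSpace (𝓡 d) q) :
    (inducedField g ι).form q (chartFrame c u (WithLp.toLp 2 (tangentPart g ι X c u))) w
      = g (ι q) (X (ι q)) (push ι q w) := by
  subst hq
  have h1 : (g.form (ι ((extChartAt (𝓡 d) c).symm u)) (X (ι ((extChartAt (𝓡 d) c).symm u)))).comp
      (pushIn ι c u) = tensorIn (inducedField g ι) c u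
        (WithLp.toLp 2 (tangentPart g ι X c u)) := by
    ext v
    rw [clm_eq_sum, clm_eq_sum (tensorIn (inducedField g ι) c u _)]
    refine Finset.sum_congr rfl fun j _ => ?_
    rw [tensorIn_symm (T := inducedField g ι) fun p v w => hg _ _ _,
      clm_eq_sum (tensorIn (inducedField g ι) c u _)]
    congr 1
    refine (pairing_eq_sum hg hι hu j).trans (Finset.sum_congr rfl fun k _ => ?_)
    exact mul_comm _ _
  have h2 := DFunLike.congr_fun h1 (vecCoord c w)
  have h3 : chartFrame c u (vecCoord c w) = w := chartFrame_vecCoord hu w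
  rw [ContinuousLinearMap.comp_apply, pushIn_apply, tensorIn_apply, h3] at h2
  exact h2.symm

/-- Two vectors representing the same functional differ by a vector of zero length, and the induced
metric is positive definite. -/
lemma tangentVec_eq (hg : SymmTensor g) (hι : IsSpacelikeSection g 𝓗 ι)
    (hu : u ∈ (extChartAt (𝓡 d) c).target) :
    chartFrame c u (WithLp.toLp 2 (tangentPart g ι X c u))
      = tangentVec g ι X ((extChartAt (𝓡 d) c).symm u) := by
  set q := (extChartAt (𝓡 d) c).symm u with hq
  by_contra h
  have h1 := hι.spacelike q (chartFrame c u (WithLp.toLp 2 (tangentPart g ι X c u))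
      - tangentVec g ι X q) (sub_ne_zero.2 h)
  have h2 := inducedField_tangentPart (X := X) hg hι hu hq.symm
    (chartFrame c u (WithLp.toLp 2 (tangentPart g ι X c u)) - tangentVec g ι X q)
  have h3 := inducedField_tangentPart (X := X) hg hι (mem_extChartAt_target (I := 𝓡 d) q)
    (extChartAt_to_inv q)
    (chartFrame c u (WithLp.toLp 2 (tangentPart g ι X c u)) - tangentVec g ι X q)
  have h4 : (inducedField g ι).form q
      (chartFrame c u (WithLp.toLp 2 (tangentPart g ι X c u)) - tangentVec g ι X q)
      (chartFrame c u (WithLp.toLp 2 (tangentPart g ι X c u)) - tangentVec g ι X q) = 0 := by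
    have h5 := map_sub ((inducedField g ι).form q)
      (chartFrame c u (WithLp.toLp 2 (tangentPart g ι X c u))) (tangentVec g ι X q)
    refine (DFunLike.congr_fun h5 _).trans ?_
    rw [_root_.sub_apply, h2]
    exact sub_eq_zero.2 h3.symm
  exact h1.ne' h4

/-- The derivative of a function on `H` along the projection of `X`. -/
def tangentDeriv (g : TField (d + 2) M) (ι : H → M) (X : VField (d + 2) M) (f : H → ℝ) (q : H) :
    ℝ :=
  (mvfderiv (𝓡 d) f q : Coord d →L[ℝ] ℝ) (tangentVec g ι X q)

lemma tangentDeriv_eq (hg : SymmTensor g) (hι : IsSpacelikeSection g 𝓗 ι) {f : H → ℝ}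
    (hf : MDifferentiable (𝓡 d) 𝓘(ℝ, ℝ) f) (hu : u ∈ (extChartAt (𝓡 d) c).target) :
    tangentDeriv g ι X f ((extChartAt (𝓡 d) c).symm u)
      = ∑ i, tangentPart g ι X c u i
        * fderiv ℝ (fun y => f ((extChartAt (𝓡 d) c).symm y)) u (EuclideanSpace.single i 1) := by
  rw [tangentDeriv, ← tangentVec_eq hg hι hu]
  refine (fderiv_comp_symm hu (hf _) _).symm.trans ?_
  rw [clm_eq_sum]
  rfl

end ChangeOfChart

/-! ### Integrals of functions supported in one chart. -/

section ChartIntegrals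

variable {d : ℕ} {H : Type*} [TopologicalSpace H] [CompactSpace H] [ChartedSpace (Coord d) H]
  [IsManifold (𝓡 d) ∞ H] {c : H} {f : H → ℝ}

/-- The support of a function on `H`, in the chart around `c`. -/
def chartSupport (c : H) (f : H → ℝ) : Set (Coord d) := extChartAt (𝓡 d) c '' tsupport f

lemma isCompact_chartSupport (hc : tsupport f ⊆ (chartAt (Coord d) c).source) :
    IsCompact (chartSupport c f : Set (Coord d)) :=
  (isClosed_tsupport f).isCompact.image_of_continuousOn
    ((continuousOn_extChartAt (I := 𝓡 d) c).mono (by rwa [extChartAt_source]))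

lemma chartSupport_subset (hc : tsupport f ⊆ (chartAt (Coord d) c).source) :
    chartSupport c f ⊆ (extChartAt (𝓡 d) c).target := by
  rintro _ ⟨q, hq, rfl⟩
  exact (extChartAt (𝓡 d) c).map_source (by rw [extChartAt_source]; exact hc hq)

lemma notMem_tsupport {u : Coord d} (hu : u ∈ (extChartAt (𝓡 d) c).target)
    (hu' : u ∉ chartSupport c f) : (extChartAt (𝓡 d) c).symm u ∉ tsupport f := fun h =>
  hu' ⟨_, h, (extChartAt (𝓡 d) c).right_inv hu⟩

/-- The support is compact inside the open chart domain, so continuity there suffices even if `h` is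
unbounded near the edge of the target. -/
lemma integrableOn_chart (hc : tsupport f ⊆ (chartAt (Coord d) c).source) {h : Coord d → ℝ}
    (hh : ContinuousOn h (extChartAt (𝓡 d) c).target)
    (h0 : ∀ u ∈ (extChartAt (𝓡 d) c).target, (extChartAt (𝓡 d) c).symm u ∉ tsupport f → h u = 0) :
    MeasureTheory.IntegrableOn h (extChartAt (𝓡 d) c).target :=
  ((hh.mono (chartSupport_subset hc)).integrableOn_compact
    (isCompact_chartSupport hc)).of_forall_sdiff_eq_zero
    (isOpen_extChartAt_target c).measurableSet fun u hu => h0 u hu.1 (notMem_tsupport hu.1 hu.2)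

lemma contDiffAt_comp_symm (hf : ContMDiff (𝓡 d) 𝓘(ℝ, ℝ) ∞ f) {u : Coord d}
    (hu : u ∈ (extChartAt (𝓡 d) c).target) :
    ContDiffAt ℝ ∞ (fun y => f ((extChartAt (𝓡 d) c).symm y)) u := by
  have h1 := (contMDiffOn_extChartAt_symm (I := 𝓡 d) (n := ∞) c).contMDiffAt
    (target_mem_nhds hu)
  exact contMDiffAt_iff_contDiffAt.1 (hf.contMDiffAt.comp u h1)

/-- The integral of a partial derivative of a function with compact support in a chart. -/
lemma integral_fderiv_chart (hf : ContMDiff (𝓡 d) 𝓘(ℝ, ℝ) ∞ f)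
    (hc : tsupport f ⊆ (chartAt (Coord d) c).source) {V : Coord d → ℝ}
    (hV : ∀ u ∈ (extChartAt (𝓡 d) c).target, ContDiffAt ℝ ∞ V u) (v : Coord d) :
    ∫ u in (extChartAt (𝓡 d) c).target,
      fderiv ℝ (fun y => f ((extChartAt (𝓡 d) c).symm y) * V y) u v = 0 := by
  set P : Coord d → ℝ := fun y => f ((extChartAt (𝓡 d) c).symm y) * V y with hP
  -- Extension by zero is smooth on the whole space, because near any point outside the compact
  -- support it vanishes identically.
  set F := (extChartAt (𝓡 d) c).target.indicator P with hF
  have hF1 : ∀ u ∈ (extChartAt (𝓡 d) c).target, F =ᶠ[nhds u] P := fun u hu => by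
    filter_upwards [target_mem_nhds hu] with y hy
    exact Set.indicator_of_mem hy _
  have hF0 : ∀ u, u ∉ chartSupport c f → F u = 0 := fun u hu => by
    by_cases h : u ∈ (extChartAt (𝓡 d) c).target
    · rw [hF, Set.indicator_of_mem h, hP]
      simp only
      rw [image_eq_zero_of_notMem_tsupport (notMem_tsupport h hu), zero_mul]
    · exact Set.indicator_of_notMem h _
  have hF2 : ∀ u, u ∉ chartSupport c f → F =ᶠ[nhds u] fun _ => 0 := fun u hu => by
    filter_upwards [(isCompact_chartSupport hc).isClosed.isOpen_compl.mem_nhds hu] with y hy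
    exact hF0 y hy
  have hFd : ContDiff ℝ ∞ F := contDiff_iff_contDiffAt.2 fun u => by
    by_cases h : u ∈ (extChartAt (𝓡 d) c).target
    · exact ((contDiffAt_comp_symm hf h).mul (hV u h)).congr_of_eventuallyEq (hF1 u h)
    · exact contDiffAt_const.congr_of_eventuallyEq (hF2 u fun h' => h (chartSupport_subset hc h'))
  have hFc : HasCompactSupport F := HasCompactSupport.intro (isCompact_chartSupport hc) hF0
  have hFv : Continuous fun u => fderiv ℝ F u v :=
    (hFd.continuous_fderiv (by simp)).clm_apply continuous_const
  have hFvc : HasCompactSupport fun u => fderiv ℝ F u v := by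
    refine HasCompactSupport.intro (isCompact_chartSupport hc) fun u hu => ?_
    rw [(hF2 u hu).fderiv_eq]
    simp
  -- Integration by parts against the constant function `1`.
  have h1 : ∫ u, fderiv ℝ F u v = 0 := by
    have h2 := integral_mul_fderiv_eq_neg_fderiv_mul_of_integrable (𝕜 := ℝ)
      (μ := (MeasureTheory.volume : MeasureTheory.Measure (Coord d)))
      (f := fun _ : Coord d => (1 : ℝ)) (g := F) (v := v) (by simp)
      (by simpa using hFv.integrable_of_hasCompactSupport hFvc)
      (by simpa using hFd.continuous.integrable_of_hasCompactSupport hFc)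
      (fun _ _ => differentiableAt_const _) (fun u _ => hFd.contDiffAt.differentiableAt (by simp))
    simpa using h2
  rw [← MeasureTheory.setIntegral_eq_integral_of_forall_compl_eq_zero
    (s := (extChartAt (𝓡 d) c).target) fun u hu => by
      rw [(hF2 u fun h' => hu (chartSupport_subset hc h')).fderiv_eq]
      simp] at h1
  rw [← h1]
  refine MeasureTheory.setIntegral_congr_fun (isOpen_extChartAt_target c).measurableSet
    fun u hu => ?_
  rw [(hF1 u hu).fderiv_eq]

end ChartIntegrals

/-! ### The divergence theorem on the closed section. -/

section Divergence

variable {d : ℕ} {M : Type*} [TopologicalSpace M] [ChartedSpace (Coord (d + 2)) M]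
  [IsManifold (𝓡 (d + 2)) ∞ M]
  {H : Type*} [TopologicalSpace H] [CompactSpace H] [ChartedSpace (Coord d) H]
  [IsManifold (𝓡 d) ∞ H]
  {g δg : TField (d + 2) M} {ξ δξ X : VField (d + 2) M} {𝓗 : Set M} {ι : H → M}
  {N : (q : H) → TangentSpace (𝓡 (d + 2)) (ι q)} {c : H} {f : H → ℝ}

lemma tangentDeriv_eq_zero {q : H} (hq : q ∉ tsupport f) : tangentDeriv g ι X f q = 0 := by
  have h1 : f =ᶠ[nhds q] fun _ => 0 := notMem_tsupport_iff_eventuallyEq.1 hq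
  have h2 : mfderiv (𝓡 d) 𝓘(ℝ, ℝ) f q = 0 := by
    rw [h1.mfderiv_eq]
    exact mfderiv_const
  exact DFunLike.congr_fun h2 (tangentVec g ι X q)

lemma continuousOn_tangentDeriv (hg : IsLorentzMetric g) (hι : IsSpacelikeSection g 𝓗 ι)
    (hX : SmoothVector X) (hf : ContMDiff (𝓡 d) 𝓘(ℝ, ℝ) ∞ f) :
    ContinuousOn (fun u => tangentDeriv g ι X f ((extChartAt (𝓡 d) c).symm u))
      (extChartAt (𝓡 d) c).target := by
  refine ContinuousOn.congr (f := fun u => ∑ i, tangentPart g ι X c u i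
    * fderiv ℝ (fun y => f ((extChartAt (𝓡 d) c).symm y)) u (EuclideanSpace.single i 1))
    (fun u hu => ContinuousAt.continuousWithinAt ?_)
    fun u hu => tangentDeriv_eq hg.symm hι (hf.mdifferentiable (by simp)) hu
  refine tendsto_finsetSum _ fun i _ => ?_
  exact (contDiffAt_tangentPart hg hι hX hu i).continuousAt.mul
    (((contDiffAt_comp_symm hf hu).fderiv_right (m := ∞) (by simp)).clm_apply
      contDiffAt_const).continuousAt

lemma continuousOn_sqrt_det (hg : IsLorentzMetric g) (hι : IsSpacelikeSection g 𝓗 ι) :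
    ContinuousOn (fun u => Real.sqrt (induced g ι c u).det) (extChartAt (𝓡 d) c).target :=
  fun _ hu => (contDiffAt_sqrt_det_induced hg hι hu).continuousAt.continuousWithinAt

/-- The ambient chart in `surfaceDiv` moves with the point, so continuity is not visible from the
definition; it comes from the coordinate divergence of `sum_fderiv_tangentPart`. -/
lemma continuousOn_sqrt_det_mul_surfaceDiv (hg : IsLorentzMetric g)
    (hhor : IsKillingHorizon g ξ 𝓗)
    (hvar : IsStationaryVariation g ξ 𝓗 δg δξ) (hι : IsSpacelikeSection g 𝓗 ι)
    (hN : IsTransverseNull g ξ ι N) :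
    ContinuousOn (fun u => Real.sqrt (induced g ι c u).det * surfaceDiv g ι δξ c u)
      (extChartAt (𝓡 d) c).target := by
  refine ContinuousOn.congr (fun u hu => ContinuousAt.continuousWithinAt ?_)
    fun u hu => (sum_fderiv_tangentPart hg hhor hvar hι hN hu).symm
  refine tendsto_finsetSum _ fun i _ => ?_
  exact ((((contDiffAt_sqrt_det_induced hg hι hu).mul
    (contDiffAt_tangentPart hg hι hvar.smooth_vector hu i)).fderiv_right (m := ∞)
      (by simp)).clm_apply contDiffAt_const).continuousAt

/-- Integration by parts in a chart. -/
lemma integral_mul_surfaceDiv (hg : IsLorentzMetric g) (hhor : IsKillingHorizon g ξ 𝓗)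
    (hvar : IsStationaryVariation g ξ 𝓗 δg δξ) (hι : IsSpacelikeSection g 𝓗 ι)
    (hN : IsTransverseNull g ξ ι N) (hf : ContMDiff (𝓡 d) 𝓘(ℝ, ℝ) ∞ f)
    (hc : tsupport f ⊆ (chartAt (Coord d) c).source) :
    ∫ u in (extChartAt (𝓡 d) c).target, f ((extChartAt (𝓡 d) c).symm u)
        * (Real.sqrt (induced g ι c u).det * surfaceDiv g ι δξ c u)
      = -∫ u in (extChartAt (𝓡 d) c).target,
        tangentDeriv g ι δξ f ((extChartAt (𝓡 d) c).symm u) * Real.sqrt (induced g ι c u).det := by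
  have hX := hvar.smooth_vector
  have hfc : ContinuousOn (fun u => f ((extChartAt (𝓡 d) c).symm u))
      (extChartAt (𝓡 d) c).target := fun u hu =>
    (contDiffAt_comp_symm hf hu).continuousAt.continuousWithinAt
  have hW : ∀ i, ∀ u ∈ (extChartAt (𝓡 d) c).target, ContDiffAt ℝ ∞ (fun y =>
      Real.sqrt (induced g ι c y).det * tangentPart g ι δξ c y i) u := fun i u hu =>
    (contDiffAt_sqrt_det_induced hg hι hu).mul (contDiffAt_tangentPart hg hι hX hu i)
  have hi1 : MeasureTheory.IntegrableOn (fun u => f ((extChartAt (𝓡 d) c).symm u)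
        * (Real.sqrt (induced g ι c u).det * surfaceDiv g ι δξ c u))
        (extChartAt (𝓡 d) c).target :=
    integrableOn_chart hc (hfc.mul (continuousOn_sqrt_det_mul_surfaceDiv hg hhor hvar hι hN))
      fun u _ hu => by rw [image_eq_zero_of_notMem_tsupport hu, zero_mul]
  have hi2 : MeasureTheory.IntegrableOn (fun u =>
        tangentDeriv g ι δξ f ((extChartAt (𝓡 d) c).symm u) * Real.sqrt (induced g ι c u).det)
        (extChartAt (𝓡 d) c).target :=
    integrableOn_chart hc ((continuousOn_tangentDeriv hg hι hX hf).mul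
      (continuousOn_sqrt_det hg hι)) fun u _ hu => by rw [tangentDeriv_eq_zero hu, zero_mul]
  rw [eq_neg_iff_add_eq_zero, ← MeasureTheory.integral_add hi1 hi2]
  have hi3 : ∀ i, MeasureTheory.IntegrableOn (fun u => fderiv ℝ (fun y =>
      f ((extChartAt (𝓡 d) c).symm y) * (Real.sqrt (induced g ι c y).det
        * tangentPart g ι δξ c y i)) u (EuclideanSpace.single i 1))
        (extChartAt (𝓡 d) c).target := fun i => by
    refine integrableOn_chart hc (fun u hu => ?_) fun u hu hu' => ?_
    · exact ((((contDiffAt_comp_symm hf hu).mul (hW i u hu)).fderiv_right (m := ∞)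
        (by simp)).clm_apply contDiffAt_const).continuousAt.continuousWithinAt
    · have h1 : (fun y => f ((extChartAt (𝓡 d) c).symm y) * (Real.sqrt (induced g ι c y).det
          * tangentPart g ι δξ c y i)) =ᶠ[nhds u] fun _ => 0 := by
        filter_upwards [(continuousOn_extChartAt_symm c).continuousAt (target_mem_nhds hu)
          |>.eventually ((isClosed_tsupport f).isOpen_compl.mem_nhds hu')] with y hy
        rw [image_eq_zero_of_notMem_tsupport hy, zero_mul]
      rw [h1.fderiv_eq]
      simp
  -- Zero is written as the integral of the coordinate divergence of the field cut off by `f`; the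
  -- integrands then agree by the product rule.
  rw [← Finset.sum_eq_zero fun i (_ : i ∈ Finset.univ) => integral_fderiv_chart hf hc (hW i)
    (EuclideanSpace.single i 1), ← MeasureTheory.integral_finsetSum _ fun i _ => hi3 i]
  refine MeasureTheory.setIntegral_congr_fun (isOpen_extChartAt_target c).measurableSet
    fun u hu => ?_
  rw [← sum_fderiv_tangentPart hg hhor hvar hι hN hu,
    tangentDeriv_eq hg.symm hι (hf.mdifferentiable (by simp)) hu, Finset.mul_sum, Finset.sum_mul,
    ← Finset.sum_add_distrib]
  refine Finset.sum_congr rfl fun i _ => ?_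
  have e : HasFDerivAt (fun y => f ((extChartAt (𝓡 d) c).symm y)
      * (Real.sqrt (induced g ι c y).det * tangentPart g ι δξ c y i)) _ u :=
    ((contDiffAt_comp_symm hf hu).differentiableAt (by simp)).hasFDerivAt.mul
      ((hW i u hu).differentiableAt (by simp)).hasFDerivAt
  rw [e.fderiv, _root_.add_apply, _root_.smul_apply, _root_.smul_apply, smul_eq_mul, smul_eq_mul]
  ring

/-- The divergence of the projection of `δξ` integrates to zero. -/
theorem sum_integral_surfaceDiv (hg : IsLorentzMetric g) (hhor : IsKillingHorizon g ξ 𝓗)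
    (hvar : IsStationaryVariation g ξ 𝓗 δg δξ) (hι : IsSpacelikeSection g 𝓗 ι)
    (hN : IsTransverseNull g ξ ι N)
    (ρ : SmoothPartitionOfUnity H (𝓡 d) H Set.univ)
    (hρ : ρ.IsSubordinate fun c => (chartAt (Coord d) c).source) {S : Finset H}
    (hS : ∀ c ∉ S, ∀ q, ρ c q = 0) :
    ∑ c ∈ S, ∫ u in (extChartAt (𝓡 d) c).target, ρ c ((extChartAt (𝓡 d) c).symm u)
        * (Real.sqrt (induced g ι c u).det * surfaceDiv g ι δξ c u) = 0 := by
  have hX := hvar.smooth_vector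
  have hsm : ∀ c, ContMDiff (𝓡 d) 𝓘(ℝ, ℝ) ∞ (ρ c) := fun c => (ρ c).contMDiff
  have hone : ∀ q, ∑ c ∈ S, ρ c q = 1 := fun q => by
    rw [← ρ.sum_eq_one (Set.mem_univ q)]
    refine (finsum_eq_sum_of_support_subset _ fun c hc => ?_).symm
    by_contra h
    exact hc (hS c h q)
  have hρc : ∀ a b : H, ContinuousOn (fun u => ρ a ((extChartAt (𝓡 d) b).symm u))
      (extChartAt (𝓡 d) b).target := fun a b u hu =>
    (contDiffAt_comp_symm (hsm a) hu).continuousAt.continuousWithinAt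
  have hD : ∀ a b : H, ContinuousOn (fun u => ρ a ((extChartAt (𝓡 d) b).symm u)
      * tangentDeriv g ι δξ (ρ a) ((extChartAt (𝓡 d) b).symm u)) (extChartAt (𝓡 d) b).target :=
    fun a b => (hρc a b).mul (continuousOn_tangentDeriv hg hι hX (hsm a))
  set F : H → H → H → ℝ := fun a b q => ρ a q * tangentDeriv g ι δξ (ρ b) q with hF
  have hF0 : ∀ a b q, q ∉ tsupport (ρ a) ∨ q ∉ tsupport (ρ b) → F a b q = 0 := by
    rintro a b q (h | h)
    · simp only [hF, image_eq_zero_of_notMem_tsupport h, zero_mul]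
    · simp only [hF, tangentDeriv_eq_zero h, mul_zero]
  have hFc : ∀ a b c : H, ContinuousOn (fun u => F a b ((extChartAt (𝓡 d) c).symm u)
      * Real.sqrt (induced g ι c u).det) (extChartAt (𝓡 d) c).target := fun a b c =>
    ((hρc a c).mul (continuousOn_tangentDeriv hg hι hX (hsm b))).mul (continuousOn_sqrt_det hg hι)
  -- After integrating by parts, `1 = ∑ ρ a` is inserted. The term with index `a` is supported in
  -- both charts, so it may be moved from the chart of `c` to that of `a`.
  have h1 : ∀ c ∈ S, ∫ u in (extChartAt (𝓡 d) c).target, ρ c ((extChartAt (𝓡 d) c).symm u)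
        * (Real.sqrt (induced g ι c u).det * surfaceDiv g ι δξ c u)
      = -∑ a ∈ S, ∫ u in (extChartAt (𝓡 d) a).target,
        F a c ((extChartAt (𝓡 d) a).symm u) * Real.sqrt (induced g ι a u).det := fun c _ => by
    rw [integral_mul_surfaceDiv hg hhor hvar hι hN (hsm c) (hρ c)]
    congr 1
    have h2 : ∀ a, ∫ u in (extChartAt (𝓡 d) a).target,
        F a c ((extChartAt (𝓡 d) a).symm u) * Real.sqrt (induced g ι a u).det
        = ∫ u in (extChartAt (𝓡 d) c).target,
        F a c ((extChartAt (𝓡 d) c).symm u) * Real.sqrt (induced g ι c u).det := fun a =>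
      integral_area_chart _ fun q hq => by
        constructor <;> by_contra h
        · exact hq (hF0 _ _ _ (Or.inl fun h' => h (hρ a h')))
        · exact hq (hF0 _ _ _ (Or.inr fun h' => h (hρ c h')))
    rw [Finset.sum_congr rfl fun a _ => h2 a, ← MeasureTheory.integral_finsetSum _ fun a _ =>
      integrableOn_chart (hρ c) (hFc a c c) fun u _ hu => by
        rw [hF0 _ _ _ (Or.inr hu), zero_mul]]
    refine MeasureTheory.setIntegral_congr_fun (isOpen_extChartAt_target c).measurableSet
      fun u _ => ?_
    simp only [hF, ← Finset.sum_mul, hone, one_mul]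
  rw [Finset.sum_congr rfl h1, Finset.sum_neg_distrib, neg_eq_zero, Finset.sum_comm]
  refine Finset.sum_eq_zero fun a _ => ?_
  rw [← MeasureTheory.integral_finsetSum _ fun b _ =>
      integrableOn_chart (hρ a) (hFc a b a) fun u _ hu => by
        rw [hF0 _ _ _ (Or.inl hu), zero_mul]]
  refine (MeasureTheory.setIntegral_congr_fun (g := fun _ => (0 : ℝ))
    (isOpen_extChartAt_target a).measurableSet fun u hu => ?_).trans (by simp)
  -- With the sums exchanged, each chart contains the derivative of `∑ ρ b = 1`, which is zero.
  have h3 : ∑ b ∈ S, tangentDeriv g ι δξ (ρ b) ((extChartAt (𝓡 d) a).symm u) = 0 := by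
    rw [Finset.sum_congr rfl fun b _ => tangentDeriv_eq hg.symm hι
      ((hsm b).mdifferentiable (by simp)) hu, Finset.sum_comm]
    refine Finset.sum_eq_zero fun i _ => ?_
    rw [← Finset.mul_sum]
    have h4 : HasFDerivAt (fun y => ∑ b ∈ S, ρ b ((extChartAt (𝓡 d) a).symm y)) _ u :=
      HasFDerivAt.fun_sum fun b _ =>
        ((contDiffAt_comp_symm (hsm b) hu).differentiableAt (by simp)).hasFDerivAt
    have h5 := h4.fderiv
    simp only [hone, fderiv_fun_const] at h5
    have h6 := DFunLike.congr_fun h5 (EuclideanSpace.single i 1)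
    rw [_root_.sum_apply] at h6
    rw [← h6]
    simp
  simp only [hF]
  rw [← Finset.sum_mul, ← Finset.mul_sum, h3, mul_zero, zero_mul]

end Divergence

/-! ### The exterior derivative of a lowered vector field, and its chart independence. -/

section ExteriorDerivative

variable {n : ℕ} {G : Coord n → Coord n →L[ℝ] Coord n →L[ℝ] ℝ} {a : Coord n → Coord n}
  {u : Coord n}

/-- The exterior derivative of the one-form `G(a, ·)`. -/
def extDer (G : Coord n → Coord n →L[ℝ] Coord n →L[ℝ] ℝ) (a : Coord n → Coord n)
    (u v w : Coord n) : ℝ :=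
  fderiv ℝ (fun y => G y (a y)) u v w - fderiv ℝ (fun y => G y (a y)) u w v

lemma hasFDerivAt_apply_const {F : Type*} [NormedAddCommGroup F] [NormedSpace ℝ F]
    {α : Coord n → Coord n →L[ℝ] F} (hα : DifferentiableAt ℝ α u) (v w : Coord n) :
    fderiv ℝ (fun y => α y w) u v = fderiv ℝ α u v w := by
  rw [(hα.hasFDerivAt.clm_apply (hasFDerivAt_const w u)).fderiv]
  simp

/-- The Christoffel terms cancel in the antisymmetrization, as the connection is metric and
torsion-free. -/
lemma IsMetricAt.extDer_eq (hG : IsMetricAt G u) (ha : DifferentiableAt ℝ a u) (v w : Coord n) :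
    extDer G a u v w = G u (cov G a u v) w - G u (cov G a u w) v := by
  have hd : DifferentiableAt ℝ (fun y => G y (a y)) u := hG.diff.clm_apply ha
  rw [extDer, ← hasFDerivAt_apply_const hd, ← hasFDerivAt_apply_const hd,
    fderiv_clm_field hG.diff ha, fderiv_clm_field hG.diff ha, hG.fderiv_eq, hG.fderiv_eq,
    cov_eq ha, cov_eq ha, hG.chr_symm w v]
  simp only [map_add, _root_.add_apply]
  ring

variable {M : Type*} [TopologicalSpace M] [ChartedSpace (Coord n) M] [IsManifold (𝓡 n) ∞ M]
  {g : TField n M} {X : VField n M} {x y : M}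

lemma eventually_symm_chartChange (hu : u ∈ (extChartAt (𝓡 n) x).target)
    (hy : (extChartAt (𝓡 n) x).symm u ∈ (chartAt (Coord n) y).source) :
    ∀ᶠ z in nhds u, (extChartAt (𝓡 n) y).symm (chartChange x y z)
      = (extChartAt (𝓡 n) x).symm z :=
  (eventually_mem_source hu hy).mono fun z hz =>
    (extChartAt (𝓡 n) y).left_inv (by rw [extChartAt_source]; exact hz.2)

lemma chartChange_mem_target (hy : (extChartAt (𝓡 n) x).symm u ∈ (chartAt (Coord n) y).source) :
    chartChange x y u ∈ (extChartAt (𝓡 n) y).target :=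
  (extChartAt (𝓡 n) y).map_source (by rwa [extChartAt_source])

lemma fderiv_scalar_chartChange {Q : M → ℝ} (hu : u ∈ (extChartAt (𝓡 n) x).target)
    (hy : (extChartAt (𝓡 n) x).symm u ∈ (chartAt (Coord n) y).source)
    (hQ : DifferentiableAt ℝ (fun z => Q ((extChartAt (𝓡 n) y).symm z)) (chartChange x y u))
    (v : Coord n) :
    fderiv ℝ (fun z => Q ((extChartAt (𝓡 n) x).symm z)) u v
      = fderiv ℝ (fun z => Q ((extChartAt (𝓡 n) y).symm z)) (chartChange x y u)
        (fderiv ℝ (chartChange x y) u v) := by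
  have h1 : (fun z => Q ((extChartAt (𝓡 n) x).symm z)) =ᶠ[nhds u]
      (fun z => Q ((extChartAt (𝓡 n) y).symm z)) ∘ chartChange x y :=
    (eventually_symm_chartChange hu hy).mono fun z hz => congrArg Q hz.symm
  rw [h1.fderiv_eq, fderiv_comp _ hQ ((contDiffAt_chartChange hu hy).differentiableAt (by simp))]
  rfl

/-- The one-form pulls back under the change of chart; differentiating produces a second derivative
of the chart change, which is symmetric and drops out. -/
lemma extDer_chartChange (hg : SmoothTensor g) (hX : SmoothVector X)
    (hu : u ∈ (extChartAt (𝓡 n) x).target)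
    (hy : (extChartAt (𝓡 n) x).symm u ∈ (chartAt (Coord n) y).source) (v w : Coord n) :
    extDer (tensorIn g y) (vecIn X y) (chartChange x y u) (fderiv ℝ (chartChange x y) u v)
        (fderiv ℝ (chartChange x y) u w)
      = extDer (tensorIn g x) (vecIn X x) u v w := by
  have hφ := contDiffAt_chartChange hu hy
  have hφ' : DifferentiableAt ℝ (fderiv ℝ (chartChange x y)) u :=
    (hφ.fderiv_right (m := ∞) (by simp)).differentiableAt (by simp)
  have ht := chartChange_mem_target hy
  have hdx : DifferentiableAt ℝ (fun z => tensorIn g x z (vecIn X x z)) u :=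
    (tensorIn_differentiableAt hg hu).clm_apply (vecIn_differentiableAt hX hu)
  have hdy : DifferentiableAt ℝ (fun z => tensorIn g y z (vecIn X y z)) (chartChange x y u) :=
    (tensorIn_differentiableAt hg ht).clm_apply (vecIn_differentiableAt hX ht)
  have h1 : ∀ v w, fderiv ℝ (fun z => tensorIn g x z (vecIn X x z)) u v w
      = fderiv ℝ (fun z => tensorIn g y z (vecIn X y z)) (chartChange x y u)
          (fderiv ℝ (chartChange x y) u v) (fderiv ℝ (chartChange x y) u w)
        + tensorIn g y (chartChange x y u) (vecIn X y (chartChange x y u))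
          (fderiv ℝ (fderiv ℝ (chartChange x y)) u v w) := fun v w => by
    rw [← hasFDerivAt_apply_const hdx]
    have e : (fun z => tensorIn g x z (vecIn X x z) w) =ᶠ[nhds u] fun z =>
        tensorIn g y (chartChange x y z) (vecIn X y (chartChange x y z))
          (fderiv ℝ (chartChange x y) z w) :=
      (eventually_mem_source hu hy).mono fun z hz => by
        beta_reduce
        rw [vecIn_chartChange X hz.1 hz.2, tensorIn_chartChange g hz.1 hz.2]
    have e1 : HasFDerivAt (fun z => tensorIn g y (chartChange x y z) (vecIn X y (chartChange x y z)))
        _ u := hasFDerivAt_comp_field (T := fun z => tensorIn g y z (vecIn X y z)) hdy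
          (hφ.differentiableAt (by simp))
    have e2 := e1.clm_apply (hφ'.hasFDerivAt.clm_apply (hasFDerivAt_const w u))
    rw [e.fderiv_eq, e2.fderiv]
    simp [add_comm]
  rw [extDer, extDer, h1, h1, (hφ.isSymmSndFDerivAt (by
    simp only [minSmoothness_of_isRCLikeNormedField]; exact two_le_infty)).eq v w]
  ring

end ExteriorDerivative

/-! ### Surface gravity and its variation as differentials of `ξ²`. -/

section SurfaceGravity

variable {d : ℕ} {M : Type*} [TopologicalSpace M] [ChartedSpace (Coord (d + 2)) M]
  [IsManifold (𝓡 (d + 2)) ∞ M]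
  {g δg : TField (d + 2) M} {ξ δξ : VField (d + 2) M} {𝓗 : Set M} {κ δκ : M → ℝ}
  {G h : Coord (d + 2) → Coord (d + 2) →L[ℝ] Coord (d + 2) →L[ℝ] ℝ}
  {a x : Coord (d + 2) → Coord (d + 2)} {u : Coord (d + 2)}

lemma fderiv_clm_pair {n : ℕ} {T : Coord n → Coord n →L[ℝ] Coord n →L[ℝ] ℝ} {u : Coord n}
    {X Y : Coord n → Coord n} (hT : DifferentiableAt ℝ T u) (hX : DifferentiableAt ℝ X u)
    (hY : DifferentiableAt ℝ Y u) (v : Coord n) :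
    fderiv ℝ (fun y => T y (X y) (Y y)) u v
      = fderiv ℝ T u v (X u) (Y u) + T u (fderiv ℝ X u v) (Y u) + T u (X u) (fderiv ℝ Y u v) := by
  have h := (hT.hasFDerivAt.clm_apply hX.hasFDerivAt).clm_apply hY.hasFDerivAt
  rw [h.fderiv]
  simp only [_root_.add_apply, ContinuousLinearMap.comp_apply, ContinuousLinearMap.flip_apply]
  ring

lemma lieForm_eq_zero {T : Coord (d + 2) → Coord (d + 2) →L[ℝ] Coord (d + 2) →L[ℝ] ℝ}
    (hT : DifferentiableAt ℝ T u) (hx : DifferentiableAt ℝ x u)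
    (hK : ∀ i j, lieDeriv (vcomps x) (tcomps T) u i j = 0) (v w : Coord (d + 2)) :
    lieForm x T u v w = 0 := by
  rw [clm_apply_eq_sum]
  simp only [← lieDeriv_eq hT hx, hK, mul_zero, Finset.sum_const_zero]

lemma lieForm_add_eq_zero (hG : DifferentiableAt ℝ G u) (hh : DifferentiableAt ℝ h u)
    (hx : DifferentiableAt ℝ x u) (ha : DifferentiableAt ℝ a u)
    (hS : ∀ i j, lieDeriv (vcomps x) (tcomps h) u i j + lieDeriv (vcomps a) (tcomps G) u i j = 0)
    (v w : Coord (d + 2)) : lieForm x h u v w + lieForm a G u v w = 0 := by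
  rw [clm_apply_eq_sum (lieForm x h u), clm_apply_eq_sum (lieForm a G u),
    ← Finset.sum_add_distrib]
  refine Finset.sum_eq_zero fun i _ => ?_
  rw [← Finset.sum_add_distrib]
  refine Finset.sum_eq_zero fun j _ => ?_
  rw [← mul_add, ← lieDeriv_eq hh hx, ← lieDeriv_eq hG ha, hS, mul_zero]

/-- By the Killing equation `ξ^ν D_ν ξ_μ = -ξ^ν D_μ ξ_ν = -½ ∂_μ(ξ²)`, which involves no connection.
-/
lemma surfaceGravity_coord (hG : IsMetricAt G u) (hx : DifferentiableAt ℝ x u)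
    (killing : ∀ i j, lieDeriv (vcomps x) (tcomps G) u i j = 0) {k : ℝ}
    (hk : ∀ i, acceleration (tcomps G) (vcomps x) u i = k * x u i) (w : Coord (d + 2)) :
    -(1 / 2) * fderiv ℝ (fun y => G y (x y) (x y)) u w = k * G u (x u) w := by
  have h1 := lieForm_eq_zero hG.diff hx killing (x u) w
  rw [lieForm_apply] at h1
  have h2 := hG.lower_cov hx w
  have h3 : cov G x u (x u) = k • x u := by
    ext i
    exact (acceleration_eq i).symm.trans (hk i)
  rw [h3, map_smul, _root_.smul_apply, smul_eq_mul] at h2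
  rw [fderiv_clm_pair hG.diff hx hx, hG.symm _ (fderiv ℝ x u w) (x u)]
  linarith

/-- The linearization of `surfaceGravity_coord`: the Killing equation is applied to the pair `(a,
w)` and its variation to the pair `(x, w)`. -/
lemma surfaceGravityVariation_coord (hG : IsMetricAt G u) (hh : DifferentiableAt ℝ h u)
    (hs : ∀ y v w, h y v w = h y w v) (hx : DifferentiableAt ℝ x u) (ha : DifferentiableAt ℝ a u)
    (killing : ∀ i j, lieDeriv (vcomps x) (tcomps G) u i j = 0)
    (stat : ∀ i j, lieDeriv (vcomps x) (tcomps h) u i j + lieDeriv (vcomps a) (tcomps G) u i j = 0)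
    {k dk : ℝ} (hk : ∀ i, acceleration (tcomps G) (vcomps x) u i = k * x u i)
    (hdk : ∀ i, HasDerivAt (fun s : ℝ =>
      acceleration (tcomps fun y => G y + s • h y) (vcomps fun y => x y + s • a y) u i
        - (k + s * dk) * (x u + s • a u) i) 0 0) (w : Coord (d + 2)) :
    -(1 / 2) * (fderiv ℝ (fun y => h y (x y) (x y) + 2 * G y (a y) (x y)) u w)
      = dk * G u (x u) w + k * (h u (x u) w + G u (a u) w) := by
  have h1 := lieForm_eq_zero hG.diff hx killing (a u) w
  have h2 := lieForm_add_eq_zero hG.diff hh hx ha stat (x u) w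
  rw [lieForm_apply] at h1
  rw [lieForm_apply, lieForm_apply] at h2
  rw [← hG.variation_acceleration hh hs hx ha hk hdk w]
  have e1 : DifferentiableAt ℝ (fun y => h y (x y) (x y)) u := (hh.clm_apply hx).clm_apply hx
  have e2 : DifferentiableAt ℝ (fun y => G y (a y) (x y)) u := (hG.diff.clm_apply ha).clm_apply hx
  have e3 : HasFDerivAt (fun y => h y (x y) (x y) + 2 * G y (a y) (x y)) _ u :=
    e1.hasFDerivAt.add (e2.hasFDerivAt.const_mul 2)
  rw [e3.fderiv, _root_.add_apply, _root_.smul_apply, smul_eq_mul, fderiv_clm_pair hh hx hx,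
    fderiv_clm_pair hG.diff ha hx, hs _ (fderiv ℝ x u w), hG.symm _ (fderiv ℝ a u w),
    fderiv_symm hG.diff (fun y => hG.symm y) w (x u) (a u)]
  linarith

end SurfaceGravity

/-! ### Continuity of the integrands along the section. -/

section Continuity

variable {d : ℕ} {M : Type*} [TopologicalSpace M] [ChartedSpace (Coord (d + 2)) M]
  [IsManifold (𝓡 (d + 2)) ∞ M]
  {H : Type*} [TopologicalSpace H] [ChartedSpace (Coord d) H] [IsManifold (𝓡 d) ∞ H]
  {g δg : TField (d + 2) M} {ξ δξ : VField (d + 2) M} {𝓗 : Set M} {κ δκ : M → ℝ} {ι : H → M}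
  {N : (q : H) → TangentSpace (𝓡 (d + 2)) (ι q)} {c : H} {x p : M} {y : Coord (d + 2)}

/-- Both sides are covectors, one the differential of a scalar, so the relation passes from the
centre of the chart at `p` to any chart containing `p`. A fixed chart can then serve for nearby
points. -/
lemma surfaceGravity_chart (hhor : IsKillingHorizon g ξ 𝓗)
    (hκ : IsSurfaceGravity g ξ 𝓗 κ) (hy : y ∈ (extChartAt (𝓡 (d + 2)) x).target)
    (hyp : (extChartAt (𝓡 (d + 2)) x).symm y = p) (hp : p ∈ 𝓗)
    (hG : IsMetricAt (tensorIn g p) (extChartAt (𝓡 (d + 2)) p p)) (v : Coord (d + 2)) :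
    -(1 / 2) * fderiv ℝ (fun z => tensorIn g x z (vecIn ξ x z) (vecIn ξ x z)) y v
      = κ p * tensorIn g x y (vecIn ξ x y) v := by
  have hs : (extChartAt (𝓡 (d + 2)) x).symm y ∈ (chartAt (Coord (d + 2)) p).source := by
    rw [hyp]
    exact mem_chart_source _ p
  have hcc : chartChange x p y = extChartAt (𝓡 (d + 2)) p p := by rw [chartChange, hyp]
  have ht := mem_extChartAt_target (I := 𝓡 (d + 2)) p
  have hξ := vecIn_differentiableAt hhor.smooth ht
  obtain ⟨Q, hQ⟩ : ∃ Q : M → ℝ, ∀ r, Q r = g r (ξ r) (ξ r) := ⟨_, fun _ => rfl⟩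
  have e : ∀ (b : M) (z : Coord (d + 2)), z ∈ (extChartAt (𝓡 (d + 2)) b).target →
      (fun z => tensorIn g b z (vecIn ξ b z) (vecIn ξ b z)) =ᶠ[nhds z]
        fun z => Q ((extChartAt (𝓡 (d + 2)) b).symm z) := fun b z hz => by
    filter_upwards [target_mem_nhds hz] with z' hz'
    exact (tensorIn_vecIn_vecIn g ξ ξ hz').trans (hQ _).symm
  have hd : DifferentiableAt ℝ (fun z => tensorIn g p z (vecIn ξ p z) (vecIn ξ p z))
      (extChartAt (𝓡 (d + 2)) p p) := (hG.diff.clm_apply hξ).clm_apply hξ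
  rw [(e x y hy).fderiv_eq, fderiv_scalar_chartChange hy hs
    (by rw [hcc]; exact hd.congr_of_eventuallyEq (e p _ ht).symm), hcc, ← (e p _ ht).fderiv_eq,
    surfaceGravity_coord hG hξ (hhor.killing p) (k := κ p) fun i => ?_, ← hcc,
    vecIn_chartChange ξ hy hs, tensorIn_chartChange g hy hs]
  rw [vecIn_self]
  exact hκ p hp i

lemma surfaceGravityVariation_chart (hhor : IsKillingHorizon g ξ 𝓗)
    (hvar : IsStationaryVariation g ξ 𝓗 δg δξ) (hκ : IsSurfaceGravity g ξ 𝓗 κ)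
    (hδκ : IsSurfaceGravityVariation g ξ 𝓗 δg δξ κ δκ)
    (hy : y ∈ (extChartAt (𝓡 (d + 2)) x).target)
    (hyp : (extChartAt (𝓡 (d + 2)) x).symm y = p) (hp : p ∈ 𝓗)
    (hG : IsMetricAt (tensorIn g p) (extChartAt (𝓡 (d + 2)) p p)) (v : Coord (d + 2)) :
    -(1 / 2) * fderiv ℝ (fun z => tensorIn δg x z (vecIn ξ x z) (vecIn ξ x z)
        + 2 * tensorIn g x z (vecIn δξ x z) (vecIn ξ x z)) y v
      = δκ p * tensorIn g x y (vecIn ξ x y) v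
        + κ p * (tensorIn δg x y (vecIn ξ x y) v + tensorIn g x y (vecIn δξ x y) v) := by
  have hs : (extChartAt (𝓡 (d + 2)) x).symm y ∈ (chartAt (Coord (d + 2)) p).source := by
    rw [hyp]
    exact mem_chart_source _ p
  have hcc : chartChange x p y = extChartAt (𝓡 (d + 2)) p p := by rw [chartChange, hyp]
  have ht := mem_extChartAt_target (I := 𝓡 (d + 2)) p
  have hξ := vecIn_differentiableAt hhor.smooth ht
  have ha := vecIn_differentiableAt hvar.smooth_vector ht
  have hh := tensorIn_differentiableAt hvar.smooth_metric ht
  obtain ⟨Q, hQ⟩ : ∃ Q : M → ℝ, ∀ r, Q r = δg r (ξ r) (ξ r) + 2 * g r (δξ r) (ξ r) :=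
    ⟨_, fun _ => rfl⟩
  have e : ∀ (b : M) (z : Coord (d + 2)), z ∈ (extChartAt (𝓡 (d + 2)) b).target →
      (fun z => tensorIn δg b z (vecIn ξ b z) (vecIn ξ b z)
        + 2 * tensorIn g b z (vecIn δξ b z) (vecIn ξ b z)) =ᶠ[nhds z]
        fun z => Q ((extChartAt (𝓡 (d + 2)) b).symm z) := fun b z hz => by
    filter_upwards [target_mem_nhds hz] with z' hz'
    rw [tensorIn_vecIn_vecIn δg ξ ξ hz', tensorIn_vecIn_vecIn g δξ ξ hz', hQ]
  have hd : DifferentiableAt ℝ (fun z => tensorIn δg p z (vecIn ξ p z) (vecIn ξ p z)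
        + 2 * tensorIn g p z (vecIn δξ p z) (vecIn ξ p z))
      (extChartAt (𝓡 (d + 2)) p p) :=
    ((hh.clm_apply hξ).clm_apply hξ).add (((hG.diff.clm_apply ha).clm_apply hξ).const_mul 2)
  rw [(e x y hy).fderiv_eq, fderiv_scalar_chartChange hy hs
    (by rw [hcc]; exact hd.congr_of_eventuallyEq (e p _ ht).symm), hcc, ← (e p _ ht).fderiv_eq,
    surfaceGravityVariation_coord hG hh (fun y v w => tensorIn_symm hvar.symm _ _ _ _) hξ ha
      (hhor.killing p) (hvar.stationary p) (k := κ p) (dk := δκ p) (fun i => ?_) (fun i => ?_),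
    ← hcc, vecIn_chartChange ξ hy hs, vecIn_chartChange δξ hy hs, tensorIn_chartChange g hy hs,
    tensorIn_chartChange g hy hs, tensorIn_chartChange δg hy hs]
  · rw [vecIn_self]
    exact hκ p hp i
  · have h1 := hδκ p hp i
    refine h1.congr_of_eventuallyEq (Filter.Eventually.of_forall fun s => ?_)
    beta_reduce
    rw [vecIn_self, vecIn_self, ← vecCoord_line, ← coordTensor_line, ← coordVector_line]
    rfl

lemma symm_mapIn {u : Coord d}
    (hx : ι ((extChartAt (𝓡 d) c).symm u) ∈ (chartAt (Coord (d + 2)) x).source) :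
    (extChartAt (𝓡 (d + 2)) x).symm (mapIn ι c x u) = ι ((extChartAt (𝓡 d) c).symm u) :=
  (extChartAt (𝓡 (d + 2)) x).left_inv (by rwa [extChartAt_source])

lemma continuousAt_fderiv_comp {n : ℕ} {F : Type*} [NormedAddCommGroup F] [NormedSpace ℝ F]
    {f : Coord n → F} {X : Coord d → Coord n} {u : Coord d} (hf : ContDiffAt ℝ ∞ f (X u))
    (hX : ContinuousAt X u) : ContinuousAt (fun y => fderiv ℝ f (X y)) u :=
  ContinuousAt.comp (g := fderiv ℝ f) (hf.fderiv_right (m := ∞) (by simp)).continuousAt hX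

/-- The variation of the surface gravity is continuous along a section of the horizon. -/
lemma continuousOn_surfaceGravityVariation (hg : IsLorentzMetric g)
    (hhor : IsKillingHorizon g ξ 𝓗)
    (hvar : IsStationaryVariation g ξ 𝓗 δg δξ) (hκ : IsSurfaceGravity g ξ 𝓗 κ)
    (hδκ : IsSurfaceGravityVariation g ξ 𝓗 δg δξ κ δκ)
    (hι : IsSpacelikeSection g 𝓗 ι) (hN : IsTransverseNull g ξ ι N) :
    ContinuousOn (fun u => δκ (ι ((extChartAt (𝓡 d) c).symm u))) (extChartAt (𝓡 d) c).target := by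
  refine fun u hu => ContinuousAt.continuousWithinAt ?_
  set x := ι ((extChartAt (𝓡 d) c).symm u) with hxdef
  have hx : ι ((extChartAt (𝓡 d) c).symm u) ∈ (chartAt (Coord (d + 2)) x).source :=
    mem_chart_source _ _
  have ht := mapIn_mem_target hx
  have hX := (contDiffAt_mapIn hι.smooth hu hx).continuousAt
  have cg := (contDiffOn_tensorIn hg.smooth x).contDiffAt (target_mem_nhds ht)
  have ch := (contDiffOn_tensorIn hvar.smooth_metric x).contDiffAt (target_mem_nhds ht)
  have cξ := (contDiffOn_vecIn hhor.smooth x).contDiffAt (target_mem_nhds ht)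
  have ca := (contDiffOn_vecIn hvar.smooth_vector x).contDiffAt (target_mem_nhds ht)
  -- The value of `N` at the base point, frozen as a constant coordinate vector: `ξ · v` equals `-1`
  -- there and stays nonzero nearby, whether or not `N` is continuous.
  set v : Coord (d + 2) := vecCoord x (N ((extChartAt (𝓡 d) c).symm u)) with hv
  set s : Coord d → ℝ := fun z =>
    tensorIn g x (mapIn ι c x z) (vecIn ξ x (mapIn ι c x z)) v with hs
  have hsc : ContinuousAt s u := ContinuousAt.comp
    (g := fun z => tensorIn g x z (vecIn ξ x z) v)
    ((cg.clm_apply cξ).clm_apply contDiffAt_const).continuousAt hX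
  have hs0 : s u ≠ 0 := by
    have h1 : s u = g x (ξ x) (N ((extChartAt (𝓡 d) c).symm u)) := by
      have h2 : vecIn ξ x (mapIn ι c x u) = vecCoord x (ξ x) := vecIn_self ξ x
      simp only [hs, h2]
      exact tensorIn_vecCoord_self g x _ _
    rw [h1, hg.symm]
    have h3 := hN.normalized ((extChartAt (𝓡 d) c).symm u)
    exact ne_of_eq_of_ne h3 (by norm_num)
  set A : Coord d → ℝ := fun z => -(1 / 2) *
    fderiv ℝ (fun z => tensorIn g x z (vecIn ξ x z) (vecIn ξ x z)) (mapIn ι c x z) v with hA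
  set B : Coord d → ℝ := fun z => tensorIn δg x (mapIn ι c x z) (vecIn ξ x (mapIn ι c x z)) v
    + tensorIn g x (mapIn ι c x z) (vecIn δξ x (mapIn ι c x z)) v with hB
  set C : Coord d → ℝ := fun z => -(1 / 2) *
    fderiv ℝ (fun z => tensorIn δg x z (vecIn ξ x z) (vecIn ξ x z)
      + 2 * tensorIn g x z (vecIn δξ x z) (vecIn ξ x z)) (mapIn ι c x z) v with hC
  have hAc : ContinuousAt A u := continuousAt_const.mul
    ((continuousAt_fderiv_comp ((cg.clm_apply cξ).clm_apply cξ) hX).clm_apply continuousAt_const)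
  have hBc : ContinuousAt B u := ContinuousAt.comp
    (g := fun z => tensorIn δg x z (vecIn ξ x z) v + tensorIn g x z (vecIn δξ x z) v)
    (((ch.clm_apply cξ).clm_apply contDiffAt_const).add
      ((cg.clm_apply ca).clm_apply contDiffAt_const)).continuousAt hX
  have hCc : ContinuousAt C u := continuousAt_const.mul
    ((continuousAt_fderiv_comp (((ch.clm_apply cξ).clm_apply cξ).add
      (contDiffAt_const.mul ((cg.clm_apply ca).clm_apply cξ))) hX).clm_apply continuousAt_const)
  -- The two covector identities paired with `v` read `A = κ s` and `C = δκ s + κ B`. Solving gives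
  -- `δκ = (C - (A / s) B) / s`.
  refine ((hCc.sub ((hAc.div hsc hs0).mul hBc)).div hsc hs0).congr ?_
  filter_upwards [eventually_mapIn hι.smooth hu hx, hsc.eventually_ne hs0] with z hz hz0
  have hp := hι.mem ((extChartAt (𝓡 d) c).symm z)
  have hG := isMetricAt hg hhor hι hN ((extChartAt (𝓡 d) c).symm z)
  have h1 : A z = _ := surfaceGravity_chart hhor hκ (mapIn_mem_target hz.2) (symm_mapIn hz.2)
    hp hG v
  have h2 : C z = _ := surfaceGravityVariation_chart hhor hvar hκ hδκ (mapIn_mem_target hz.2)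
    (symm_mapIn hz.2) hp hG v
  have h1' : A z = κ (ι ((extChartAt (𝓡 d) c).symm z)) * s z := h1
  have h2' : C z = δκ (ι ((extChartAt (𝓡 d) c).symm z)) * s z
    + κ (ι ((extChartAt (𝓡 d) c).symm z)) * B z := h2
  rw [Pi.div_apply, Pi.sub_apply, Pi.mul_apply, Pi.div_apply, h1', h2']
  field_simp
  ring

lemma fderiv_chartChange_vecCoord {n : ℕ} {M : Type*} [TopologicalSpace M]
    [ChartedSpace (Coord n) M] [IsManifold (𝓡 n) ∞ M] {x y p : M}
    (hx : p ∈ (chartAt (Coord n) x).source) (hy : p ∈ (chartAt (Coord n) y).source)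
    (w : TangentSpace (𝓡 n) p) :
    fderiv ℝ (chartChange x y) (extChartAt (𝓡 n) x p) (vecCoord x w) = vecCoord y w := by
  obtain ⟨u, hu, rfl⟩ := exists_chart_point hx
  rw [(extChartAt (𝓡 n) x).right_inv hu, fderiv_chartChange hu hy, chartFrame_vecCoord hu]

lemma isAdaptedFrame_mapIn (hg : IsLorentzMetric g) (hhor : IsKillingHorizon g ξ 𝓗)
    (hι : IsSpacelikeSection g 𝓗 ι) (hN : IsTransverseNull g ξ ι N) {u : Coord d}
    (hu : u ∈ (extChartAt (𝓡 d) c).target)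
    (hx : ι ((extChartAt (𝓡 d) c).symm u) ∈ (chartAt (Coord (d + 2)) x).source) :
    IsAdaptedFrame (tensorIn g x (mapIn ι c x u))
      (vecCoord x (N ((extChartAt (𝓡 d) c).symm u))) (vecIn ξ x (mapIn ι c x u))
      (fun i => fderiv ℝ (mapIn ι c x) u (EuclideanSpace.single i 1)) (induced g ι c u) := by
  set q := (extChartAt (𝓡 d) c).symm u
  have hξ : vecIn ξ x (mapIn ι c x u) = vecCoord x (ξ (ι q)) := vecIn_extChartAt ξ hx
  have h : ∀ v w : TangentSpace (𝓡 (d + 2)) (ι q),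
      tensorIn g x (mapIn ι c x u) (vecCoord x v) (vecCoord x w) = g (ι q) v w :=
    fun v w => tensorIn_vecCoord g hx v w
  refine ⟨fun v w => tensorIn_symm hg.symm _ _ _ _, ?_, ?_, ?_, fun i => ?_, fun i => ?_,
    fun i j => ?_, (posDef_induced hg.symm hι hu).det_pos⟩
  · rw [h]; exact hN.null q
  · rw [hξ, h]; exact hhor.null _ (hι.mem q)
  · rw [hξ, h]; exact hN.normalized q
  · rw [fderiv_mapIn hι.smooth hu hx, h]; exact hN.orthogonal q _
  · rw [hξ, fderiv_mapIn hι.smooth hu hx, h]; exact hhor.orthogonal_push hι q _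
  · exact (induced_eq_mapIn hι.smooth hu hx i j)

/-- The Komar scalar is the exterior derivative of `g(δξ, ·)` on `(ξ, N)`, so one fixed chart can be
used in place of the chart around `ι q`. -/
lemma komarScalar_eq_extDer (hg : IsLorentzMetric g) (hhor : IsKillingHorizon g ξ 𝓗)
    (hX : SmoothVector δξ) (hι : IsSpacelikeSection g 𝓗 ι) (hN : IsTransverseNull g ξ ι N)
    {q : H} (hx : ι q ∈ (chartAt (Coord (d + 2)) x).source) :
    komarScalar g ξ ι N δξ q
      = extDer (tensorIn g x) (vecIn δξ x) (extChartAt (𝓡 (d + 2)) x (ι q))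
        (vecIn ξ x (extChartAt (𝓡 (d + 2)) x (ι q))) (vecCoord x (N q)) := by
  have hG := isMetricAt hg hhor hι hN q
  have hx' : ι q ∈ (extChartAt (𝓡 (d + 2)) x).source := by rwa [extChartAt_source]
  have ht := (extChartAt (𝓡 (d + 2)) x).map_source hx'
  have hl := (extChartAt (𝓡 (d + 2)) x).left_inv hx'
  have hs : (extChartAt (𝓡 (d + 2)) x).symm (extChartAt (𝓡 (d + 2)) x (ι q))
      ∈ (chartAt (Coord (d + 2)) (ι q)).source := by
    rw [hl]
    exact mem_chart_source _ _
  have hcc : chartChange x (ι q) (extChartAt (𝓡 (d + 2)) x (ι q))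
      = extChartAt (𝓡 (d + 2)) (ι q) (ι q) := by rw [chartChange, hl]
  rw [← extDer_chartChange (y := ι q) hg.smooth hX ht hs, ← vecIn_chartChange ξ ht hs,
    fderiv_chartChange_vecCoord hx (mem_chart_source _ _), hcc, hG.extDer_eq
    (vecIn_differentiableAt hX (mem_extChartAt_target _))]
  rfl

/-- Continuity of `N` is not assumed, so `θ(N)`, for the covector `θ = d(g(δξ, ·))(ξ, ·)`, is
obtained indirectly. Expand a fixed vector `v` in the adapted frame: `θ(ξ) = 0` by antisymmetry, the
terms along `e` are continuous, and the coefficient of `θ(N)` is `-ξ · v`, nonzero near the base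
point. -/
lemma continuousOn_komarScalar (hg : IsLorentzMetric g) (hhor : IsKillingHorizon g ξ 𝓗)
    (ha : SmoothVector δξ) (hι : IsSpacelikeSection g 𝓗 ι) (hN : IsTransverseNull g ξ ι N) :
    ContinuousOn (fun u => komarScalar g ξ ι N δξ ((extChartAt (𝓡 d) c).symm u))
      (extChartAt (𝓡 d) c).target := by
  refine fun u hu => ContinuousAt.continuousWithinAt ?_
  set x := ι ((extChartAt (𝓡 d) c).symm u) with hxdef
  have hx : ι ((extChartAt (𝓡 d) c).symm u) ∈ (chartAt (Coord (d + 2)) x).source :=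
    mem_chart_source _ _
  have ht := mapIn_mem_target hx
  have hX := (contDiffAt_mapIn hι.smooth hu hx).continuousAt
  have cg := (contDiffOn_tensorIn hg.smooth x).contDiffAt (target_mem_nhds ht)
  have cξ := (contDiffOn_vecIn hhor.smooth x).contDiffAt (target_mem_nhds ht)
  have ca := (contDiffOn_vecIn ha x).contDiffAt (target_mem_nhds ht)
  set v : Coord (d + 2) := vecCoord x (N ((extChartAt (𝓡 d) c).symm u)) with hv
  set s : Coord d → ℝ := fun z =>
    tensorIn g x (mapIn ι c x z) (vecIn ξ x (mapIn ι c x z)) v with hs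
  have hsc : ContinuousAt s u := ContinuousAt.comp
    (g := fun z => tensorIn g x z (vecIn ξ x z) v)
    ((cg.clm_apply cξ).clm_apply contDiffAt_const).continuousAt hX
  have hs0 : s u ≠ 0 := by
    have h1 : s u = g x (ξ x) (N ((extChartAt (𝓡 d) c).symm u)) := by
      have h2 : vecIn ξ x (mapIn ι c x u) = vecCoord x (ξ x) := vecIn_self ξ x
      simp only [hs, h2]
      exact tensorIn_vecCoord_self g x _ _
    rw [h1, hg.symm]
    have h3 := hN.normalized ((extChartAt (𝓡 d) c).symm u)
    exact ne_of_eq_of_ne h3 (by norm_num)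
  set θ : Coord d → Coord (d + 2) → ℝ := fun z w => extDer (tensorIn g x) (vecIn δξ x)
    (mapIn ι c x z) (vecIn ξ x (mapIn ι c x z)) w with hθ
  have hξc : ContinuousAt (fun z => vecIn ξ x (mapIn ι c x z)) u :=
    ContinuousAt.comp (g := vecIn ξ x) cξ.continuousAt hX
  have hθc : ∀ w : Coord d → Coord (d + 2), ContinuousAt w u →
      ContinuousAt (fun z => θ z (w z)) u := fun w hw => by
    have h1 := continuousAt_fderiv_comp (cg.clm_apply ca) hX
    exact ((h1.clm_apply hξc).clm_apply hw).sub ((h1.clm_apply hw).clm_apply hξc)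
  set E : Fin d → Coord d → Coord (d + 2) := fun i z =>
    fderiv ℝ (mapIn ι c x) z (EuclideanSpace.single i 1) with hE
  have hEc : ∀ i, ContinuousAt (E i) u := fun i =>
    (contDiffAt_fderiv_mapIn hι.smooth hu hx _).continuousAt
  have hγc : ∀ i j, ContinuousAt (fun z => (induced g ι c z)⁻¹ i j) u := fun i j =>
    (contDiffAt_inv_apply (fun i j => contDiffAt_induced hι.smooth hg.smooth hu i j)
      (posDef_induced hg.symm hι hu).det_pos.ne' i j).continuousAt
  have hgc : ContinuousAt (fun z => tensorIn g x (mapIn ι c x z)) u :=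
    (contDiffAt_tensorIn_mapIn hι.smooth hg.smooth hu hx).continuousAt
  set R : Coord d → ℝ := fun z => ∑ i, (∑ j, (induced g ι c z)⁻¹ i j
    * tensorIn g x (mapIn ι c x z) (E j z) v) * θ z (E i z) with hR
  have hRc : ContinuousAt R u := tendsto_finsetSum _ fun i _ =>
    Filter.Tendsto.mul (tendsto_finsetSum _ fun j _ => (hγc i j).mul
      ((hgc.clm_apply (hEc j)).clm_apply continuousAt_const)) (hθc _ (hEc i))
  refine ((hRc.sub (hθc _ (continuousAt_const (y := v)))).div hsc hs0).congr ?_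
  filter_upwards [eventually_mapIn hι.smooth hu hx, hsc.eventually_ne hs0] with z hz hz0
  have hf := isAdaptedFrame_mapIn hg hhor hι hN hz.1 hz.2
  have h1 : komarScalar g ξ ι N δξ ((extChartAt (𝓡 d) c).symm z)
      = θ z (vecCoord x (N ((extChartAt (𝓡 d) c).symm z))) :=
    komarScalar_eq_extDer hg hhor ha hι hN hz.2
  have h2 := hf.expand v
  set L : Coord (d + 2) →L[ℝ] ℝ :=
    fderiv ℝ (fun y => tensorIn g x y (vecIn δξ x y)) (mapIn ι c x z)
      (vecIn ξ x (mapIn ι c x z))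
    - (fderiv ℝ (fun y => tensorIn g x y (vecIn δξ x y)) (mapIn ι c x z)).flip
      (vecIn ξ x (mapIn ι c x z)) with hL
  have hLθ : ∀ w, θ z w = L w := fun w => rfl
  have hLξ : L (vecIn ξ x (mapIn ι c x z)) = 0 := by
    rw [← hLθ]
    exact sub_self _
  have h3 := congrArg L h2
  rw [map_add, map_sub, map_sum, map_smul, map_smul, hLξ, smul_zero, smul_eq_mul] at h3
  simp only [map_smul, smul_eq_mul] at h3
  simp only [← hLθ] at h3
  have h4 : θ z v = 0 - s z * θ z (vecCoord x (N ((extChartAt (𝓡 d) c).symm z))) + R z := h3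
  rw [Pi.div_apply, Pi.sub_apply, h1, h4]
  field_simp
  ring

end Continuity

/-! ### Integration over the section. -/

section FirstLaw

variable {d : ℕ} {M : Type*} [TopologicalSpace M] [ChartedSpace (Coord (d + 2)) M]
  [IsManifold (𝓡 (d + 2)) ∞ M]
  {H : Type*} [TopologicalSpace H] [CompactSpace H] [ChartedSpace (Coord d) H]
  [IsManifold (𝓡 d) ∞ H]
  {g δg : TField (d + 2) M} {ξ δξ : VField (d + 2) M} {𝓗 : Set M} {κ δκ : M → ℝ} {ι : H → M}
  {N : (q : H) → TangentSpace (𝓡 (d + 2)) (ι q)} {GN : ℝ}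

/-- On a compact space a locally finite family has only finitely many members with nonempty support.
-/
lemma exists_finset_support (ρ : SmoothPartitionOfUnity H (𝓡 d) H Set.univ) :
    ∃ S : Finset H, ∀ c ∉ S, ∀ q, ρ c q = 0 := by
  refine ⟨(ρ.locallyFinite.finite_nonempty_of_compact).toFinset, fun c hc q => ?_⟩
  by_contra h
  exact hc ((Set.Finite.mem_toFinset _).2 ⟨q, h⟩)

lemma integral_eq_sum (ρ : SmoothPartitionOfUnity H (𝓡 d) H Set.univ) {S : Finset H}
    (hS : ∀ c ∉ S, ∀ q, ρ c q = 0) (dens : (q : H) → (Fin d → TangentSpace (𝓡 d) q) → ℝ) :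
    integral ρ dens = ∑ c ∈ S, ∫ u in (extChartAt (𝓡 d) c).target,
      ρ c ((extChartAt (𝓡 d) c).symm u)
        * dens ((extChartAt (𝓡 d) c).symm u) (fun a => basisVec c u a) := by
  refine finsum_eq_sum_of_support_subset _ fun c hc => ?_
  by_contra h
  exact hc (by simp [hS c h])

lemma integral_add_sub {E : Type*} [MeasurableSpace E] {μ : MeasureTheory.Measure E}
    {K A D : E → ℝ} (hK : MeasureTheory.Integrable K μ) (hA : MeasureTheory.Integrable A μ)
    (hD : MeasureTheory.Integrable D μ) (a b : ℝ) :
    ∫ u, (K u + (a * A u - b * D u)) ∂μ = ∫ u, K u ∂μ + (a * ∫ u, A u ∂μ - b * ∫ u, D u ∂μ) := by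
  have h1 := MeasureTheory.integral_add hK ((hA.const_mul a).sub (hD.const_mul b))
  have h2 := MeasureTheory.integral_sub (hA.const_mul a) (hD.const_mul b)
  rw [MeasureTheory.integral_const_mul, MeasureTheory.integral_const_mul] at h2
  rw [← h2]
  exact h1

/-- The variation of the Komar charge minus the boundary term is the variation of the surface
gravity, integrated over the section of the horizon. -/
theorem integral_komar_sub_integral_theta (hg : IsLorentzMetric g)
    (hhor : IsKillingHorizon g ξ 𝓗)
    (hvar : IsStationaryVariation g ξ 𝓗 δg δξ) (hκ : IsSurfaceGravity g ξ 𝓗 κ)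
    (hδκ : IsSurfaceGravityVariation g ξ 𝓗 δg δξ κ δκ)
    (hι : IsSpacelikeSection g 𝓗 ι) (hN : IsTransverseNull g ξ ι N)
    (ρ : SmoothPartitionOfUnity H (𝓡 d) H Set.univ)
    (hρ : ρ.IsSubordinate fun c => (chartAt (Coord d) c).source) :
    integral ρ (komarDensity GN g ξ ι N δξ) - integral ρ (thetaDensity GN g ξ ι N δg)
      = -(1 / (8 * Real.pi * GN))
        * integral ρ (fun q w => δκ (ι q) * areaDensity g ι q w) := by
  obtain ⟨S, hS⟩ := exists_finset_support ρ
  have hdiv := sum_integral_surfaceDiv hg hhor hvar hι hN ρ hρ hS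
  have hρc : ∀ c : H, ContinuousOn (fun u => ρ c ((extChartAt (𝓡 d) c).symm u))
      (extChartAt (𝓡 d) c).target := fun c u hu =>
    (contDiffAt_comp_symm (ρ c).contMDiff hu).continuousAt.continuousWithinAt
  have hint : ∀ (c : H) (h : Coord d → ℝ), ContinuousOn h (extChartAt (𝓡 d) c).target →
      MeasureTheory.IntegrableOn (fun u => ρ c ((extChartAt (𝓡 d) c).symm u) * h u)
        (extChartAt (𝓡 d) c).target := fun c h hh =>
    integrableOn_chart (hρ c) ((hρc c).mul hh) fun u _ hu => by
      rw [image_eq_zero_of_notMem_tsupport hu, zero_mul]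
  set k := 1 / (16 * Real.pi * GN) with hk
  have key : ∀ c : H, (∫ u in (extChartAt (𝓡 d) c).target, ρ c ((extChartAt (𝓡 d) c).symm u)
        * komarDensity GN g ξ ι N δξ ((extChartAt (𝓡 d) c).symm u) (fun a => basisVec c u a))
      - ∫ u in (extChartAt (𝓡 d) c).target, ρ c ((extChartAt (𝓡 d) c).symm u)
        * thetaDensity GN g ξ ι N δg ((extChartAt (𝓡 d) c).symm u) (fun a => basisVec c u a)
      = -(1 / (8 * Real.pi * GN)) * (∫ u in (extChartAt (𝓡 d) c).target,
          ρ c ((extChartAt (𝓡 d) c).symm u) * (δκ (ι ((extChartAt (𝓡 d) c).symm u))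
            * areaDensity g ι ((extChartAt (𝓡 d) c).symm u) (fun a => basisVec c u a)))
        + k * ∫ u in (extChartAt (𝓡 d) c).target, ρ c ((extChartAt (𝓡 d) c).symm u)
          * (Real.sqrt (induced g ι c u).det * surfaceDiv g ι δξ c u) := fun c => by
    have hm := (isOpen_extChartAt_target (I := 𝓡 d) c).measurableSet
    have iA := hint c _ ((continuousOn_surfaceGravityVariation hg hhor hvar hκ hδκ hι hN).mul
      (continuousOn_sqrt_det hg hι))
    have iD := hint c _ (continuousOn_sqrt_det_mul_surfaceDiv hg hhor hvar hι hN)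
    have iK := hint c _ ((continuousOn_const (c := k)).mul
      (continuousOn_komarScalar hg hhor hvar.smooth_vector hι hN) |>.mul
      (continuousOn_sqrt_det hg hι))
    have hK : ∫ u in (extChartAt (𝓡 d) c).target, ρ c ((extChartAt (𝓡 d) c).symm u)
        * komarDensity GN g ξ ι N δξ ((extChartAt (𝓡 d) c).symm u) (fun a => basisVec c u a)
        = ∫ u in (extChartAt (𝓡 d) c).target, ρ c ((extChartAt (𝓡 d) c).symm u)
          * (k * komarScalar g ξ ι N δξ ((extChartAt (𝓡 d) c).symm u)
            * Real.sqrt (induced g ι c u).det) :=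
      MeasureTheory.setIntegral_congr_fun hm fun u hu =>
        congrArg (ρ c ((extChartAt (𝓡 d) c).symm u) * ·) (komarDensity_eq hg hhor hι hN hu)
    -- The pointwise identity writes the boundary density as a combination of three integrable ones,
    -- so its own regularity never has to be examined.
    have hΘ : ∫ u in (extChartAt (𝓡 d) c).target, ρ c ((extChartAt (𝓡 d) c).symm u)
        * thetaDensity GN g ξ ι N δg ((extChartAt (𝓡 d) c).symm u) (fun a => basisVec c u a)
        = (∫ u in (extChartAt (𝓡 d) c).target, ρ c ((extChartAt (𝓡 d) c).symm u)
            * (k * komarScalar g ξ ι N δξ ((extChartAt (𝓡 d) c).symm u)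
              * Real.sqrt (induced g ι c u).det))
          + (2 * k * (∫ u in (extChartAt (𝓡 d) c).target, ρ c ((extChartAt (𝓡 d) c).symm u)
              * (δκ (ι ((extChartAt (𝓡 d) c).symm u))
                * areaDensity g ι ((extChartAt (𝓡 d) c).symm u) (fun a => basisVec c u a)))
            - k * ∫ u in (extChartAt (𝓡 d) c).target, ρ c ((extChartAt (𝓡 d) c).symm u)
              * (Real.sqrt (induced g ι c u).det * surfaceDiv g ι δξ c u)) := by
      refine (MeasureTheory.setIntegral_congr_fun hm fun u hu => ?_).trans
        (integral_add_sub iK iA iD (2 * k) k)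
      have h1 := komarDensity_sub_thetaDensity (GN := GN) hg hhor hvar hκ hδκ hι hN hu
      rw [komarDensity_eq hg hhor hι hN hu, sub_eq_iff_eq_add, ← sub_eq_iff_eq_add'] at h1
      rw [← h1, ← hk]
      simp only [Pi.mul_apply]
      ring
    have h8 : -(1 / (8 * Real.pi * GN)) = -(2 * k) := by
      rw [hk]
      ring
    rw [hΘ, hK, h8]
    ring
  -- Summed over the charts, the divergence terms cancel by `hdiv`.
  rw [integral_eq_sum ρ hS, integral_eq_sum ρ hS, integral_eq_sum ρ hS, ← Finset.sum_sub_distrib,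
    Finset.sum_congr rfl fun c _ => key c, Finset.sum_add_distrib, ← Finset.mul_sum,
    ← Finset.mul_sum, hdiv, mul_zero, add_zero]

lemma integral_const_mul_area (ρ : SmoothPartitionOfUnity H (𝓡 d) H Set.univ) (k : ℝ) :
    integral ρ (fun q w => k * areaDensity g ι q w) = k * integral ρ (areaDensity g ι) := by
  obtain ⟨S, hS⟩ := exists_finset_support ρ
  rw [integral_eq_sum ρ hS, integral_eq_sum ρ hS, Finset.mul_sum]
  refine Finset.sum_congr rfl fun c _ => ?_
  rw [← MeasureTheory.integral_const_mul]
  congr 1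
  funext u
  ring

end FirstLaw

end KillingHorizon

end

theorem mainTheorem3 {d : ℕ}
    {M : Type*} [TopologicalSpace M] [ChartedSpace (KillingHorizon.Coord (d + 2)) M]
    [IsManifold (𝓡 (d + 2)) ∞ M]
    {H : Type*} [TopologicalSpace H] [CompactSpace H] [T2Space H]
    [ChartedSpace (KillingHorizon.Coord d) H] [IsManifold (𝓡 d) ∞ H]
    (g δg : KillingHorizon.TField (d + 2) M) (ξ δξ : KillingHorizon.VField (d + 2) M)
    (𝓗 : Set M) (κ δκ : M → ℝ) (ι : H → M)
    (N : (q : H) → TangentSpace (𝓡 (d + 2)) (ι q)) (GN : ℝ) (hGN : 0 < GN)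
    (hg : KillingHorizon.IsLorentzMetric g)
    (hhor : KillingHorizon.IsKillingHorizon g ξ 𝓗)
    (hvar : KillingHorizon.IsStationaryVariation g ξ 𝓗 δg δξ)
    (hκ : KillingHorizon.IsSurfaceGravity g ξ 𝓗 κ)
    (hδκ : KillingHorizon.IsSurfaceGravityVariation g ξ 𝓗 δg δξ κ δκ)
    (hι : KillingHorizon.IsSpacelikeSection g 𝓗 ι)
    (hN : KillingHorizon.IsTransverseNull g ξ ι N)
    (ρ : SmoothPartitionOfUnity H (𝓡 d) H Set.univ)
    (hρ : ρ.IsSubordinate fun c => (chartAt (KillingHorizon.Coord d) c).source) :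
    (KillingHorizon.integral ρ (KillingHorizon.komarDensity GN g ξ ι N δξ)
        - KillingHorizon.integral ρ (KillingHorizon.thetaDensity GN g ξ ι N δg)
      = -(1 / (8 * Real.pi * GN)) * KillingHorizon.integral ρ
          (fun q w => δκ (ι q) * KillingHorizon.areaDensity g ι q w)) ∧
    ∀ c : ℝ, (∀ q, δκ (ι q) = c) →
      KillingHorizon.integral ρ (KillingHorizon.komarDensity GN g ξ ι N δξ)
          - KillingHorizon.integral ρ (KillingHorizon.thetaDensity GN g ξ ι N δg)
        = -(KillingHorizon.integral ρ (KillingHorizon.areaDensity g ι)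
            / (8 * Real.pi * GN)) * c := by
  have h := KillingHorizon.integral_komar_sub_integral_theta (GN := GN) hg hhor hvar hκ hδκ hι hN
    ρ hρ
  refine ⟨h, fun c hc => ?_⟩
  simp only [hc] at h
  rw [h, KillingHorizon.integral_const_mul_area]
  ring
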